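/- Let $K$ be a field and let $R=KQ=\bigoplus_{p\ge 0}R_p$ be the path algebra of a finite quiver $Q$ (for instance a finitely generated free algebra), graded by the length of paths, with $F_pR=\bigoplus_{i\le p}R_i$. Let $\succeq_{gr}$ be a graded monomial ordering on the set $\mathcal B$ of paths, that is, a total ordering compatible with the left and right multiplications by paths that do not vanish, in which a longer path is always larger. For $0\neq f\in R$ with homogeneous components $f_i$ and of degree $d$ put $\mathbf{LH}(f)=f_d$ and $f^*=\sum_{i\le d}t^{d-i}f_i\in R[t]$ ($\mathbf{LH}(0)=0$ and $0^*=0$); let $\mathbf{LM}(f)$ be the largest path occurring in $f$. $R[t]$ has a central variable $t$ and is graded by $R[t]_p=\sum_{i+j=p}R_it^j$; its monomials $wt^r$ ($w\in\mathcal B$) are ordered by $w_1t^{r_1}\succ w_2t^{r_2}$ iff $w_1\succ w_2$, or $w_1=w_2$ and $r_1>r_2$. A subset $\mathcal G$ of a two-sided ideal $J$ (of $R$ or of $R[t]$) is a Gröbner basis of $J$ if the leading monomials of the nonzero elements of $\mathcal G$ and those of the nonzero elements of $J$ generate the same two-sided ideal. Let $I$ be a two-sided ideal of $R$ and $A=R/I$,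 filtered by $F_pA=(F_pR+I)/I$. Let $G(A)=\bigoplus_pF_pA/F_{p-1}A$ and $\widetilde A=\bigoplus_pF_pA$ be its associated graded algebra and its Rees algebra. Definitions. An $\mathbb N$-graded algebra $S$ is Koszul in the classical sense if $S_0$ is semisimple and the graded left $S$-module $S_0=S/S_{>0}$ has a graded projective resolution $\cdots\to P_1\to P_0\to S_0\to 0$ with $P_i$ generated in degree $i$. For $N\ge 2$, a graded quotient $R/J$ is $N$-Koszul if $J$ is generated by homogeneous elements of degree $N$ and $(R/J)_0$ is semisimple and has a graded projective resolution with $P_{2j}$ generated in degree $Nj$ and $P_{2j+1}$ in degree $Nj+1$ (Berger). For $P\subseteq F_NR$ with $I=\langle P\rangle$, put $P_N=\{f\in P: f\notin F_{N-1}R\}$; the algebra $A=R/\langle P\rangle$ is Koszul in the sense of Berger–Ginzburg if $R/\langle\mathbf{LH}(P_N)\rangle$ is $N$-Koszul and the natural epimorphism $R/\langle\mathbf{LH}(P_N)\rangle\to G(A)$ is an isomorphism. Let $\mathcal G$ be a Gröbner basis of $I$ with respect to $\succeq_{gr}$. Then: (i) $A$ has the general PBW property with respect to $\mathcal G$, that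 is, $\mathcal G$ generates $I$ and the natural graded epimorphism $R/\langle\mathbf{LH}(\mathcal G)\rangle\to G(A)$, sending the class of $f\in R_p$ to the class of $f+I$ in $F_pA/F_{p-1}A$, is an isomorphism. Moreover, $\mathbf{LH}(\mathcal G)=\{\mathbf{LH}(g): g\in\mathcal G\}$ is a Gröbner basis of $\langle\mathbf{LH}(I)\rangle$. (ii) If $\mathcal G\subseteq F_2R$, then $G(A)$ is Koszul in the classical sense. If $N\ge 2$, $\mathcal G\subseteq F_NR$ and $R/\langle\mathbf{LH}(\mathcal G)\rangle$ is $N$-Koszul, then $A$ is Koszul in the sense of Berger–Ginzburg, with respect to $P=\mathcal G$ and, more generally, to every $P$ with $\mathcal G\subseteq P\subseteq I\cap F_NR$ (for example the $K$-span of $\mathcal G$). (iii) There is an isomorphism of graded algebras $R[t]/\langle\mathcal G^*\rangle\cong\widetilde A$, sending the class of $F\in R[t]_p$ to $F|_{t=1}+I\in F_pA$. Moreover, $\mathcal G^*=\{g^*: g\in\mathcal G\}$ is a Gröbner basis of the homogenization ideal $\langle I^*\rangle$ of $R[t]$ generated by $I^*=\{f^*: f\in I\}$. (iv) If $\mathcal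 G\subseteq F_2R$, then $\widetilde A$ is Koszul in the classical sense. -/

import Mathlib

open scoped Polynomial DirectSum

noncomputable section

universe u v w

/-! ## Path algebras -/

/-- A finite directed path in the quiver `V`; the paths of length `0` are the vertices. -/
@[ext] structure QPath (V : Type v) [Quiver.{w} V] where
  src : V
  tgt : V
  path : Quiver.Path src tgt

namespace QPath

variable {V : Type v} [Quiver.{w} V]

/-- The number of arrows of a path. -/
def length (p : QPath V) : ℕ := p.path.length

/-- The vertex `a`, as a path of length `0`. -/
def vertex (a : V) : QPath V := ⟨a, a, Quiver.Path.nil⟩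

open Classical in
/-- Concatenation of paths; it is defined if and only if the first path ends where the second one
starts. -/
def comp? (p q : QPath V) : Option (QPath V) :=
  if h : q.src = p.tgt then some ⟨p.src, q.tgt, p.path.comp (q.path.cast h rfl)⟩ else none

theorem comp?_mk {a b c : V} (p : Quiver.Path a b) (q : Quiver.Path b c) :
    comp? ⟨a, b, p⟩ ⟨b, c, q⟩ = some ⟨a, c, p.comp q⟩ := by
  simp [comp?]

theorem comp?_of_ne {p q : QPath V} (h : q.src ≠ p.tgt) : comp? p q = none := by
  simp [comp?, h]

theorem comp?_eq_some {p q r : QPath V} (h : comp? p q = some r) :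
    r.length = p.length + q.length := by
  obtain ⟨a, b, p⟩ := p
  obtain ⟨b', c, q⟩ := q
  by_cases hb : b' = b
  · subst hb
    rw [comp?_mk] at h
    obtain rfl := Option.some.inj h
    simp [length]
  · rw [comp?_of_ne hb] at h
    cases h

theorem comp?_assoc (p q r : QPath V) :
    (comp? p q).bind (fun s => comp? s r) = (comp? q r).bind (fun s => comp? p s) := by
  obtain ⟨a, b, p⟩ := p
  obtain ⟨b', c, q⟩ := q
  obtain ⟨c', d, r⟩ := r
  by_cases hb : b' = b
  · subst hb
    by_cases hc : c' = c
    · subst hc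
      simp [comp?_mk]
    · simp [comp?_mk, comp?_of_ne, hc]
  · by_cases hc : c' = c
    · subst hc
      simp [comp?_mk, comp?_of_ne, hb]
    · simp [comp?_of_ne, hb, hc]

end QPath

/-- The path algebra `KQ` of a quiver with vertex set `V`: the vector space with the paths as a
basis. -/
def PathAlgebra (K : Type u) (V : Type v) [Field K] [Quiver.{w} V] : Type (max u v w) :=
  QPath V →₀ K

namespace PathAlgebra

variable (K : Type u) {V : Type v} [Field K] [Quiver.{w} V]

instance : AddCommGroup (PathAlgebra K V) := inferInstanceAs (AddCommGroup (QPath V →₀ K))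
instance : Module K (PathAlgebra K V) := inferInstanceAs (Module K (QPath V →₀ K))

/-- The basis element of the path algebra given by a path. -/
def ofPath (p : QPath V) : PathAlgebra K V := Finsupp.single p 1

/-- The coefficient of a path in an element of the path algebra. -/
def coeff {K : Type u} [Field K] (f : PathAlgebra K V) (p : QPath V) : K :=
  (show QPath V →₀ K from f) p

/-- The paths that occur in an element with a nonzero coefficient. -/
def support {K : Type u} [Field K] (f : PathAlgebra K V) : Finset (QPath V) :=
  Finsupp.support (show QPath V →₀ K from f)

/-- The product of two paths in the path algebra: their concatenation, or `0`. -/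
def mulPath (p q : QPath V) : PathAlgebra K V := ((p.comp? q).map (ofPath K)).getD 0

/-- The bilinear extension of the product of paths. -/
def mulBilin : PathAlgebra K V →ₗ[K] PathAlgebra K V →ₗ[K] PathAlgebra K V :=
  Finsupp.linearCombination K fun p : QPath V =>
    (Finsupp.linearCombination K fun q : QPath V => mulPath K p q :
      (QPath V →₀ K) →ₗ[K] PathAlgebra K V)

theorem mulBilin_ofPath (p q : QPath V) :
    mulBilin K (ofPath K p) (ofPath K q) = mulPath K p q := by
  have h1 : mulBilin K (ofPath K p) = (Finsupp.linearCombination K fun q : QPath V => mulPath K p q :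
      (QPath V →₀ K) →ₗ[K] PathAlgebra K V) := by
    refine (Finsupp.linearCombination_single K (1 : K) p).trans ?_
    exact one_smul _ _
  rw [h1]
  refine (Finsupp.linearCombination_single K (1 : K) q).trans ?_
  exact one_smul _ _

variable {K} in
theorem induction_lin {P : PathAlgebra K V → Prop} (f : PathAlgebra K V) (h0 : P 0)
    (hadd : ∀ f g, P f → P g → P (f + g)) (hsmul : ∀ (c : K) f, P f → P (c • f))
    (hpath : ∀ p, P (ofPath K p)) : P f := by
  refine Finsupp.induction_linear f h0 hadd fun p c => ?_
  have h := hsmul c _ (hpath p)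
  have e : c • ofPath K p = (Finsupp.single p c : QPath V →₀ K) :=
    (Finsupp.smul_single' c p 1).trans (by rw [mul_one])
  rwa [e] at h

theorem mulBilin_assoc (f g h : PathAlgebra K V) :
    mulBilin K (mulBilin K f g) h = mulBilin K f (mulBilin K g h) := by
  induction f using induction_lin with
  | h0 => simp
  | hadd f f' hf hf' => simp [hf, hf']
  | hsmul c f hf => simp [hf]
  | hpath p =>
    induction g using induction_lin with
    | h0 => simp
    | hadd f f' hf hf' => simp [hf, hf']
    | hsmul c f hf => simp [hf]
    | hpath q =>
      induction h using induction_lin with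
      | h0 => simp
      | hadd f f' hf hf' => simp [hf, hf']
      | hsmul c f hf => simp [hf]
      | hpath r =>
        have h := QPath.comp?_assoc p q r
        rw [mulBilin_ofPath, mulBilin_ofPath, mulPath, mulPath]
        rcases hpq : p.comp? q with _ | s <;> rcases hqr : q.comp? r with _ | t <;>
          rw [hpq, hqr] at h <;> simp [mulBilin_ofPath, mulPath] at h ⊢ <;> 
            (first | rw [h] | rw [← h]) <;> rfl

variable [Fintype V]

/-- The identity of the path algebra: the sum of all vertices. -/
def unit : PathAlgebra K V := ∑ a : V, ofPath K (QPath.vertex a)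

theorem unit_mul (f : PathAlgebra K V) : mulBilin K (unit K) f = f := by
  induction f using induction_lin with
  | h0 => simp
  | hadd f f' hf hf' => simp [hf, hf']
  | hsmul c f hf => simp [hf]
  | hpath p =>
    obtain ⟨a, b, p⟩ := p
    rw [unit, map_sum, LinearMap.sum_apply, Finset.sum_eq_single a]
    · rw [mulBilin_ofPath, mulPath, QPath.vertex, QPath.comp?_mk]
      simp
    · intro c _ hc
      rw [mulBilin_ofPath, mulPath, QPath.comp?_of_ne (by simpa [QPath.vertex] using hc.symm)]
      rfl
    · simp

theorem mul_unit (f : PathAlgebra K V) : mulBilin K f (unit K) = f := by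
  induction f using induction_lin with
  | h0 => simp
  | hadd f f' hf hf' => simp [hf, hf']
  | hsmul c f hf => simp [hf]
  | hpath p =>
    obtain ⟨a, b, p⟩ := p
    rw [unit, map_sum, Finset.sum_eq_single b]
    · rw [mulBilin_ofPath, mulPath, QPath.vertex, QPath.comp?_mk]
      simp
    · intro c _ hc
      rw [mulBilin_ofPath, mulPath, QPath.comp?_of_ne (by simpa [QPath.vertex] using hc)]
      rfl
    · simp

instance : Ring (PathAlgebra K V) :=
  { (inferInstance : AddCommGroup (PathAlgebra K V)) with
    mul := fun f g => mulBilin K f g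
    one := unit K
    left_distrib := fun f g h => map_add (mulBilin K f) g h
    right_distrib := fun f g h => LinearMap.map_add₂ (mulBilin K) f g h
    zero_mul := fun f => LinearMap.map_zero₂ (mulBilin K) f
    mul_zero := fun f => map_zero (mulBilin K f)
    mul_assoc := mulBilin_assoc K
    one_mul := unit_mul K
    mul_one := mul_unit K }

instance : Algebra K (PathAlgebra K V) :=
  Algebra.ofModule (fun c f g => LinearMap.map_smul₂ (mulBilin K) c f g)
    (fun c f g => map_smul (mulBilin K f) c g)

theorem ofPath_mul_ofPath (p q : QPath V) : ofPath K p * ofPath K q = mulPath K p q :=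
  mulBilin_ofPath K p q

end PathAlgebra

namespace PathAlgebra

variable {K : Type u} {V : Type v} [Field K] [Quiver.{w} V]

/-! ### Length grading, leading homogeneous parts, homogenization -/

theorem coeff_add (f g : PathAlgebra K V) (p : QPath V) :
    (f + g).coeff p = f.coeff p + g.coeff p := rfl

theorem coeff_smul (c : K) (f : PathAlgebra K V) (p : QPath V) :
    (c • f).coeff p = c * f.coeff p := rfl

theorem coeff_zero (p : QPath V) : (0 : PathAlgebra K V).coeff p = 0 := rfl

variable (K V) in
/-- The elements all of whose paths satisfy a condition `C`. -/
def spanPaths (C : QPath V → Prop) : Submodule K (PathAlgebra K V) where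
  carrier := {f | ∀ w, f.coeff w ≠ 0 → C w}
  zero_mem' w h := absurd (coeff_zero w) h
  add_mem' {f g} hf hg w h := by
    by_cases h1 : f.coeff w = 0
    · exact hg w fun h2 => h (by rw [coeff_add, h1, h2, add_zero])
    · exact hf w h1
  smul_mem' c f hf w h := hf w fun h1 => h (by rw [coeff_smul, h1, mul_zero])

variable (K V) in
/-- `R_p`: the homogeneous elements of degree `p` of the path algebra `R` (and `0`). -/
def homogeneous (p : ℕ) : Submodule K (PathAlgebra K V) := spanPaths K V fun w => w.length = p

variable (K V) in
/-- `F_p R`, the sum of the `R_i` with `i ≤ p`. -/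
def filtered (p : ℕ) : Submodule K (PathAlgebra K V) := spanPaths K V fun w => w.length ≤ p

open Classical in
/-- The homogeneous component of degree `p` of `f`. -/
def component (p : ℕ) (f : PathAlgebra K V) : PathAlgebra K V :=
  Finsupp.filter (fun w : QPath V => w.length = p) f

/-- The degree `d(f)`: the largest length of a path occurring in `f` (and `0` for `f = 0`). -/
def degree (f : PathAlgebra K V) : ℕ := f.support.sup QPath.length

/-- The leading homogeneous part `LH(f)` (with `LH(0) = 0`). -/
def LH (f : PathAlgebra K V) : PathAlgebra K V := component f.degree f

variable [Fintype V]

/-- The homogenization `f^* = f_d + t f_{d-1} + ... + t^d f_0`, where `d = d(f)`. -/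
def homogenize (f : PathAlgebra K V) : (PathAlgebra K V)[X] :=
  ∑ i ∈ Finset.range (f.degree + 1), Polynomial.monomial (f.degree - i) (component i f)

variable (K V) in
/-- `R[t]_p`: the homogeneous elements of degree `p` of `R[t]` for the mixed gradation. -/
def polyHomogeneous (p : ℕ) : Submodule K (PathAlgebra K V)[X] where
  carrier := {F | ∀ r w, (F.coeff r).coeff w ≠ 0 → w.length + r = p}
  zero_mem' r w h := absurd (coeff_zero w) h
  add_mem' {F G} hF hG r w h := by
    by_cases h1 : (F.coeff r).coeff w = 0
    · exact hG r w fun h2 => h (by rw [Polynomial.coeff_add, coeff_add, h1, h2, add_zero])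
    · exact hF r w h1
  smul_mem' c F hF r w h := hF r w fun h1 => h (by
    rw [Polynomial.coeff_smul, coeff_smul, h1, mul_zero])

/-- The ideal `⟨LH(S)⟩` generated by the leading homogeneous parts of the elements of `S`. -/
def idealLH (S : Set (PathAlgebra K V)) : TwoSidedIdeal (PathAlgebra K V) :=
  TwoSidedIdeal.span (LH '' S)

/-- The ideal `⟨S^*⟩` of `R[t]` generated by the homogenizations of the elements of `S`;
`⟨I^*⟩` is the homogenization ideal of an ideal `I`. -/
def idealHomogenize (S : Set (PathAlgebra K V)) : TwoSidedIdeal (PathAlgebra K V)[X] :=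
  TwoSidedIdeal.span (homogenize '' S)

/-! ### Monomial orderings and Gröbner bases -/

variable (V) in
/-- A graded monomial ordering on the paths: a total order that is compatible with those left and
right multiplications that do not vanish, and that refines the comparison of lengths. (In a finite
quiver there are finitely many paths of each length, so such an order is a well-order, and a path
is never smaller than one of its subpaths.) -/
structure IsGradedMonomialOrder [LinearOrder (QPath V)] : Prop where
  mul_left : ∀ s u v su sv : QPath V, u < v → s.comp? u = some su → s.comp? v = some sv → su < sv
  mul_right : ∀ s u v us vs : QPath V, u < v → u.comp? s = some us → v.comp? s = some vs → us < vs
  of_length_lt : ∀ u v : QPath V, u.length < v.length → u < v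

section Groebner

variable [LinearOrder (QPath V)]

/-- `w` is the leading monomial `LM(f)` of `f` (the element `0` has none). -/
def IsLM (f : PathAlgebra K V) (w : QPath V) : Prop :=
  f.coeff w ≠ 0 ∧ ∀ w', f.coeff w' ≠ 0 → w' ≤ w

/-- The monomial ideal `⟨LM(S)⟩`. -/
def idealLM (S : Set (PathAlgebra K V)) : TwoSidedIdeal (PathAlgebra K V) :=
  TwoSidedIdeal.span {m | ∃ f ∈ S, ∃ w, IsLM f w ∧ m = ofPath K w}

/-- `G` is a Gröbner basis of the two-sided ideal `I`. -/
def IsGroebnerBasis (G : Set (PathAlgebra K V)) (I : TwoSidedIdeal (PathAlgebra K V)) : Prop :=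
  G ⊆ I ∧ idealLM (I : Set (PathAlgebra K V)) = idealLM G

/-- `w t^r` is the leading monomial of the element `F` of `R[t]`, for the order with
`w₁ t^r₁ > w₂ t^r₂` if and only if `w₁ > w₂`, or `w₁ = w₂` and `r₁ > r₂`. -/
def IsPolyLM (F : (PathAlgebra K V)[X]) (w : QPath V) (r : ℕ) : Prop :=
  (F.coeff r).coeff w ≠ 0 ∧
    ∀ w' r', (F.coeff r').coeff w' ≠ 0 → w' < w ∨ w' = w ∧ r' ≤ r

/-- The monomial ideal `⟨LM(S)⟩` of `R[t]`. -/
def polyIdealLM (S : Set (PathAlgebra K V)[X]) : TwoSidedIdeal (PathAlgebra K V)[X] :=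
  TwoSidedIdeal.span
    {m | ∃ F ∈ S, ∃ w r, IsPolyLM F w r ∧ m = Polynomial.monomial r (ofPath K w)}

/-- `G` is a Gröbner basis of the two-sided ideal `J` of `R[t]`. -/
def IsPolyGroebnerBasis (G : Set (PathAlgebra K V)[X]) (J : TwoSidedIdeal (PathAlgebra K V)[X]) :
    Prop :=
  G ⊆ J ∧ polyIdealLM (J : Set (PathAlgebra K V)[X]) = polyIdealLM G

end Groebner

end PathAlgebra

/-! ## Quotients, filtrations, associated graded algebras, Rees algebras -/

/-- The quotient algebra `S / J` by a two-sided ideal. -/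
abbrev TwoSidedIdeal.QuotientAlg {S : Type*} [Ring S] (J : TwoSidedIdeal S) : Type _ :=
  S ⧸ TwoSidedIdeal.asIdeal J

/-- The canonical projection `S → S / J`. -/
def TwoSidedIdeal.proj (K : Type*) {S : Type*} [CommRing K] [Ring S] [Algebra K S]
    (J : TwoSidedIdeal S) : S →ₐ[K] J.QuotientAlg :=
  Ideal.Quotient.mkₐ K (TwoSidedIdeal.asIdeal J)

/-- The images in `S / J` of the homogeneous parts of `S`. -/
def quotientGrading {K S : Type*} [CommRing K] [Ring S] [Algebra K S] (𝒮 : ℕ → Submodule K S)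
    (J : TwoSidedIdeal S) (p : ℕ) : Submodule K J.QuotientAlg :=
  (𝒮 p).map (J.proj K).toLinearMap

/-- An ascending `ℕ`-filtration of a `K`-algebra; the terms of negative index are `0`. -/
structure AlgFiltration (K A : Type*) [CommRing K] [Ring A] [Algebra K A] where
  F : ℕ → Submodule K A
  mono : Monotone F
  one_mem : (1 : A) ∈ F 0
  mul_mem : ∀ {p q : ℕ} {a b : A}, a ∈ F p → b ∈ F q → a * b ∈ F (p + q)
  exhaustive : ∀ a : A, ∃ p, a ∈ F p

namespace AlgFiltration

variable {K A : Type*} [CommRing K] [Ring A] [Algebra K A] (Φ : AlgFiltration K A)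

/-- `F_{p-1} A`, which is `0` for `p = 0`. -/
def pred : ℕ → Submodule K A
  | 0 => ⊥
  | p + 1 => Φ.F p

instance : SetLike.GradedMonoid Φ.F where
  one_mem := Φ.one_mem
  mul_mem _ _ _ _ := Φ.mul_mem

/-- The Rees algebra: the direct sum of the `F_p A`, with the multiplication
`F_p A × F_q A → F_{p+q} A` of `A`. -/
abbrev Rees : Type _ := ⨁ p, Φ.F p

/-- The homogeneous part of degree `p` of the Rees algebra. -/
def reesGrading (p : ℕ) : Submodule K Φ.Rees :=
  LinearMap.range (DirectSum.lof K ℕ (fun p => Φ.F p) p)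

/-- An element of `F_p A`, as a homogeneous element of degree `p` of the Rees algebra. -/
def toRees (p : ℕ) (a : A) (ha : a ∈ Φ.F p) : Φ.Rees :=
  DirectSum.of (fun p => Φ.F p) p ⟨a, ha⟩

/-- `G(A)_p = F_p A / F_{p-1} A`. -/
def GrPart (p : ℕ) : Type _ := Φ.F p ⧸ (Φ.pred p).submoduleOf (Φ.F p)

instance (p : ℕ) : AddCommGroup (Φ.GrPart p) :=
  inferInstanceAs (AddCommGroup (Φ.F p ⧸ (Φ.pred p).submoduleOf (Φ.F p)))

instance (p : ℕ) : Module K (Φ.GrPart p) :=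
  inferInstanceAs (Module K (Φ.F p ⧸ (Φ.pred p).submoduleOf (Φ.F p)))

/-- The class in `G(A)_p` of an element of `F_p A`. -/
def cls (p : ℕ) (a : A) (ha : a ∈ Φ.F p) : Φ.GrPart p := Submodule.Quotient.mk ⟨a, ha⟩

theorem cls_eq_cls {p : ℕ} {a b : A} (ha : a ∈ Φ.F p) (hb : b ∈ Φ.F p) :
    Φ.cls p a ha = Φ.cls p b hb ↔ a - b ∈ Φ.pred p := by
  exact Submodule.Quotient.eq ((Φ.pred p).submoduleOf (Φ.F p))

theorem cls_surj {p : ℕ} (x : Φ.GrPart p) : ∃ a ha, x = Φ.cls p a ha := by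
  obtain ⟨⟨a, ha⟩, rfl⟩ := Submodule.Quotient.mk_surjective _ x
  exact ⟨a, ha, rfl⟩

theorem mul_pred_mem {p q : ℕ} {a b : A} (ha : a ∈ Φ.F p) (hb : b ∈ Φ.pred q) :
    a * b ∈ Φ.pred (p + q) := by
  cases q with
  | zero =>
    obtain rfl : b = 0 := hb
    rw [mul_zero]
    exact zero_mem _
  | succ q => exact Φ.mul_mem ha hb

theorem pred_mul_mem {p q : ℕ} {a b : A} (ha : a ∈ Φ.pred p) (hb : b ∈ Φ.F q) :
    a * b ∈ Φ.pred (p + q) := by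
  cases p with
  | zero =>
    obtain rfl : a = 0 := ha
    rw [zero_mul]
    exact zero_mem _
  | succ p =>
    rw [Nat.succ_add_eq_add_succ]
    exact Φ.mul_mem ha hb

/-- The multiplication `G(A)_p × G(A)_q → G(A)_{p+q}` induced by that of `A`. -/
def grMul {p q : ℕ} : Φ.GrPart p → Φ.GrPart q → Φ.GrPart (p + q) :=
  Quotient.map₂ (fun a b => ⟨a.1 * b.1, Φ.mul_mem a.2 b.2⟩) (by
    rintro ⟨a, ha⟩ ⟨a', ha'⟩ h ⟨b, hb⟩ ⟨b', hb'⟩ h'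
    have h1 : a - a' ∈ Φ.pred p := (Submodule.quotientRel_def ((Φ.pred p).submoduleOf (Φ.F p))).1 h
    have h2 : b - b' ∈ Φ.pred q := (Submodule.quotientRel_def ((Φ.pred q).submoduleOf (Φ.F q))).1 h'
    refine (Submodule.quotientRel_def _).2 ?_
    have h3 : a * b - a' * b' = a * (b - b') + (a - a') * b' := by noncomm_ring
    change a * b - a' * b' ∈ Φ.pred (p + q)
    rw [h3]
    exact add_mem (Φ.mul_pred_mem ha h2) (Φ.pred_mul_mem h1 hb'))

theorem cls_add {p : ℕ} {a b : A} (ha : a ∈ Φ.F p) (hb : b ∈ Φ.F p) :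
    Φ.cls p a ha + Φ.cls p b hb = Φ.cls p (a + b) (add_mem ha hb) := rfl

theorem cls_zero {p : ℕ} : (0 : Φ.GrPart p) = Φ.cls p 0 (zero_mem _) := rfl

theorem mk_cls {p q : ℕ} {a b : A} (h : p = q) (hab : a = b) (ha : a ∈ Φ.F p) (hb : b ∈ Φ.F q) :
    GradedMonoid.mk (A := Φ.GrPart) p (Φ.cls p a ha) = GradedMonoid.mk q (Φ.cls q b hb) := by
  subst h hab
  rfl

theorem algebraMap_mem (c : K) : algebraMap K A c ∈ Φ.F 0 := by
  rw [Algebra.algebraMap_eq_smul_one]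
  exact Submodule.smul_mem _ _ Φ.one_mem

instance : GradedMonoid.GMul Φ.GrPart := ⟨Φ.grMul⟩

instance : GradedMonoid.GOne Φ.GrPart := ⟨Φ.cls 0 1 Φ.one_mem⟩

theorem gMul_cls {p q : ℕ} {a b : A} (ha : a ∈ Φ.F p) (hb : b ∈ Φ.F q) :
    GradedMonoid.GMul.mul (A := Φ.GrPart) (Φ.cls p a ha) (Φ.cls q b hb) =
      Φ.cls (p + q) (a * b) (Φ.mul_mem ha hb) := rfl

instance : DirectSum.GRing Φ.GrPart where
  mul_zero := by
    intro p q x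
    obtain ⟨a, ha, rfl⟩ := Φ.cls_surj x
    rw [cls_zero, gMul_cls, cls_zero, cls_eq_cls]
    simp
  zero_mul := by
    intro p q x
    obtain ⟨a, ha, rfl⟩ := Φ.cls_surj x
    rw [cls_zero, gMul_cls, cls_zero, cls_eq_cls]
    simp
  mul_add := by
    intro p q x y z
    obtain ⟨a, ha, rfl⟩ := Φ.cls_surj x
    obtain ⟨b, hb, rfl⟩ := Φ.cls_surj y
    obtain ⟨c, hc, rfl⟩ := Φ.cls_surj z
    simp only [cls_add, gMul_cls, mul_add]
  add_mul := by
    intro p q x y z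
    obtain ⟨a, ha, rfl⟩ := Φ.cls_surj x
    obtain ⟨b, hb, rfl⟩ := Φ.cls_surj y
    obtain ⟨c, hc, rfl⟩ := Φ.cls_surj z
    simp only [cls_add, gMul_cls, add_mul]
  one_mul := by
    rintro ⟨p, x⟩
    obtain ⟨a, ha, rfl⟩ := Φ.cls_surj x
    exact Φ.mk_cls (zero_add p) (one_mul a) _ _
  mul_one := by
    rintro ⟨p, x⟩
    obtain ⟨a, ha, rfl⟩ := Φ.cls_surj x
    exact Φ.mk_cls (add_zero p) (mul_one a) _ _
  mul_assoc := by
    rintro ⟨p, x⟩ ⟨q, y⟩ ⟨r, z⟩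
    obtain ⟨a, ha, rfl⟩ := Φ.cls_surj x
    obtain ⟨b, hb, rfl⟩ := Φ.cls_surj y
    obtain ⟨c, hc, rfl⟩ := Φ.cls_surj z
    exact Φ.mk_cls (add_assoc p q r) (mul_assoc a b c) _ _
  natCast n := n • Φ.cls 0 1 Φ.one_mem
  natCast_zero := zero_smul _ _
  natCast_succ n := succ_nsmul _ n
  intCast n := n • Φ.cls 0 1 Φ.one_mem
  intCast_ofNat n := natCast_zsmul _ n
  intCast_negSucc_ofNat n := negSucc_zsmul _ n

instance : DirectSum.GAlgebra K Φ.GrPart where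
  toFun :=
    { toFun := fun c => Φ.cls 0 (algebraMap K A c) (Φ.algebraMap_mem c)
      map_zero' := by
        rw [cls_zero, cls_eq_cls]
        simp
      map_add' := fun c d => by
        rw [cls_add, cls_eq_cls]
        simp }
  map_one := by
    refine (Φ.cls_eq_cls _ _).2 ?_
    simp
  map_mul c d := Φ.mk_cls (add_zero 0).symm (map_mul (algebraMap K A) c d) _ _
  commutes := by
    rintro c ⟨p, x⟩
    obtain ⟨a, ha, rfl⟩ := Φ.cls_surj x
    exact Φ.mk_cls ((zero_add p).trans (add_zero p).symm) (Algebra.commutes c a)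
      (Φ.mul_mem (Φ.algebraMap_mem c) ha) (Φ.mul_mem ha (Φ.algebraMap_mem c))
  smul_def := by
    rintro c ⟨p, x⟩
    obtain ⟨a, ha, rfl⟩ := Φ.cls_surj x
    exact Φ.mk_cls (zero_add p).symm (Algebra.smul_def c a) (Submodule.smul_mem _ c ha)
      (Φ.mul_mem (Φ.algebraMap_mem c) ha)

/-- The associated graded algebra `G(A)`, the direct sum of the `F_p A / F_{p-1} A`. -/
abbrev Gr : Type _ := ⨁ p, Φ.GrPart p

/-- The homogeneous part of degree `p` of `G(A)`. -/
def grGrading (p : ℕ) : Submodule K Φ.Gr := LinearMap.range (DirectSum.lof K ℕ Φ.GrPart p)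

/-- The class in `G(A)_p` of an element of `F_p A`, as an element of `G(A)`. -/
def toGr (p : ℕ) (a : A) (ha : a ∈ Φ.F p) : Φ.Gr := DirectSum.of Φ.GrPart p (Φ.cls p a ha)

instance : SetLike.GradedMonoid Φ.grGrading where
  one_mem := ⟨_, rfl⟩
  mul_mem := by
    rintro p q _ _ ⟨x, rfl⟩ ⟨y, rfl⟩
    exact ⟨_, (DirectSum.of_mul_of (A := Φ.GrPart) x y).symm⟩

instance : SetLike.GradedMonoid Φ.reesGrading where
  one_mem := ⟨_, rfl⟩
  mul_mem := by
    rintro p q _ _ ⟨x, rfl⟩ ⟨y, rfl⟩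
    exact ⟨_, (DirectSum.of_mul_of (A := fun p => Φ.F p) x y).symm⟩

end AlgFiltration

instance {K S : Type*} [CommRing K] [Ring S] [Algebra K S] (𝒮 : ℕ → Submodule K S)
    [SetLike.GradedMonoid 𝒮] (J : TwoSidedIdeal S) :
    SetLike.GradedMonoid (quotientGrading 𝒮 J) where
  one_mem := ⟨1, SetLike.GradedOne.one_mem, map_one (J.proj K)⟩
  mul_mem := by
    rintro p q _ _ ⟨x, hx, rfl⟩ ⟨y, hy, rfl⟩
    exact ⟨x * y, SetLike.GradedMul.mul_mem hx hy, map_mul (J.proj K) x y⟩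

namespace PathAlgebra

variable {K : Type u} {V : Type v} [Field K] [Quiver.{w} V]

theorem ofPath_mem (C : QPath V → Prop) {w : QPath V} (h : C w) : ofPath K w ∈ spanPaths K V C := by
  intro w' hw'
  by_contra hC
  have hne : w ≠ w' := fun e => hC (e ▸ h)
  exact hw' (Finsupp.single_eq_of_ne' hne)

theorem spanPaths_le {C : QPath V → Prop} {M : Submodule K (PathAlgebra K V)}
    (h : ∀ w, C w → ofPath K w ∈ M) : spanPaths K V C ≤ M := by
  intro f hf
  have e : f = Finsupp.sum (show QPath V →₀ K from f) fun w c => c • ofPath K w := by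
    conv_lhs => rw [← Finsupp.sum_single (show QPath V →₀ K from f)]
    refine Finsupp.sum_congr fun w _ => ?_
    exact ((Finsupp.smul_single' _ w 1).trans (by rw [mul_one])).symm
  rw [e]
  exact sum_mem fun w hw => M.smul_mem _ (h w (hf w (Finsupp.mem_support_iff.1 hw)))

theorem le_degree (f : PathAlgebra K V) : f ∈ filtered K V f.degree := fun _ hw =>
  Finset.le_sup (f := QPath.length) (Finsupp.mem_support_iff.2 hw)

variable [Fintype V]

theorem mul_mem_spanPaths {C D E : QPath V → Prop}
    (h : ∀ p q r : QPath V, C p → D q → p.comp? q = some r → E r)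
    {f g : PathAlgebra K V} (hf : f ∈ spanPaths K V C) (hg : g ∈ spanPaths K V D) :
    f * g ∈ spanPaths K V E := by
  have h1 : spanPaths K V C ≤ (spanPaths K V E).comap ((mulBilin K).flip g) := by
    refine spanPaths_le fun p hp => ?_
    have h2 : spanPaths K V D ≤ (spanPaths K V E).comap (mulBilin K (ofPath K p)) := by
      refine spanPaths_le fun q hq => ?_
      rw [Submodule.mem_comap, mulBilin_ofPath, mulPath]
      rcases hr : p.comp? q with _ | r
      · exact zero_mem _
      · exact ofPath_mem E (h p q r hp hq hr)
    exact h2 hg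
  exact h1 hf

theorem one_mem_spanPaths {C : QPath V → Prop} (h : ∀ a, C (QPath.vertex a)) :
    (1 : PathAlgebra K V) ∈ spanPaths K V C :=
  sum_mem fun a _ => ofPath_mem C (h a)

instance : SetLike.GradedMonoid (homogeneous K V) where
  one_mem := one_mem_spanPaths fun _ => rfl
  mul_mem _ _ _ _ := mul_mem_spanPaths fun _ _ _ hp hq hr => by
    rw [QPath.comp?_eq_some hr, hp, hq]

/-- The filtration `F_p A = (F_p R + I) / I` of the quotient algebra `A = R / I`. -/
def inducedFiltration (I : TwoSidedIdeal (PathAlgebra K V)) : AlgFiltration K I.QuotientAlg where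
  F p := (filtered K V p).map (I.proj K).toLinearMap
  mono p q h := Submodule.map_mono fun _ hf w hw => (hf w hw).trans h
  one_mem := ⟨1, one_mem_spanPaths fun _ => le_rfl, map_one (I.proj K)⟩
  mul_mem := by
    rintro p q _ _ ⟨f, hf, rfl⟩ ⟨g, hg, rfl⟩
    refine ⟨f * g, mul_mem_spanPaths (fun a b c ha hb hc => ?_) hf hg, map_mul (I.proj K) f g⟩
    rw [QPath.comp?_eq_some hc]
    exact add_le_add ha hb
  exhaustive a := by
    obtain ⟨f, rfl⟩ := Ideal.Quotient.mk_surjective a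
    exact ⟨f.degree, f, le_degree f, rfl⟩

theorem proj_mem (I : TwoSidedIdeal (PathAlgebra K V)) {p : ℕ} {f : PathAlgebra K V} (hf : f ∈ homogeneous K V p) :
    I.proj K f ∈ (inducedFiltration I).F p := ⟨f, fun w hw => (hf w hw).le, rfl⟩

/-- The natural graded epimorphism `ρ : R / ⟨LH(S)⟩ → G(A)`, for a subset `S` of `I` and `A = R / I`,
is an isomorphism of algebras; `ρ` sends the class of a homogeneous element `f` of degree `p` to the
class of `f + I ∈ F_p A` in `F_p A / F_{p-1} A`. -/
def NaturalMapIsIso (I : TwoSidedIdeal (PathAlgebra K V)) (S : Set (PathAlgebra K V)) : Prop :=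
  ∃ ρ : (idealLH S).QuotientAlg ≃ₐ[K] (inducedFiltration I).Gr,
    ∀ (p : ℕ) (f : PathAlgebra K V) (hf : f ∈ homogeneous K V p),
      ρ ((idealLH S).proj K f) = (inducedFiltration I).toGr p (I.proj K f) (proj_mem I hf)

/-- The general PBW property of `A = R / I` with respect to a set `S` of generators of `I`. -/
def HasGeneralPBW (I : TwoSidedIdeal (PathAlgebra K V)) (S : Set (PathAlgebra K V)) : Prop :=
  TwoSidedIdeal.span S = I ∧ NaturalMapIsIso I S

theorem eval_mem_filtered {p : ℕ} {F : (PathAlgebra K V)[X]} (hF : F ∈ polyHomogeneous K V p) :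
    F.eval 1 ∈ filtered K V p := by
  rw [Polynomial.eval_eq_sum]
  refine sum_mem fun r _ => ?_
  simp only [one_pow, mul_one]
  exact fun w hw => (Nat.le_add_right _ _).trans (hF r w hw).le

/-- There is an isomorphism of graded algebras from `R[t] / ⟨S^*⟩` to the Rees algebra of
`A = R / I`; it sends the class of a homogeneous element `F` of degree `p` to the element
`F_* + I ∈ F_p A`, where `F_*` is the dehomogenization of `F` (put `t = 1`). -/
def ReesIsomorphism (I : TwoSidedIdeal (PathAlgebra K V)) (S : Set (PathAlgebra K V)) : Prop :=
  ∃ e : (idealHomogenize S).QuotientAlg ≃ₐ[K] (inducedFiltration I).Rees,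
    ∀ (p : ℕ) (F : (PathAlgebra K V)[X]) (hF : F ∈ polyHomogeneous K V p),
      e ((idealHomogenize S).proj K F) =
        (inducedFiltration I).toRees p (I.proj K (F.eval 1)) ⟨_, eval_mem_filtered hF, rfl⟩

end PathAlgebra

/-! ## Koszul algebras -/

section Koszul

variable {K : Type*} {S : Type u} [CommRing K] [Ring S] [Algebra K S]

/-- The left ideal generated by the homogeneous elements of positive degree; for an `ℕ`-graded
algebra `S` it is `S_1 + S_2 + ...`, so that `S` modulo it is `S_0`. -/
def irrelevantIdeal (𝒮 : ℕ → Submodule K S) : Ideal S :=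
  Ideal.span {s | ∃ p, 0 < p ∧ s ∈ 𝒮 p}

/-- A graded projective resolution `... → P_2 → P_1 → P_0 → S_0 → 0` of the left `S`-module
`S_0 = S / (S_1 + S_2 + ...)`, in which `P_i` is generated by its homogeneous elements of degree
`δ i`. -/
structure PureResolution (𝒮 : ℕ → Submodule K S) (δ : ℕ → ℕ) where
  P : ℕ → Type u
  [addCommGroup : ∀ i, AddCommGroup (P i)]
  [module : ∀ i, Module S (P i)]
  gr : ∀ i, ℕ → AddSubgroup (P i)
  isInternal : ∀ i, DirectSum.IsInternal (gr i)
  smul_mem : ∀ i p q (s : S) (x : P i), s ∈ 𝒮 p → x ∈ gr i q → s • x ∈ gr i (p + q)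
  projective : ∀ i, Module.Projective S (P i)
  generated : ∀ i, Submodule.span S (gr i (δ i) : Set (P i)) = ⊤
  d : ∀ i, P (i + 1) →ₗ[S] P i
  d_mem : ∀ i p (x : P (i + 1)), x ∈ gr (i + 1) p → d i x ∈ gr i p
  aug : P 0 →ₗ[S] S ⧸ irrelevantIdeal 𝒮
  aug_degree : ∀ p, 0 < p → ∀ x ∈ gr 0 p, aug x = 0
  aug_surjective : Function.Surjective aug
  exact_aug : Function.Exact (d 0) aug
  exact : ∀ i, Function.Exact (d (i + 1)) (d i)

/-- `S` is an `ℕ`-graded algebra with semisimple degree zero part `S_0`, and the `S`-module `S_0`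
has a graded projective resolution whose `i`-th term is generated in degree `δ i`. -/
structure HasPureResolution (𝒮 : ℕ → Submodule K S) [SetLike.GradedMonoid 𝒮] (δ : ℕ → ℕ) :
    Prop where
  isInternal : DirectSum.IsInternal 𝒮
  isSemisimpleRing : IsSemisimpleRing (𝒮 0)
  resolution : Nonempty (PureResolution 𝒮 δ)

/-- Koszul algebras in the classical sense: `S_0` is semisimple and has a linear resolution. -/
def IsKoszul (𝒮 : ℕ → Submodule K S) [SetLike.GradedMonoid 𝒮] : Prop :=
  HasPureResolution 𝒮 fun i => i

/-- The jump function of `N`-Koszulity: `2j ↦ Nj` and `2j + 1 ↦ Nj + 1`. -/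
def koszulDegree (N i : ℕ) : ℕ := N * (i / 2) + i % 2

end Koszul

namespace PathAlgebra

variable {K : Type u} {V : Type v} [Field K] [Quiver.{w} V] [Fintype V]

/-- The graded quotient `R / J` of the path algebra `R` is `N`-Koszul: the ideal `J` is generated by
homogeneous elements of degree `N`, and the degree zero part of `R / J` has a graded projective
resolution whose term of index `2j` (of index `2j + 1`) is generated in degree `Nj` (in degree
`Nj + 1`). -/
def IsNKoszul (N : ℕ) (J : TwoSidedIdeal (PathAlgebra K V)) : Prop :=
  (∃ S : Set (PathAlgebra K V), S ⊆ homogeneous K V N ∧ J = TwoSidedIdeal.span S) ∧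
    HasPureResolution (quotientGrading (homogeneous K V) J) (koszulDegree N)

/-- `P_N`, the set of the elements of `P` that do not lie in `F_{N-1} R` (they have a path of length
at least `N`). -/
def topPart (N : ℕ) (P : Set (PathAlgebra K V)) : Set (PathAlgebra K V) :=
  {f ∈ P | ∃ w, f.coeff w ≠ 0 ∧ N ≤ w.length}

/-- The (not necessarily graded) algebra `A = R / I`, where `I = ⟨P⟩` with `P ⊆ F_N R` and `2 ≤ N`,
is Koszul in the sense of Berger and Ginzburg: the graded algebra `R / ⟨LH(P_N)⟩` is `N`-Koszul, and
the `N`-type PBW property holds, that is, the natural epimorphism `R / ⟨LH(P_N)⟩ → G(A)` is an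
isomorphism. -/
structure IsBergerGinzburgKoszul (N : ℕ) (P : Set (PathAlgebra K V))
    (I : TwoSidedIdeal (PathAlgebra K V)) : Prop where
  two_le : 2 ≤ N
  subset_filtered : P ⊆ filtered K V N
  span_eq : TwoSidedIdeal.span P = I
  isNKoszul : IsNKoszul N (idealLH (topPart N P))
  nTypePBW : NaturalMapIsIso I (topPart N P)

end PathAlgebra

end

noncomputable section

universe u v w

/-! Everything rests on division by a Gröbner basis for an ordering that refines length. Dividing an
element of `I` that lies in `F_d R` writes it as a combination of products `s g t` with `g ∈ G` and
`|s| + deg g + |t| ≤ d` (`mem_span_of_mem_ideal`): no terms of higher degree are needed that would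
cancel afterwards. Taking the component of degree `d`, or homogenizing in degree `d`, turns such an
expression into a member of `⟨LH(G)⟩`, or of `⟨G^*⟩`. These ideals are therefore the kernels of the
natural surjections from `R` to `G(A)` and from `R[t]` to the Rees algebra (`grHom_eq_zero_iff`,
`polyReesHom_eq_zero_iff`). The two Gröbner basis assertions hold because a leading monomial of
`⟨LH(I)⟩` is one of `I`, and because one of `⟨I^*⟩` is a power of `t` times one of `I`.

For Koszulity, the classes of the normal paths (those that are not leading monomials of elements of
`I`) form a basis of `A`. If `G ⊆ F_2 R`, normality is decided by subpaths of length at most two.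
`QuadraticNormalForm` isolates what is needed of this, and a linear resolution is built from it by
iterated syzygies, in the manner of Anick. A `Stage n` is a module generated in degree `n`, with
generators labelled by paths of length `n` (chains). Its basis consists of the products of a normal
path with a generator for which the last letter of the path is not forbidden, and a forbidden letter
times a generator equals a combination of terms with smaller words. The kernel of its projective
cover is again such a module. It is generated by one syzygy for each normal forbidden letter `x`,
with a chain one letter longer, and `y` becomes forbidden when `yx` is not normal. Reduction gives
generation (`single_mem_sup`); leading terms give the basis, since a path `v` that is allowed before
`x` makes `vx` normal (`syzMap_injOn`). The iteration starts at `S_0`, where every letter is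
forbidden.

The associated graded algebra carries such a normal form on the paths of `Q`. In the Rees algebra
the central variable is represented by a loop added at every vertex. Normal words have all their
loops in front, and commuting a loop past an arrow is a further quadratic rule.

For Berger–Ginzburg Koszulity, `N`-Koszulity forces `⟨LH(G)⟩` to live in degrees at least `N`.
Nonzero elements of `G` thus belong to `P_N`, and `⟨LH(P_N)⟩ = ⟨LH(G)⟩` (`idealLH_topPart_eq`). -/

/-- A map that kills all pieces but the `q`-th reads off its value on the `q`-th summand from the
sum, so a vanishing sum has vanishing summands. -/
theorem DirectSum.isInternal_of_separating {M E σ : Type*} [AddCommGroup M] [AddCommGroup E]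
    [SetLike σ M] [AddSubgroupClass σ M] (A : ℕ → σ)
    (hspan : ∀ R : AddSubmonoid M, (∀ q, ∀ x ∈ A q, x ∈ R) → ∀ x, x ∈ R)
    (hsep : ∀ q, ∀ x ∈ A q, x ≠ 0 →
      ∃ φ : M →+ E, φ x ≠ 0 ∧ ∀ q', q' ≠ q → ∀ y ∈ A q', φ y = 0) :
    DirectSum.IsInternal A := by
  classical
  constructor
  · refine (injective_iff_map_eq_zero _).2 fun a ha => ?_
    ext q
    by_contra hne
    obtain ⟨φ, h1, h2⟩ := hsep q (a q) (a q).2 (by simpa using hne)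
    have key : ∀ c : ⨁ i, A i, φ (DirectSum.coeAddMonoidHom A c) = φ (c q) := by
      intro c
      induction c using DirectSum.induction_on with
      | zero => simp
      | of i x =>
        rw [DirectSum.coeAddMonoidHom_of]
        by_cases h : i = q
        · subst h
          rw [DirectSum.of_eq_same]
        · rw [DirectSum.of_eq_of_ne _ _ _ (Ne.symm h), h2 i h _ x.2]
          simp
      | add x y hx hy => simp [hx, hy]
    exact h1 (by rw [← key a, ha, map_zero])
  · exact fun x => hspan (AddMonoidHom.mrange (DirectSum.coeAddMonoidHom A)) (fun q x hx =>
      ⟨DirectSum.of (fun i => A i) q ⟨x, hx⟩, DirectSum.coeAddMonoidHom_of A q _⟩) x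

/-- In a nontrivial relation choose an index `t` of the support that is maximal for `r`: the form `κ
t` kills every other term of the relation, and so its coefficient at `t` is zero. -/
theorem linearIndependent_of_triangular {K T E : Type*} [Field K] [AddCommGroup E] [Module K E]
    (r : T → T → Prop) (hirr : ∀ t, ¬ r t t) (htrans : ∀ s t u, r s t → r t u → r s u)
    (Z : T → E) (κ : T → E →ₗ[K] K) (h1 : ∀ t, κ t (Z t) = 1)
    (h2 : ∀ t t', κ t (Z t') ≠ 0 → t = t' ∨ r t t') : LinearIndependent K Z := by
  classical
  rw [linearIndependent_iff]
  intro l hl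
  by_contra hne
  let _ : Preorder T :=
    { le := fun s t => s = t ∨ r s t
      le_refl := fun _ => Or.inl rfl
      le_trans := by
        rintro a b c (rfl | h) (rfl | h')
        · exact Or.inl rfl
        · exact Or.inr h'
        · exact Or.inr h
        · exact Or.inr (htrans _ _ _ h h') }
  obtain ⟨t, ht⟩ := l.support.exists_maximal (Finsupp.support_nonempty_iff.2 hne)
  have h := congrArg (κ t) hl
  rw [Finsupp.linearCombination_apply, Finsupp.sum, map_sum, map_zero, Finset.sum_eq_single t] at h
  · rw [map_smul, h1, smul_eq_mul, mul_one] at h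
    exact Finsupp.mem_support_iff.1 ht.1 h
  · intro s hs hst
    rw [map_smul]
    by_contra h0
    have h3 : κ t (Z s) ≠ 0 := fun h => h0 (by rw [h, smul_zero])
    rcases h2 t s h3 with h4 | h4
    · exact hst h4.symm
    · rcases ht.2 hs (Or.inr h4) with h5 | h5
      · exact hst h5
      · exact hirr _ (htrans _ _ _ h4 h5)
  · exact fun h' => absurd ht.1 h'

/-! ### Algebras with quadratic normal forms and their graded projective modules -/

/-- An algebra with a basis of normal paths of a quiver, in which the normality of a path is
decided by its subpaths of length at most `2`, and in which a path that is not normal is a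
combination of smaller parallel normal paths. -/
structure QuadraticNormalForm {K : Type u} (W : Type v) [Field K] [Quiver.{w} W] [Fintype W]
    {S : Type (max u v w)} [Ring S] [Algebra K S] (𝒮 : ℕ → Submodule K S) where
  lt : QPath W → QPath W → Prop
  lt_trans : ∀ {p q r}, lt p q → lt q r → lt p r
  lt_wf : WellFounded lt
  lt_length : ∀ {p q}, lt p q → p.length = q.length
  -- The targets may differ here, because the words compared later end with chains of different
  -- generators; on the right only parallel paths are ever extended.
  lt_comp_left : ∀ {a b c c' : W} (s : Quiver.Path a b) {p : Quiver.Path b c}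
    {q : Quiver.Path b c'}, lt ⟨b, c, p⟩ ⟨b, c', q⟩ → lt ⟨a, c, s.comp p⟩ ⟨a, c', s.comp q⟩
  lt_comp_right : ∀ {a b c : W} (s : Quiver.Path b c) {p q : Quiver.Path a b},
    lt ⟨a, b, p⟩ ⟨a, b, q⟩ → lt ⟨a, c, p.comp s⟩ ⟨a, c, q.comp s⟩
  Nrm : ∀ {a b : W}, Quiver.Path a b → Prop
  nrm_letter : ∀ {a b c : W} {p : Quiver.Path a b} {x : b ⟶ c}, Nrm (p.cons x) → Nrm x.toPath
  nrm_cons_cons : ∀ {a b c d : W} {p : Quiver.Path a b} {x : b ⟶ c} {y : c ⟶ d},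
    Nrm (p.cons x) → Nrm (x.toPath.cons y) → Nrm ((p.cons x).cons y)
  val : ∀ {a b : W}, Quiver.Path a b → S
  val_comp : ∀ {a b c : W} (p : Quiver.Path a b) (q : Quiver.Path b c),
    val (p.comp q) = val p * val q
  val_mul_of_ne : ∀ {a b c d : W} (p : Quiver.Path a b) (q : Quiver.Path c d), b ≠ c →
    val p * val q = 0
  sum_val : ∑ a : W, val (Quiver.Path.nil : Quiver.Path a a) = 1
  val_mem : ∀ {a b : W} (p : Quiver.Path a b), val p ∈ 𝒮 p.length
  span_val : ∀ n, 𝒮 n ≤ Submodule.span K {s | ∃ (a b : W) (p : Quiver.Path a b),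
    p.length = n ∧ s = val p}
  coord : QPath W → S →ₗ[K] K
  coord_self : ∀ {a b : W} {p : Quiver.Path a b}, Nrm p → coord ⟨a, b, p⟩ (val p) = 1
  coord_ne : ∀ {a b c d : W} {p : Quiver.Path a b} {q : Quiver.Path c d}, Nrm p → Nrm q →
    (⟨a, b, p⟩ : QPath W) ≠ ⟨c, d, q⟩ → coord ⟨a, b, p⟩ (val q) = 0
  reduce : ∀ {a b : W} (p : Quiver.Path a b), ¬ Nrm p →
    val p ∈ Submodule.span K {s | ∃ q : Quiver.Path a b,
      Nrm q ∧ lt ⟨a, b, q⟩ ⟨a, b, p⟩ ∧ s = val q}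
  internal : DirectSum.IsInternal 𝒮

namespace QuadraticNormalForm

variable {K : Type u} {W : Type v} [Field K] [Quiver.{w} W] [Fintype W]
  {S : Type (max u v w)} [Ring S] [Algebra K S] {𝒮 : ℕ → Submodule K S}
  (D : QuadraticNormalForm W 𝒮)

/-- The idempotent of a vertex. -/
def e (a : W) : S := D.val (Quiver.Path.nil : Quiver.Path a a)

theorem val_mul_e {a b : W} (p : Quiver.Path a b) : D.val p * D.e b = D.val p := by
  rw [e, ← D.val_comp, Quiver.Path.comp_nil]

theorem val_mul_e_of_ne {a b c : W} (p : Quiver.Path a b) (h : b ≠ c) : D.val p * D.e c = 0 :=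
  D.val_mul_of_ne p _ h

theorem e_mem (a : W) : D.e a ∈ 𝒮 0 := D.val_mem (Quiver.Path.nil : Quiver.Path a a)

theorem e_mul_self (a : W) : D.e a * D.e a = D.e a := D.val_mul_e _

theorem lt_irrefl (p : QPath W) : ¬ D.lt p p := D.lt_wf.irrefl.irrefl p

theorem bijective_coeLinearMap (D : QuadraticNormalForm W 𝒮) :
    Function.Bijective (DirectSum.coeLinearMap 𝒮) := D.internal

/-- The projection onto the homogeneous part of degree `m`. -/
def proj (m : ℕ) : S →ₗ[K] S :=
  (𝒮 m).subtype ∘ₗ DirectSum.component K ℕ (fun i => 𝒮 i) m ∘ₗ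
    (LinearEquiv.ofBijective (DirectSum.coeLinearMap 𝒮) D.bijective_coeLinearMap).symm.toLinearMap

theorem proj_of_mem {m n : ℕ} {s : S} (hs : s ∈ 𝒮 n) : D.proj m s = if n = m then s else 0 := by
  have h : (LinearEquiv.ofBijective (DirectSum.coeLinearMap 𝒮) D.bijective_coeLinearMap).symm s =
      DirectSum.lof K ℕ (fun i => 𝒮 i) n ⟨s, hs⟩ := by
    rw [LinearEquiv.symm_apply_eq, LinearEquiv.ofBijective_apply, DirectSum.coeLinearMap_lof]
  rw [proj, LinearMap.comp_apply, LinearMap.comp_apply, LinearEquiv.coe_coe, h]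
  split_ifs with hnm
  · subst hnm
    rw [DirectSum.component.lof_self]
    rfl
  · rw [DirectSum.component.of]
    rw [dif_neg hnm, map_zero]

theorem proj_mem (m : ℕ) (s : S) : D.proj m s ∈ 𝒮 m :=
  Subtype.property (DirectSum.component K ℕ (fun i => 𝒮 i) m
    ((LinearEquiv.ofBijective (DirectSum.coeLinearMap 𝒮) D.bijective_coeLinearMap).symm s))

theorem span_homogeneous (D : QuadraticNormalForm W 𝒮) (R : AddSubmonoid S) (hR : ∀ q, ∀ x ∈ 𝒮 q, x ∈ R) (s : S) : s ∈ R := by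
  obtain ⟨x, rfl⟩ := D.internal.2 s
  induction x using DirectSum.induction_on with
  | zero => simp
  | of i x =>
    rw [DirectSum.coeAddMonoidHom_of]
    exact hR i _ x.2
  | add x y hx hy => rw [map_add]; exact add_mem hx hy

theorem eq_zero_of_proj {s : S} (h : ∀ m, D.proj m s = 0) : s = 0 := by
  have h1 : (LinearEquiv.ofBijective (DirectSum.coeLinearMap 𝒮) D.bijective_coeLinearMap).symm s = 0 := by
    ext m
    exact h m
  exact (LinearEquiv.map_eq_zero_iff _).1 h1

theorem mem_of_proj {n : ℕ} {s : S} (h : ∀ m, m ≠ n → D.proj m s = 0) : s ∈ 𝒮 n := by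
  have : s - D.proj n s = 0 := D.eq_zero_of_proj fun m => by
    rw [map_sub, D.proj_of_mem (D.proj_mem n s)]
    split_ifs with hm
    · rw [hm, sub_self]
    · rw [h m (Ne.symm hm), sub_zero]
  rw [sub_eq_zero.1 this]
  exact D.proj_mem n s

theorem span_val_top : Submodule.span K {s | ∃ (a b : W) (p : Quiver.Path a b), s = D.val p} = ⊤ := by
  refine eq_top_iff.2 fun s _ => ?_
  refine D.span_homogeneous (Submodule.span K _).toAddSubmonoid (fun q x hx => ?_) s
  refine Submodule.span_mono ?_ (D.span_val q hx)
  rintro _ ⟨a, b, p, -, rfl⟩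
  exact ⟨a, b, p, rfl⟩

theorem mul_e_mem_span (s : S) (b : W) :
    s * D.e b ∈ Submodule.span K {s | ∃ (a : W) (p : Quiver.Path a b), s = D.val p} := by
  have h : s ∈ Submodule.span K {s | ∃ (a b : W) (p : Quiver.Path a b), s = D.val p} := by
    rw [D.span_val_top]; trivial
  induction h using Submodule.span_induction with
  | mem x hx =>
    obtain ⟨a, c, p, rfl⟩ := hx
    by_cases hc : c = b
    · subst hc
      rw [D.val_mul_e]
      exact Submodule.subset_span ⟨a, p, rfl⟩
    · rw [D.val_mul_e_of_ne p hc]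
      exact zero_mem _
  | zero => rw [zero_mul]; exact zero_mem _
  | add x y _ _ hx hy => rw [add_mul]; exact add_mem hx hy
  | smul c x _ hx => rw [smul_mul_assoc]; exact Submodule.smul_mem _ c hx

/-- The `S`-module `⨁ S e_{a_i}`, as a submodule of a free module. -/
def free {ι : Type*} (vx : ι → W) : Submodule S (ι →₀ S) where
  carrier := {f | ∀ i, f i * D.e (vx i) = f i}
  zero_mem' i := by simp
  add_mem' {f g} hf hg i := by
    change (f + g) i * _ = (f + g) i
    rw [Finsupp.add_apply, add_mul, hf i, hg i]
  smul_mem' s f hf i := by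
    change (s • f) i * _ = (s • f) i
    rw [Finsupp.smul_apply, smul_eq_mul, mul_assoc, hf i]

theorem single_val_mem_free {ι : Type*} (vx : ι → W) (i : ι) {a : W} (p : Quiver.Path a (vx i)) :
    Finsupp.single i (D.val p) ∈ D.free vx := by
  classical
  intro j
  rw [Finsupp.single_apply]
  split_ifs with h
  · subst h; exact D.val_mul_e p
  · exact zero_mul _

/-- Right multiplication of each coordinate by the idempotent of its vertex is an `S`-linear
retraction of the free module onto this submodule. -/
theorem projective_free {ι : Type*} (vx : ι → W) : Module.Projective S (D.free vx) := by
  classical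
  let π : (ι →₀ S) →ₗ[S] D.free vx := Finsupp.linearCombination S fun i =>
    ⟨Finsupp.single i (D.e (vx i)), D.single_val_mem_free vx i _⟩
  refine Module.Projective.of_split (D.free vx).subtype π ?_
  ext f j
  have h : ∀ g : ι →₀ S, ((π g : D.free vx) : ι →₀ S) j = g j * D.e (vx j) := by
    intro g
    induction g using Finsupp.induction_linear with
    | zero => simp
    | add f g hf hg => simp [hf, hg, add_mul]
    | single i s =>
      rw [Finsupp.linearCombination_single]
      change (s • Finsupp.single i (D.e (vx i))) j = _
      rw [Finsupp.smul_single, smul_eq_mul, Finsupp.single_apply, Finsupp.single_apply]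
      split_ifs with h
      · subst h; rfl
      · rw [zero_mul]
  exact (h f).trans (f.2 j)

/-- A coordinate fixed by right multiplication with the idempotent of a vertex is a combination of
paths ending at that vertex. -/
theorem free_induction {ι : Type*} (vx : ι → W) (R : AddSubmonoid (ι →₀ S))
    (h : ∀ (c : K) (i : ι) (a : W) (p : Quiver.Path a (vx i)), Finsupp.single i (c • D.val p) ∈ R)
    {f : ι →₀ S} (hf : f ∈ D.free vx) : f ∈ R := by
  rw [← Finsupp.sum_single f]
  refine sum_mem fun i _ => ?_
  rw [← hf i]
  have h1 := D.mul_e_mem_span (f i) (vx i)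
  suffices h2 : ∀ s ∈ Submodule.span K {s | ∃ (a : W) (p : Quiver.Path a (vx i)), s = D.val p},
      Finsupp.single i s ∈ R from h2 _ h1
  intro s hs
  obtain ⟨l, hl⟩ := Submodule.mem_span_set.1 hs
  rw [← hl.2, Finsupp.sum, ← Finsupp.singleAddHom_apply, map_sum]
  refine sum_mem fun x hx => ?_
  obtain ⟨a, p, hp⟩ := hl.1 hx
  rw [hp, Finsupp.singleAddHom_apply]
  exact h _ i a p

/-- The homogeneous part of degree `q` of `⨁ S e_{a_i}`, when the generators have degree `n`. -/
def freeGr {ι : Type*} (vx : ι → W) (n q : ℕ) : AddSubgroup (D.free vx) where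
  carrier := {f | ∀ i m, m + n ≠ q → D.proj m (f.1 i) = 0}
  zero_mem' i m _ := by simp
  add_mem' {f g} hf hg i m h := by
    rw [Submodule.coe_add, Finsupp.add_apply, map_add, hf i m h, hg i m h, add_zero]
  neg_mem' {f} hf i m h := by
    rw [Submodule.coe_neg, Finsupp.neg_apply, map_neg, hf i m h, neg_zero]

theorem single_mem_freeGr {ι : Type*} (vx : ι → W) {n q m : ℕ} (h : m + n = q) (i : ι) {s : S}
    (hs : s ∈ 𝒮 m) (hf : Finsupp.single i s ∈ D.free vx) :
    (⟨Finsupp.single i s, hf⟩ : D.free vx) ∈ D.freeGr vx n q := by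
  classical
  intro j m' hm'
  rw [Finsupp.single_apply]
  split_ifs
  · rw [D.proj_of_mem hs, if_neg (by rintro rfl; exact hm' h)]
  · exact map_zero _

theorem isInternal_freeGr {ι : Type*} (vx : ι → W) (n : ℕ) :
    DirectSum.IsInternal (D.freeGr vx n) := by
  refine DirectSum.isInternal_of_separating (E := S) (D.freeGr vx n) (fun R hR f => ?_) fun q f hf hne => ?_
  · have h := D.free_induction vx (R.map (D.free vx).subtype.toAddMonoidHom) (fun c i a p =>
      ⟨⟨Finsupp.single i (c • D.val p), ?_⟩, hR (p.length + n) _ ?_, rfl⟩) f.2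
    · obtain ⟨g, hg, hgf⟩ := h
      rwa [← Subtype.ext hgf]
    · intro j
      have h := D.single_val_mem_free vx i p j
      rw [← Finsupp.smul_single, Finsupp.smul_apply, smul_mul_assoc, h]
    · exact D.single_mem_freeGr vx rfl i (Submodule.smul_mem _ c (D.val_mem p)) _
  · have h : ∃ i m, D.proj m (f.1 i) ≠ 0 := by
      by_contra! h
      exact hne (Subtype.ext (Finsupp.ext fun i => D.eq_zero_of_proj (h i)))
    obtain ⟨i, m, him⟩ := h
    have hmq : m + n = q := by
      by_contra h
      exact him (hf i m h)
    refine ⟨(D.proj m).toAddMonoidHom.comp ((Finsupp.applyAddHom i).comp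
      (D.free vx).subtype.toAddMonoidHom), him, fun q' hq' g hg => ?_⟩
    exact hg i m (fun h => hq' (h.symm.trans hmq))

theorem freeGr_generated {ι : Type*} (vx : ι → W) (n : ℕ) :
    Submodule.span S (D.freeGr vx n n : Set (D.free vx)) = ⊤ := by
  refine eq_top_iff.2 fun f _ => ?_
  have h := D.free_induction vx
    ((Submodule.span S (D.freeGr vx n n : Set (D.free vx))).toAddSubmonoid.map
      (D.free vx).subtype.toAddMonoidHom) (fun c i a p =>
      ⟨(c • D.val p) • (⟨_, D.single_val_mem_free vx i Quiver.Path.nil⟩ : D.free vx),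
        Submodule.smul_mem _ _ (Submodule.subset_span
          (D.single_mem_freeGr vx (zero_add n) i (D.e_mem _) _)), ?_⟩) f.2
  · obtain ⟨g, hg, hgf⟩ := h
    rwa [← Subtype.ext hgf]
  · change (c • D.val p) • Finsupp.single i (D.e (vx i)) = _
    rw [Finsupp.smul_single, smul_eq_mul, smul_mul_assoc, D.val_mul_e]

variable [SetLike.GradedMonoid 𝒮]

theorem smul_mem_freeGr {ι : Type*} (vx : ι → W) (n p q : ℕ) (s : S) (f : D.free vx)
    (hs : s ∈ 𝒮 p) (hf : f ∈ D.freeGr vx n q) : s • f ∈ D.freeGr vx n (p + q) := by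
  intro i m hm
  change D.proj m (s * f.1 i) = 0
  -- Generators have degree `n`, so there is nothing below that degree; the subtraction `q - n`
  -- makes sense only in the second case.
  rcases lt_or_ge q n with hq | hq
  · have : f.1 i = 0 := D.eq_zero_of_proj fun m' => hf i m' (by omega)
    rw [this, mul_zero, map_zero]
  · have : f.1 i ∈ 𝒮 (q - n) := D.mem_of_proj fun m' hm' => hf i m' (by omega)
    rw [D.proj_of_mem (SetLike.GradedMul.mul_mem hs this), if_neg (by omega)]

end QuadraticNormalForm

theorem Submodule.mem_of_mem_span {R M : Type*} [Semiring R] [AddCommMonoid M] [Module R M]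
    {s : Set M} {x : M} (N : Submodule R M) (hx : x ∈ Submodule.span R s) (h : ∀ y ∈ s, y ∈ N) :
    x ∈ N :=
  Submodule.span_le.2 h hx

namespace QuadraticNormalForm

variable {K : Type u} {W : Type v} [Field K] [Quiver.{w} W] [Fintype W]
  {S : Type (max u v w)} [Ring S] [Algebra K S] {𝒮 : ℕ → Submodule K S}
  (D : QuadraticNormalForm W 𝒮)

/-! ### Terms, their words, and reduction to smaller words -/

section Terms

variable {ι : Type*} {vx tx : ι → W} (chain : ∀ i, Quiver.Path (vx i) (tx i))

/-- The span of the terms `p ⊗ i` for which the path `p * chain i` satisfies a condition. -/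
def termSpan (C : QPath W → Prop) : Submodule K (ι →₀ S) :=
  Submodule.span K {f | ∃ (i : ι) (a : W) (p : Quiver.Path a (vx i)),
    C ⟨a, tx i, p.comp (chain i)⟩ ∧ f = Finsupp.single i (D.val p)}

/-- The paths with source `a` that are smaller than `t`. -/
def below (a : W) (t : QPath W) (q : QPath W) : Prop := q.src = a ∧ D.lt q t

theorem termSpan_mono {C C' : QPath W → Prop} (h : ∀ q, C q → C' q) :
    D.termSpan chain C ≤ D.termSpan chain C' :=
  Submodule.span_mono fun _ ⟨i, a, p, hp, hf⟩ => ⟨i, a, p, h _ hp, hf⟩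

theorem single_mem_termSpan {C : QPath W → Prop} {i : ι} {a : W} {p : Quiver.Path a (vx i)}
    (h : C ⟨a, tx i, p.comp (chain i)⟩) : Finsupp.single i (D.val p) ∈ D.termSpan chain C :=
  Submodule.subset_span ⟨i, a, p, h, rfl⟩

theorem termSpan_le_free (C : QPath W → Prop) :
    D.termSpan chain C ≤ (D.free vx).restrictScalars K := by
  refine Submodule.span_le.2 ?_
  rintro _ ⟨i, a, p, -, rfl⟩
  exact D.single_val_mem_free vx i p

theorem val_smul_mem_termSpan {a b c : W} (s : Quiver.Path a b) (t : Quiver.Path b c) {f : ι →₀ S}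
    (hf : f ∈ D.termSpan chain (D.below b ⟨b, c, t⟩)) :
    D.val s • f ∈ D.termSpan chain (D.below a ⟨a, c, s.comp t⟩) := by
  induction hf using Submodule.span_induction with
  | mem x hx =>
    obtain ⟨i, a', p, ⟨h1, h2⟩, rfl⟩ := hx
    obtain rfl : a' = b := h1
    rw [Finsupp.smul_single, smul_eq_mul, ← D.val_comp]
    refine D.single_mem_termSpan chain ⟨rfl, ?_⟩
    rw [Quiver.Path.comp_assoc]
    exact D.lt_comp_left s h2
  | zero => rw [smul_zero]; exact zero_mem _
  | add x y _ _ hx hy => rw [smul_add]; exact add_mem hx hy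
  | smul c x _ hx => rw [smul_comm]; exact Submodule.smul_mem _ c hx

/-- The paths in the normal form of `p` are parallel to `p` and smaller, and appending the chain
preserves this. -/
theorem single_val_mem_of_not_nrm {i : ι} {a : W} {p : Quiver.Path a (vx i)} (hp : ¬ D.Nrm p) :
    Finsupp.single i (D.val p) ∈
      D.termSpan chain (D.below a ⟨a, tx i, p.comp (chain i)⟩) := by
  refine Submodule.mem_of_mem_span
    ((D.termSpan chain (D.below a ⟨a, tx i, p.comp (chain i)⟩)).comap (Finsupp.lsingle i))
    (D.reduce p hp) ?_
  rintro _ ⟨q, -, hlt, rfl⟩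
  exact D.single_mem_termSpan chain ⟨rfl, D.lt_comp_right (chain i) hlt⟩

/-- The normal form of `p` contains only `p` itself or smaller paths. This bound on words supplies
the triangularity in the independence of the syzygies. -/
theorem coord_single_ne_zero {i : ι} {a : W} {u : Quiver.Path a (vx i)} (hu : D.Nrm u)
    {j : ι} {a' : W} {p : Quiver.Path a' (vx j)}
    (h : D.coord ⟨a, vx i, u⟩ (Finsupp.single j (D.val p) i) ≠ 0) :
    (i = j ∧ (⟨a, vx i, u⟩ : QPath W) = ⟨a', vx j, p⟩) ∨
      D.lt ⟨a, tx i, u.comp (chain i)⟩ ⟨a', tx j, p.comp (chain j)⟩ := by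
  classical
  rw [Finsupp.single_apply] at h
  split_ifs at h with hij
  swap
  · exact absurd (map_zero _) h
  subst hij
  by_cases hp : D.Nrm p
  · left
    refine ⟨rfl, ?_⟩
    by_contra hne
    exact h (D.coord_ne hu hp hne)
  · right
    by_contra hlt
    refine h (Submodule.mem_of_mem_span (LinearMap.ker (D.coord ⟨a, vx j, u⟩)) (D.reduce p hp) ?_)
    rintro _ ⟨q, hq, hqp, rfl⟩
    refine D.coord_ne hu hq fun he => hlt ?_
    cases he
    exact D.lt_comp_right (chain j) hqp

theorem coord_termSpan {i : ι} {a : W} {u : Quiver.Path a (vx i)} (hu : D.Nrm u) {b : W}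
    {t : QPath W} (ht : ¬ D.lt ⟨a, tx i, u.comp (chain i)⟩ t) {f : ι →₀ S}
    (hf : f ∈ D.termSpan chain (D.below b t)) : D.coord ⟨a, vx i, u⟩ (f i) = 0 := by
  have h : D.termSpan chain (D.below b t) ≤
      LinearMap.ker (D.coord ⟨a, vx i, u⟩ ∘ₗ Finsupp.lapply i) :=
    Submodule.span_le.2 (by
      rintro _ ⟨j, a', p, ⟨-, hp⟩, rfl⟩
      by_contra h
      rcases D.coord_single_ne_zero chain hu h with ⟨rfl, h⟩ | h
      · cases h
        exact ht hp
      · exact ht (D.lt_trans h hp))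
  exact h hf

end Terms

/-- The elements whose coefficients at `i` are combinations of normal paths the last letter of
which is not forbidden. -/
def irr {ι : Type*} {vx : ι → W} (forb : ∀ (i : ι) {b : W}, (b ⟶ vx i) → Prop) :
    Submodule K (ι →₀ S) :=
  ⨅ i, (Submodule.span K {s | ∃ (a : W) (p : Quiver.Path a (vx i)), D.Nrm p ∧
    (∀ (c : W) (q : Quiver.Path a c) (x : c ⟶ vx i), p = q.cons x → ¬ forb i x) ∧
    s = D.val p}).comap (Finsupp.lapply i)

theorem single_mem_irr {ι : Type*} {vx : ι → W} {forb : ∀ (i : ι) {b : W}, (b ⟶ vx i) → Prop}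
    {i : ι} {a : W} {p : Quiver.Path a (vx i)} (hp : D.Nrm p)
    (hf : ∀ (c : W) (q : Quiver.Path a c) (x : c ⟶ vx i), p = q.cons x → ¬ forb i x) :
    Finsupp.single i (D.val p) ∈ D.irr forb := by
  classical
  refine (Submodule.mem_iInf _).2 fun j => ?_
  rw [Submodule.mem_comap, Finsupp.lapply_apply, Finsupp.single_apply]
  split_ifs with h
  · subst h
    exact Submodule.subset_span ⟨a, p, hp, hf, rfl⟩
  · exact zero_mem _

theorem mem_span_of_mem_irr {ι : Type*} {vx : ι → W}
    {forb : ∀ (i : ι) {b : W}, (b ⟶ vx i) → Prop} {f : ι →₀ S} (hf : f ∈ D.irr forb) :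
    f ∈ Submodule.span K {f | ∃ (i : ι) (a : W) (p : Quiver.Path a (vx i)), D.Nrm p ∧
      (∀ (c : W) (q : Quiver.Path a c) (x : c ⟶ vx i), p = q.cons x → ¬ forb i x) ∧
      f = Finsupp.single i (D.val p)} := by
  rw [← Finsupp.sum_single f]
  refine sum_mem fun i _ => ?_
  have h := (Submodule.mem_iInf _).1 hf i
  suffices H : ∀ N : Submodule K (ι →₀ S), (∀ (a : W) (p : Quiver.Path a (vx i)), D.Nrm p →
      (∀ (c : W) (q : Quiver.Path a c) (x : c ⟶ vx i), p = q.cons x → ¬ forb i x) →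
      Finsupp.single i (D.val p) ∈ N) → Finsupp.single i (f i) ∈ N from
    H _ fun a p h1 h2 => Submodule.subset_span ⟨i, a, p, h1, h2, rfl⟩
  intro N hN
  refine Submodule.mem_of_mem_span (N.comap (Finsupp.lsingle i)) h ?_
  rintro _ ⟨a, p, h1, h2, rfl⟩
  exact hN a p h1 h2

variable [SetLike.GradedMonoid 𝒮]

/-! ### The inductive step: the first syzygies of a stage -/

/-- A graded module with generators of degree `n`, each of them labelled by a path of length `n`,
which has a basis of products of generators with those normal paths whose last letter is not
forbidden, and in which a product of a generator with a forbidden letter is a combination of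
smaller terms. -/
structure Stage (n : ℕ) where
  M : Type (max u v w)
  [addCommGroup : AddCommGroup M]
  [module : Module S M]
  gr : ℕ → AddSubgroup M
  smul_mem : ∀ {p q} {s : S} {x : M}, s ∈ 𝒮 p → x ∈ gr q → s • x ∈ gr (p + q)
  ι : Type (max v w)
  vx : ι → W
  tx : ι → W
  chain : ∀ i, Quiver.Path (vx i) (tx i)
  length_chain : ∀ i, (chain i).length = n
  gen : ι → M
  gen_mem : ∀ i, gen i ∈ gr n
  forb : ∀ (i : ι) {b : W}, (b ⟶ vx i) → Prop
  surj : ∀ x, ∃ f ∈ D.free vx, Finsupp.linearCombination S gen f = x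
  indep : ∀ f ∈ D.irr forb, Finsupp.linearCombination S gen f = 0 → f = 0
  red : ∀ (i : ι) (b : W) (x : b ⟶ vx i), forb i x → D.Nrm x.toPath →
    ∃ g ∈ D.termSpan chain (D.below b ⟨b, tx i, x.toPath.comp (chain i)⟩),
      D.val x.toPath • gen i = Finsupp.linearCombination S gen g

attribute [instance] Stage.addCommGroup Stage.module

namespace Stage

variable {D} {n : ℕ} (X : D.Stage n)

/-- The projective cover. -/
def cover : D.free X.vx →ₗ[S] X.M :=
  Finsupp.linearCombination S X.gen ∘ₗ (D.free X.vx).subtype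

theorem cover_surjective : Function.Surjective X.cover := fun x => by
  obtain ⟨f, hf, rfl⟩ := X.surj x
  exact ⟨⟨f, hf⟩, rfl⟩

theorem cover_mem {q : ℕ} {f : D.free X.vx} (hf : f ∈ D.freeGr X.vx n q) : X.cover f ∈ X.gr q := by
  change Finsupp.linearCombination S X.gen f.1 ∈ X.gr q
  rw [Finsupp.linearCombination_apply]
  refine sum_mem fun i _ => ?_
  rcases lt_or_ge q n with hq | hq
  · have : f.1 i = 0 := D.eq_zero_of_proj fun m' => hf i m' (by omega)
    simp only [this, zero_smul]
    exact zero_mem _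
  · have : f.1 i ∈ 𝒮 (q - n) := D.mem_of_proj fun m' hm' => hf i m' (by omega)
    have h := X.smul_mem this (X.gen_mem i)
    rwa [Nat.sub_add_cancel hq] at h

/-- The generators of the first syzygy module. -/
structure Next where
  i : X.ι
  b : W
  x : b ⟶ X.vx i
  forb : X.forb i x
  nrm : D.Nrm x.toPath

variable {X} in
/-- The label of a generator of the first syzygy module. -/
def Next.chain (k : X.Next) : Quiver.Path k.b (X.tx k.i) := k.x.toPath.comp (X.chain k.i)

theorem exists_tail (k : X.Next) : ∃ g ∈ D.termSpan X.chain (D.below k.b ⟨k.b, X.tx k.i, k.chain⟩),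
    D.val k.x.toPath • X.gen k.i = Finsupp.linearCombination S X.gen g :=
  X.red k.i k.b k.x k.forb k.nrm

/-- The tail of a syzygy. -/
def tail (k : X.Next) : X.ι →₀ S := (X.exists_tail k).choose

theorem tail_mem (k : X.Next) :
    X.tail k ∈ D.termSpan X.chain (D.below k.b ⟨k.b, X.tx k.i, k.chain⟩) :=
  (X.exists_tail k).choose_spec.1

/-- The syzygy that expresses the product of a generator with a forbidden letter by smaller
terms. -/
def syz (k : X.Next) : X.ι →₀ S := Finsupp.single k.i (D.val k.x.toPath) - X.tail k

theorem syz_mem_free (k : X.Next) : X.syz k ∈ D.free X.vx :=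
  sub_mem (D.single_val_mem_free _ _ _) (D.termSpan_le_free _ _ (X.tail_mem k))

theorem linearCombination_syz (k : X.Next) : Finsupp.linearCombination S X.gen (X.syz k) = 0 := by
  have h : D.val k.x.toPath • X.gen k.i = Finsupp.linearCombination S X.gen (X.tail k) :=
    (X.exists_tail k).choose_spec.2
  rw [syz, map_sub, Finsupp.linearCombination_single, h, sub_self]

/-- Left multiplication preserves strict inequalities of words, so the leading term of a multiple of
a syzygy is the multiple of its leading term. -/
theorem val_smul_syz (k : X.Next) {a : W} (v : Quiver.Path a k.b) :
    ∃ h ∈ D.termSpan X.chain (D.below a ⟨a, X.tx k.i, v.comp k.chain⟩),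
      D.val v • X.syz k = Finsupp.single k.i (D.val (v.cons k.x)) - h := by
  refine ⟨D.val v • X.tail k, D.val_smul_mem_termSpan X.chain v _ (X.tail_mem k), ?_⟩
  rw [syz, smul_sub, Finsupp.smul_single, smul_eq_mul, ← D.val_comp]
  rfl

/-- A term on the new generator `k` has the same word as the leading term of its image. Bounds on
words therefore pass between two consecutive stages. -/
theorem comp_next_chain (k : X.Next) {a : W} (v : Quiver.Path a k.b) :
    v.comp k.chain = (v.cons k.x).comp (X.chain k.i) := by
  rw [Next.chain, ← Quiver.Path.comp_assoc]
  rfl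

/-- The map from the free module on the syzygies. -/
def syzMap : (X.Next →₀ S) →ₗ[S] X.ι →₀ S := Finsupp.linearCombination S X.syz

theorem linearCombination_syzMap (f : X.Next →₀ S) :
    Finsupp.linearCombination S X.gen (X.syzMap f) = 0 := by
  induction f using Finsupp.induction_linear with
  | zero => simp
  | add f g hf hg => rw [map_add, map_add, hf, hg, add_zero]
  | single k s =>
    rw [syzMap, Finsupp.linearCombination_single, map_smul, X.linearCombination_syz, smul_zero]

/-- The image of the terms that satisfy a condition. -/
def syzSpan (C : QPath W → Prop) : Submodule K (X.ι →₀ S) :=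
  (D.termSpan (fun k : X.Next => k.chain) C).map (X.syzMap.restrictScalars K)

theorem syzSpan_mono {C C' : QPath W → Prop} (h : ∀ q, C q → C' q) : X.syzSpan C ≤ X.syzSpan C' :=
  Submodule.map_mono (D.termSpan_mono _ h)

/-- Well-founded induction on the word: a path that is not normal is rewritten by its normal form,
and a forbidden last letter is removed by subtracting a multiple of a syzygy. What remains has
smaller words. The words of the syzygies used are bounded by `q`, which is needed for the rewriting
rules of the next stage. -/
theorem single_mem_sup (q : QPath W) : ∀ (i : X.ι) (a : W) (p : Quiver.Path a (X.vx i)),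
    q = ⟨a, X.tx i, p.comp (X.chain i)⟩ → Finsupp.single i (D.val p) ∈
      X.syzSpan (fun q' => q'.src = a ∧ (q' = q ∨ D.lt q' q)) ⊔ D.irr X.forb := by
  induction q using D.lt_wf.induction with
  | _ q ih =>
  intro i a p hq
  -- Terms with smaller words come from the induction hypothesis, whose bound is relaxed to `q` by
  -- transitivity.
  have low : D.termSpan X.chain (D.below a q) ≤
      X.syzSpan (fun q' => q'.src = a ∧ (q' = q ∨ D.lt q' q)) ⊔ D.irr X.forb := by
    refine Submodule.span_le.2 ?_
    rintro _ ⟨j, a', p', ⟨h1, h2⟩, rfl⟩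
    obtain rfl : a' = a := h1
    refine sup_le_sup_right (X.syzSpan_mono ?_) _ (ih _ h2 j a' p' rfl)
    rintro q' ⟨h3, rfl | h4⟩
    · exact ⟨h3, Or.inr h2⟩
    · exact ⟨h3, Or.inr (D.lt_trans h4 h2)⟩
  by_cases hp : D.Nrm p
  swap
  · exact low (hq ▸ D.single_val_mem_of_not_nrm X.chain hp)
  by_cases hirr : ∀ (c : W) (q : Quiver.Path a c) (x : c ⟶ X.vx i), p = q.cons x → ¬ X.forb i x
  · exact Submodule.mem_sup_right (D.single_mem_irr hp hirr)
  push Not at hirr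
  obtain ⟨c, v, x, rfl, hx⟩ := hirr
  -- The term is the leading term of `v` times this syzygy, and the difference consists of terms
  -- with smaller words.
  let k : X.Next := ⟨i, c, x, hx, D.nrm_letter hp⟩
  obtain ⟨h, hh, he⟩ := X.val_smul_syz k v
  have he' : Finsupp.single i (D.val (v.cons x)) = D.val v • X.syz k + h := by
    rw [he]; exact (sub_add_cancel _ _).symm
  have hw : v.comp k.chain = (v.cons x).comp (X.chain i) := X.comp_next_chain k v
  rw [he']
  refine add_mem (Submodule.mem_sup_left ⟨Finsupp.single k (D.val v), ?_, ?_⟩) (low ?_)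
  · refine D.single_mem_termSpan (fun k : X.Next => k.chain) ⟨rfl, Or.inl ?_⟩
    rw [hq, hw]
  · exact Finsupp.linearCombination_single S (D.val v) k
  · rw [hq, ← hw]
    exact hh

/-- Reduction never enlarges words, so a relation whose terms lie below `t` is a combination of
multiples of syzygies with words below `t`. This strict bound makes the tails of the next syzygies
smaller than their leading terms. -/
theorem mem_syzSpan_of_below {a : W} {t : QPath W} {f : X.ι →₀ S}
    (hf : f ∈ D.termSpan X.chain (D.below a t)) (h0 : Finsupp.linearCombination S X.gen f = 0) :
    f ∈ X.syzSpan (D.below a t) := by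
  have h : D.termSpan X.chain (D.below a t) ≤ X.syzSpan (D.below a t) ⊔ D.irr X.forb := by
    refine Submodule.span_le.2 ?_
    rintro _ ⟨j, a', p', ⟨h1, h2⟩, rfl⟩
    obtain rfl : a' = a := h1
    refine sup_le_sup_right (X.syzSpan_mono ?_) _ (X.single_mem_sup _ j a' p' rfl)
    rintro q' ⟨h3, rfl | h4⟩
    · exact ⟨h3, h2⟩
    · exact ⟨h3, D.lt_trans h4 h2⟩
  obtain ⟨y, hy, z, hz, rfl⟩ := Submodule.mem_sup.1 (h hf)
  obtain ⟨g, hg, rfl⟩ := hy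
  -- The syzygy part is a relation, hence so is the irreducible remainder, which vanishes by the
  -- independence at this stage.
  have hz0 : Finsupp.linearCombination S X.gen z = 0 := by
    rw [map_add] at h0
    rwa [show Finsupp.linearCombination S X.gen ((X.syzMap.restrictScalars K) g) = 0 from
      X.linearCombination_syzMap g, zero_add] at h0
  rw [X.indep z hz hz0, add_zero]
  exact ⟨g, hg, rfl⟩

theorem exists_syzMap_eq {f : X.ι →₀ S} (hf : f ∈ D.free X.vx)
    (h0 : Finsupp.linearCombination S X.gen f = 0) :
    ∃ g ∈ D.free (fun k : X.Next => k.b), X.syzMap g = f := by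
  have h : f ∈ X.syzSpan (fun _ => True) ⊔ D.irr X.forb := by
    refine D.free_induction X.vx (X.syzSpan (fun _ => True) ⊔ D.irr X.forb).toAddSubmonoid
      (fun c i a p => ?_) hf
    rw [← Finsupp.smul_single]
    refine Submodule.smul_mem _ c ?_
    exact sup_le_sup_right (X.syzSpan_mono fun _ _ => trivial) _ (X.single_mem_sup _ i a p rfl)
  obtain ⟨y, hy, z, hz, rfl⟩ := Submodule.mem_sup.1 h
  obtain ⟨g, hg, rfl⟩ := hy
  have hz0 : Finsupp.linearCombination S X.gen z = 0 := by
    rw [map_add] at h0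
    rwa [show Finsupp.linearCombination S X.gen ((X.syzMap.restrictScalars K) g) = 0 from
      X.linearCombination_syzMap g, zero_add] at h0
  rw [X.indep z hz hz0, add_zero]
  exact ⟨g, D.termSpan_le_free _ _ hg, rfl⟩

/-- The forbidden last letters for the syzygies. -/
def nextForb (k : X.Next) {a : W} (y : a ⟶ k.b) : Prop := ¬ D.Nrm (y.toPath.cons k.x)

/-- The multiple of a syzygy by `v` has leading term `vx` on the old generator. When `vx` is normal
the coordinate at this term is `1`, distinct pairs give distinct leading terms, and the family is
triangular. -/
theorem syzMap_injOn {f : X.Next →₀ S} (hf : f ∈ D.irr (vx := fun k : X.Next => k.b) X.nextForb)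
    (h0 : X.syzMap f = 0) : f = 0 := by
  let T := Σ (k : X.Next) (a : W), {v : Quiver.Path a k.b // D.Nrm (v.cons k.x)}
  let word : T → QPath W := fun t => ⟨t.2.1, X.tx t.1.i, t.2.2.1.comp t.1.chain⟩
  have hli : LinearIndependent K fun t : T => D.val t.2.2.1 • X.syz t.1 := by
    refine linearIndependent_of_triangular (fun s t => D.lt (word s) (word t))
      (fun t => D.lt_irrefl _) (fun _ _ _ => D.lt_trans) _
      (fun t => D.coord ⟨t.2.1, X.vx t.1.i, t.2.2.1.cons t.1.x⟩ ∘ₗ Finsupp.lapply t.1.i) ?_ ?_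
    · rintro ⟨k, a, v, hv⟩
      obtain ⟨h, hh, he⟩ := X.val_smul_syz k v
      dsimp only
      rw [he, map_sub, LinearMap.comp_apply, LinearMap.comp_apply, Finsupp.lapply_apply,
        Finsupp.lapply_apply, Finsupp.single_eq_same, D.coord_self hv, D.coord_termSpan X.chain hv ?_ hh,
        sub_zero]
      rw [X.comp_next_chain]
      exact D.lt_irrefl _
    · rintro ⟨k, a, v, hv⟩ ⟨k', a', v', hv'⟩ hne
      by_contra! hcon
      obtain ⟨h, hh, he⟩ := X.val_smul_syz k' v'
      apply hne
      dsimp only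
      have h1 : ¬ D.lt ⟨a, X.tx k.i, (v.cons k.x).comp (X.chain k.i)⟩
          ⟨a', X.tx k'.i, v'.comp k'.chain⟩ := by
        rw [← X.comp_next_chain]
        exact hcon.2
      rw [he, map_sub, LinearMap.comp_apply, LinearMap.comp_apply, Finsupp.lapply_apply,
        Finsupp.lapply_apply, D.coord_termSpan X.chain hv h1 hh, sub_zero]
      by_contra h2
      rcases D.coord_single_ne_zero X.chain hv h2 with ⟨h3, h4⟩ | h3
      · apply hcon.1
        obtain ⟨i, b, x, _, _⟩ := k
        obtain ⟨i', b', x', _, _⟩ := k'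
        obtain rfl : i = i' := h3
        cases h4
        rfl
      · exact h1 (by rwa [← X.comp_next_chain k' v'] at h3)
  have hspan : f ∈ Submodule.span K (Set.range fun t : T => Finsupp.single t.1 (D.val t.2.2.1)) := by
    refine Submodule.span_mono ?_ (D.mem_span_of_mem_irr hf)
    rintro _ ⟨k, a, p, hp, hp', rfl⟩
    refine ⟨⟨k, a, p, ?_⟩, rfl⟩
    -- The quadratic hypothesis enters here: `qy` is normal and `y` is allowed before `x`, so `yx`
    -- and therefore `qyx` are normal. The empty path only needs the letter `x` to be normal.
    cases p with
    | nil => exact k.nrm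
    | cons q y => exact D.nrm_cons_cons hp (not_not.1 (hp' _ q y rfl))
  obtain ⟨l, rfl⟩ := (Finsupp.mem_span_range_iff_exists_finsupp).1 hspan
  have h1 : Finsupp.linearCombination K (fun t : T => D.val t.2.2.1 • X.syz t.1) l = 0 := by
    rw [← h0, Finsupp.linearCombination_apply, Finsupp.sum, Finsupp.sum, map_sum]
    refine Finset.sum_congr rfl fun t _ => ?_
    rw [← LinearMap.restrictScalars_apply K, map_smul, LinearMap.restrictScalars_apply]
    congr 1
    exact (Finsupp.linearCombination_single S (D.val t.2.2.1) t.1).symm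
  rw [linearIndependent_iff.1 hli l h1, Finsupp.sum_zero_index]

/-- The kernel of the projective cover. -/
def ker : Submodule S (D.free X.vx) := LinearMap.ker X.cover

instance : AddCommGroup X.ker := Submodule.addCommGroup (M := D.free X.vx) X.ker

instance : Module S X.ker := Submodule.module X.ker

/-- The homogeneous parts of the kernel of the projective cover. -/
def kerGr (q : ℕ) : AddSubgroup X.ker where
  carrier := {x | x.1 ∈ D.freeGr X.vx n q}
  zero_mem' := zero_mem (D.freeGr X.vx n q)
  add_mem' {x y} hx hy := (D.freeGr X.vx n q).add_mem (x := x.1) (y := y.1) hx hy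
  neg_mem' {x} hx := (D.freeGr X.vx n q).neg_mem (x := x.1) hx

theorem mem_kerGr {q : ℕ} {x : X.ker} : x ∈ X.kerGr q ↔ x.1 ∈ D.freeGr X.vx n q := Iff.rfl

theorem smul_mem_kerGr {p q : ℕ} {s : S} {x : X.ker} (hs : s ∈ 𝒮 p) (hx : x ∈ X.kerGr q) :
    s • x ∈ X.kerGr (p + q) :=
  X.mem_kerGr.2 (D.smul_mem_freeGr X.vx n p q s x.1 hs (X.mem_kerGr.1 hx))

/-- A syzygy, as an element of the kernel of the projective cover. -/
def kerSyz (k : X.Next) : X.ker :=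
  ⟨⟨X.syz k, X.syz_mem_free k⟩, X.linearCombination_syz k⟩

theorem coe_linearCombination_kerSyz (f : X.Next →₀ S) :
    ((Finsupp.linearCombination S X.kerSyz f : X.ker).1 : D.free X.vx).1 =
      X.syzMap f := by
  induction f using Finsupp.induction_linear with
  | zero => simp
  | add f g hf hg =>
    rw [map_add, map_add, ← hf, ← hg]
    rfl
  | single k s =>
    rw [syzMap, Finsupp.linearCombination_single, Finsupp.linearCombination_single]
    rfl

/-- The order compares only words of equal length, here `n + 1`, while the old chains have length
`n`. The tail of a syzygy therefore has coefficients of degree `1`, and this makes the resolution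
linear. -/
theorem termSpan_homogeneous {k : X.Next} {f : X.ι →₀ S}
    (hf : f ∈ D.termSpan X.chain (D.below k.b ⟨k.b, X.tx k.i, k.chain⟩)) (i : X.ι) : f i ∈ 𝒮 1 := by
  classical
  have h : D.termSpan X.chain (D.below k.b ⟨k.b, X.tx k.i, k.chain⟩) ≤
      (𝒮 1).comap (Finsupp.lapply i) := by
    refine Submodule.span_le.2 ?_
    rintro _ ⟨j, a, p, ⟨-, hp⟩, rfl⟩
    change Finsupp.single j (D.val p) i ∈ 𝒮 1
    rw [Finsupp.single_apply]
    split_ifs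
    · have h1 : (p.comp (X.chain j)).length = k.chain.length := D.lt_length hp
      rw [Next.chain, Quiver.Path.length_comp, Quiver.Path.length_comp, X.length_chain,
        X.length_chain, Quiver.Path.length_toPath] at h1
      have h2 := D.val_mem p
      rwa [show p.length = 1 by omega] at h2
    · exact zero_mem _
  exact h hf

theorem kerSyz_mem (k : X.Next) : (X.kerSyz k).1 ∈ D.freeGr X.vx n (n + 1) := by
  intro i m hm
  change D.proj m (X.syz k i) = 0
  have h : X.syz k i ∈ 𝒮 1 := by
    classical
    refine sub_mem ?_ (X.termSpan_homogeneous (X.tail_mem k) i)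
    rw [Finsupp.single_apply]
    split_ifs
    · exact D.val_mem k.x.toPath
    · exact zero_mem _
  rw [D.proj_of_mem h, if_neg (by omega)]

/-- The first syzygy module. -/
@[reducible] def next : D.Stage (n + 1) where
  M := X.ker
  gr := X.kerGr
  smul_mem := X.smul_mem_kerGr
  ι := X.Next
  vx k := k.b
  tx k := X.tx k.i
  chain k := k.chain
  length_chain k := by
    rw [Next.chain, Quiver.Path.length_comp, X.length_chain, Quiver.Path.length_toPath, add_comm]
  gen := X.kerSyz
  gen_mem k := X.mem_kerGr.2 (X.kerSyz_mem k)
  forb := X.nextForb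
  surj x := by
    obtain ⟨g, hg, h⟩ := X.exists_syzMap_eq x.1.2 x.2
    refine ⟨g, hg, Subtype.ext (Subtype.ext ?_)⟩
    rw [← h]
    exact X.coe_linearCombination_kerSyz g
  indep f hf h := X.syzMap_injOn hf (by
    rw [← X.coe_linearCombination_kerSyz, h]
    rfl)
  red k a y hy _ := by
    have h0 : Finsupp.linearCombination S X.gen (D.val y.toPath • X.syz k) = 0 := by
      rw [map_smul, X.linearCombination_syz, smul_zero]
    -- Since `yx` is not normal, even the leading term of this multiple reduces to smaller words, so
    -- the whole relation lies strictly below the word of `y` and `k`.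
    have h1 : D.val y.toPath • X.syz k ∈
        D.termSpan X.chain (D.below a ⟨a, X.tx k.i, y.toPath.comp k.chain⟩) := by
      obtain ⟨h, hh, he⟩ := X.val_smul_syz k y.toPath
      rw [he]
      refine sub_mem ?_ hh
      rw [X.comp_next_chain]
      exact D.single_val_mem_of_not_nrm X.chain hy
    obtain ⟨g, hg, he⟩ := X.mem_syzSpan_of_below h1 h0
    refine ⟨g, hg, Subtype.ext (Subtype.ext ?_)⟩
    exact he.symm.trans (X.coe_linearCombination_kerSyz g).symm

/-- The differential from the projective cover of the first syzygy module. -/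
def diff : D.free X.next.vx →ₗ[S] D.free X.vx :=
  (X.ker).subtype ∘ₗ X.next.cover

theorem diff_mem {q : ℕ} {f : D.free X.next.vx} (hf : f ∈ D.freeGr X.next.vx (n + 1) q) :
    X.diff f ∈ D.freeGr X.vx n q := X.mem_kerGr.1 (X.next.cover_mem hf)

theorem exact_diff_cover : Function.Exact X.diff X.cover := by
  intro f
  constructor
  · intro h
    obtain ⟨g, hg⟩ := X.next.cover_surjective ⟨f, h⟩
    refine ⟨g, ?_⟩
    change ((X.next.cover g : X.ker) : D.free X.vx) = f
    rw [hg]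
  · rintro ⟨g, rfl⟩
    exact (X.next.cover g : X.ker).2

/-- The differential is the cover of the kernel followed by an inclusion, so it has the same kernel
as that cover. -/
theorem exact_diff_diff : Function.Exact X.next.diff X.diff := by
  intro f
  rw [← X.next.exact_diff_cover f]
  exact ⟨fun h => Subtype.ext h, fun h => congrArg Subtype.val h⟩

end Stage

end QuadraticNormalForm

/-! ### The resolution of the degree zero part -/

namespace QuadraticNormalForm

variable {K : Type u} {W : Type v} [Field K] [Quiver.{w} W] [Fintype W]
  {S : Type (max u v w)} [Ring S] [Algebra K S] {𝒮 : ℕ → Submodule K S}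
  (D : QuadraticNormalForm W 𝒮) [SetLike.GradedMonoid 𝒮]

theorem proj_zero_of_mem_irrelevantIdeal {s : S} (hs : s ∈ irrelevantIdeal 𝒮) :
    D.proj 0 s = 0 := by
  -- The statement for all left multiples is what survives the induction on a left ideal.
  have h : ∀ r : S, D.proj 0 (r * s) = 0 := by
    induction hs using Submodule.span_induction with
    | mem x hx =>
      obtain ⟨p, hp, hx⟩ := hx
      refine D.span_homogeneous (AddMonoidHom.ker
        ((D.proj 0).toAddMonoidHom.comp (AddMonoidHom.mulRight x))).toAddSubmonoid ?_
      intro q r hr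
      change D.proj 0 (r * x) = 0
      rw [D.proj_of_mem (SetLike.GradedMul.mul_mem hr hx), if_neg (by omega)]
    | zero => simp
    | add x y _ _ hx hy => intro r; rw [mul_add, map_add, hx, hy, add_zero]
    | smul c x _ hx => intro r; rw [smul_eq_mul, ← mul_assoc, hx]
  simpa using h 1

/-- The irrelevant ideal is defined as a left ideal, but right multiples of an element of positive
degree by homogeneous elements again have positive degree. -/
theorem smul_eq_zero_of_pos (D : QuadraticNormalForm W 𝒮) {p : ℕ} (hp : 0 < p) {s : S} (hs : s ∈ 𝒮 p)
    (x : S ⧸ irrelevantIdeal 𝒮) : s • x = 0 := by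
  obtain ⟨r, rfl⟩ := Submodule.Quotient.mk_surjective _ x
  rw [← Submodule.Quotient.mk_smul, Submodule.Quotient.mk_eq_zero]
  refine D.span_homogeneous (AddSubmonoid.comap (AddMonoidHom.mulLeft s)
    (irrelevantIdeal 𝒮).toAddSubmonoid) (fun q r hr => ?_) r
  exact Submodule.subset_span ⟨p + q, by omega, SetLike.GradedMul.mul_mem hs hr⟩

/-- The elements of degree `0` of the module `S_0`. -/
def _root_.degreeZeroGr {K S : Type*} [CommRing K] [Ring S] [Algebra K S] (𝒮 : ℕ → Submodule K S)
    (q : ℕ) : AddSubgroup (S ⧸ irrelevantIdeal 𝒮) :=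
  if q = 0 then ⊤ else ⊥

/-- The module `S_0`. -/
@[reducible] def initial : D.Stage 0 where
  M := S ⧸ irrelevantIdeal 𝒮
  gr := degreeZeroGr 𝒮
  smul_mem {p q s x} hs hx := by
    rcases Nat.eq_zero_or_pos p with rfl | hp
    · rcases Nat.eq_zero_or_pos q with rfl | hq
      · trivial
      · rw [degreeZeroGr, if_neg hq.ne'] at hx
        rw [(AddSubgroup.mem_bot).1 hx, smul_zero]
        exact zero_mem _
    · rw [D.smul_eq_zero_of_pos hp hs]
      exact zero_mem _
  ι := ULift.{w} W
  vx a := a.down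
  tx a := a.down
  chain a := Quiver.Path.nil
  length_chain _ := rfl
  gen a := Submodule.Quotient.mk (D.e a.down)
  gen_mem _ := trivial
  -- Positive degree acts by zero on this module: every letter is forbidden, with tail `0`, and only
  -- the vertices are irreducible.
  forb _ _ _ := True
  surj x := by
    obtain ⟨s, rfl⟩ := Submodule.Quotient.mk_surjective _ x
    refine ⟨∑ a : ULift.{w} W, Finsupp.single a (s * D.e a.down), sum_mem fun a _ => ?_, ?_⟩
    · have h := (D.free fun a : ULift.{w} W => a.down).smul_mem s
        (D.single_val_mem_free (fun a : ULift.{w} W => a.down) a Quiver.Path.nil)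
      rwa [Finsupp.smul_single] at h
    · rw [map_sum]
      simp only [Finsupp.linearCombination_single]
      simp only [← Submodule.Quotient.mk_smul, smul_eq_mul, mul_assoc, D.e_mul_self]
      rw [← Submodule.mkQ_apply]
      simp only [← Submodule.mkQ_apply]
      rw [← map_sum, ← Finset.mul_sum]
      congr 1
      have h : ∑ a : ULift.{w} W, D.e a.down = 1 := by
        rw [← D.sum_val]
        exact Fintype.sum_equiv Equiv.ulift _ _ fun _ => rfl
      rw [h, mul_one]
  indep f hf h := by
    have h1 : ∀ a : ULift.{w} W, f a ∈ Submodule.span K {D.e a.down} := by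
      intro a
      refine Submodule.span_mono ?_ ((Submodule.mem_iInf _).1 hf a)
      rintro _ ⟨b, p, hp, hp', rfl⟩
      cases p with
      | nil => rfl
      | cons q x => exact absurd trivial (hp' _ q x rfl)
    have h2 : ∀ a : ULift.{w} W, f a * D.e a.down = f a := by
      intro a
      obtain ⟨c, hc⟩ := Submodule.mem_span_singleton.1 (h1 a)
      rw [← hc, smul_mul_assoc, D.e_mul_self]
    have h3 : ∀ a b : ULift.{w} W, a ≠ b → f a * D.e b.down = 0 := by
      intro a b hab
      obtain ⟨c, hc⟩ := Submodule.mem_span_singleton.1 (h1 a)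
      rw [← hc, smul_mul_assoc]
      have : D.e a.down * D.e b.down = 0 :=
        D.val_mul_e_of_ne Quiver.Path.nil fun h => hab (ULift.ext _ _ h)
      rw [this, smul_zero]
    have h4 : ∑ a ∈ f.support, f a ∈ irrelevantIdeal 𝒮 := by
      rw [← Submodule.Quotient.mk_eq_zero, ← h, Finsupp.linearCombination_apply, Finsupp.sum,
        ← Submodule.mkQ_apply, map_sum]
      refine Finset.sum_congr rfl fun a _ => ?_
      rw [← Submodule.Quotient.mk_smul, smul_eq_mul, h2, Submodule.mkQ_apply]
    -- The sum lies in degree `0` and in the irrelevant ideal; multiplying by the idempotents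
    -- afterwards separates its terms.
    have h5 : ∑ a ∈ f.support, f a = 0 := by
      have h6 : ∑ a ∈ f.support, f a ∈ 𝒮 0 := by
        refine sum_mem fun a _ => ?_
        obtain ⟨c, hc⟩ := Submodule.mem_span_singleton.1 (h1 a)
        rw [← hc]
        exact Submodule.smul_mem _ c (D.e_mem _)
      have h7 := D.proj_zero_of_mem_irrelevantIdeal h4
      rwa [D.proj_of_mem h6, if_pos rfl] at h7
    ext b
    have h8 := congrArg (· * D.e b.down) h5
    simp only [Finset.sum_mul, zero_mul] at h8
    rw [Finset.sum_eq_single b, h2] at h8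
    · exact h8
    · exact fun a _ hab => h3 a b hab
    · intro hb
      rw [Finsupp.notMem_support_iff.1 hb, zero_mul]
  red a b x _ _ := by
    refine ⟨0, zero_mem _, ?_⟩
    rw [map_zero]
    exact D.smul_eq_zero_of_pos one_pos (D.val_mem x.toPath) _

/-- The iterated syzygies of the module `S_0`. -/
def stage : ∀ n : ℕ, D.Stage n
  | 0 => D.initial
  | n + 1 => (stage n).next

/-- The linear resolution of `S_0`. -/
def resolution : PureResolution 𝒮 fun i => i where
  P i := D.free (D.stage i).vx
  addCommGroup i := inferInstance
  module i := inferInstance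
  gr i := D.freeGr (D.stage i).vx i
  isInternal i := D.isInternal_freeGr _ _
  smul_mem i p q s x hs hx := D.smul_mem_freeGr _ _ _ _ _ _ hs hx
  projective i := D.projective_free _
  generated i := D.freeGr_generated _ _
  d i := (D.stage i).diff
  d_mem i p x hx := (D.stage i).diff_mem hx
  aug := (D.stage 0).cover
  aug_degree p hp x hx := by
    have h : (D.stage 0).cover x ∈ degreeZeroGr 𝒮 p := (D.stage 0).cover_mem hx
    rw [degreeZeroGr, if_neg hp.ne'] at h
    exact AddSubgroup.mem_bot.1 h
  aug_surjective := (D.stage 0).cover_surjective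
  exact_aug := (D.stage 0).exact_diff_cover
  exact i := (D.stage i).exact_diff_diff

open Classical in
/-- The map from the algebra of functions on the vertices to the homogeneous part of degree `0`. -/
def vertexMap : (W → K) →+* 𝒮 0 where
  toFun f := ⟨∑ a, f a • D.e a, sum_mem fun a _ => Submodule.smul_mem _ _ (D.e_mem a)⟩
  map_one' := Subtype.ext (by simpa using! D.sum_val)
  map_mul' f g := Subtype.ext (by
    change _ = (∑ a, f a • D.e a) * ∑ a, g a • D.e a
    rw [Finset.sum_mul]
    refine Finset.sum_congr rfl fun a _ => ?_
    rw [Finset.mul_sum, Finset.sum_eq_single a]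
    · rw [smul_mul_smul_comm, D.e_mul_self]
      rfl
    · intro b _ hb
      rw [smul_mul_smul_comm]
      have : D.e a * D.e b = 0 := D.val_mul_e_of_ne _ hb.symm
      rw [this, smul_zero]
    · simp)
  map_zero' := Subtype.ext (by simp)
  map_add' f g := Subtype.ext (by simp [add_smul, Finset.sum_add_distrib])

/-- Degree zero is spanned by the idempotents of the vertices. It is thus a quotient of a finite
product of copies of `K`, which gives semisimplicity. -/
theorem vertexMap_surjective : Function.Surjective D.vertexMap := by
  classical
  rintro ⟨s, hs⟩
  have h : s ∈ Submodule.span K (Set.range D.e) := by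
    refine Submodule.span_mono ?_ (D.span_val 0 hs)
    rintro _ ⟨a, b, p, hp, rfl⟩
    obtain rfl := Quiver.Path.eq_of_length_zero p hp
    rw [Quiver.Path.eq_nil_of_length_zero p hp]
    exact ⟨a, rfl⟩
  obtain ⟨c, hc⟩ := (Submodule.mem_span_range_iff_exists_fun K).1 h
  exact ⟨c, Subtype.ext hc⟩

theorem isKoszul (D : QuadraticNormalForm W 𝒮) : IsKoszul 𝒮 where
  isInternal := D.internal
  isSemisimpleRing := RingHom.isSemisimpleRing_of_surjective D.vertexMap D.vertexMap_surjective
  resolution := ⟨D.resolution⟩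

end QuadraticNormalForm

/-! ### Multiplication by paths and monomial ideals -/

namespace QPath

variable {V : Type v} [Quiver.{w} V]

theorem comp?_eq_some_iff {p q r : QPath V} : comp? p q = some r ↔
    ∃ (a b c : V) (p' : Quiver.Path a b) (q' : Quiver.Path b c),
      p = ⟨a, b, p'⟩ ∧ q = ⟨b, c, q'⟩ ∧ r = ⟨a, c, p'.comp q'⟩ := by
  constructor
  · intro h
    obtain ⟨a, b, p⟩ := p
    obtain ⟨b', c, q⟩ := q
    by_cases hb : b' = b
    · subst hb
      rw [comp?_mk] at h
      exact ⟨a, b', c, p, q, rfl, rfl, (Option.some.inj h).symm⟩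
    · rw [comp?_of_ne hb] at h
      cases h
  · rintro ⟨a, b, c, p, q, rfl, rfl, rfl⟩
    exact comp?_mk p q

theorem finite_length_eq [Finite V] [∀ a b : V, Finite (a ⟶ b)] (n : ℕ) :
    {p : QPath V | p.length = n}.Finite := by
  induction n with
  | zero =>
    refine (Set.finite_range (vertex : V → QPath V)).subset ?_
    rintro ⟨a, b, p⟩ hp
    obtain rfl := Quiver.Path.eq_of_length_zero p hp
    obtain rfl := Quiver.Path.eq_nil_of_length_zero p hp
    exact ⟨a, rfl⟩
  | succ n ih =>
    have := ih.to_subtype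
    refine (Set.finite_range (fun t : Σ (p : {p : QPath V | p.length = n}) (c : V), (p.1.tgt ⟶ c) =>
      (⟨t.1.1.src, t.2.1, t.1.1.path.cons t.2.2⟩ : QPath V))).subset ?_
    rintro ⟨a, b, p⟩ hp
    cases p with
    | nil => cases hp
    | cons q x => exact ⟨⟨⟨⟨a, _, q⟩, Nat.succ.inj hp⟩, b, x⟩, rfl⟩

end QPath

namespace PathAlgebra

variable {K : Type u} {V : Type v} [Field K] [Quiver.{w} V]

theorem ext_coeff {f g : PathAlgebra K V} (h : ∀ p, f.coeff p = g.coeff p) : f = g :=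
  Finsupp.ext h

theorem coeff_sub (f g : PathAlgebra K V) (p : QPath V) :
    (f - g).coeff p = f.coeff p - g.coeff p := rfl

theorem coeff_ofPath_self (p : QPath V) : (ofPath K p).coeff p = 1 := Finsupp.single_eq_same

theorem coeff_ofPath_of_ne {p q : QPath V} (h : q ≠ p) : (ofPath K p).coeff q = 0 :=
  Finsupp.single_eq_of_ne h

theorem coeff_sum {ι : Type*} (s : Finset ι) (f : ι → PathAlgebra K V) (p : QPath V) :
    (∑ i ∈ s, f i).coeff p = ∑ i ∈ s, (f i).coeff p :=
  Finsupp.finsetSum_apply s f p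

theorem mem_spanPaths_support (f : PathAlgebra K V) :
    f ∈ spanPaths K V fun w => f.coeff w ≠ 0 := fun _ h => h

theorem spanPaths_mono {C D : QPath V → Prop} (h : ∀ p, C p → D p) :
    spanPaths K V C ≤ spanPaths K V D := fun _ hf w hw => h w (hf w hw)

theorem linearIndependent_ofPath : LinearIndependent K (ofPath K : QPath V → PathAlgebra K V) :=
  (Finsupp.basisSingleOne (R := K) (ι := QPath V)).linearIndependent

section Order

variable [LinearOrder (QPath V)]

theorem exists_isLM {f : PathAlgebra K V} (hf : f ≠ 0) : ∃ w, IsLM f w := by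
  have h : f.support.Nonempty := Finsupp.support_nonempty_iff.2 hf
  refine ⟨f.support.max' h, Finsupp.mem_support_iff.1 (f.support.max'_mem h), fun w hw => ?_⟩
  exact f.support.le_max' w (Finsupp.mem_support_iff.2 hw)

end Order

section Mul

variable [Fintype V]

theorem ofPath_mul_comp {a b c : V} (p : Quiver.Path a b) (q : Quiver.Path b c) :
    ofPath K ⟨a, b, p⟩ * ofPath K ⟨b, c, q⟩ = ofPath K ⟨a, c, p.comp q⟩ := by
  rw [ofPath_mul_ofPath, mulPath, QPath.comp?_mk]
  rfl

theorem ofPath_mul_of_ne {p q : QPath V} (h : q.src ≠ p.tgt) : ofPath K p * ofPath K q = 0 := by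
  rw [ofPath_mul_ofPath, mulPath, QPath.comp?_of_ne h]
  rfl

theorem coeff_ofPath_mul {a b c : V} (u : Quiver.Path a b) (p : Quiver.Path b c)
    (f : PathAlgebra K V) :
    (ofPath K ⟨a, b, u⟩ * f).coeff ⟨a, c, u.comp p⟩ = f.coeff ⟨b, c, p⟩ := by
  induction f using induction_lin with
  | h0 => rw [mul_zero]; rfl
  | hadd f g hf hg => rw [mul_add, coeff_add, coeff_add, hf, hg]
  | hsmul k f hf => rw [mul_smul_comm, coeff_smul, coeff_smul, hf]
  | hpath q =>
    obtain ⟨b', c', q⟩ := q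
    by_cases hb : b' = b
    · subst hb
      rw [ofPath_mul_comp]
      by_cases h : (⟨b', c, p⟩ : QPath V) = ⟨b', c', q⟩
      · cases h
        rw [coeff_ofPath_self, coeff_ofPath_self]
      · rw [coeff_ofPath_of_ne h, coeff_ofPath_of_ne]
        intro h'
        obtain ⟨-, rfl, h'⟩ := (QPath.mk.injEq _ _ _ _ _ _).mp h'
        exact h (by rw [Quiver.Path.comp_injective_right u (eq_of_heq h')])
    · rw [ofPath_mul_of_ne hb, coeff_ofPath_of_ne fun h => hb (congrArg QPath.src h).symm]
      rfl

theorem coeff_mul_ofPath {a b c : V} (p : Quiver.Path a b) (u : Quiver.Path b c)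
    (f : PathAlgebra K V) :
    (f * ofPath K ⟨b, c, u⟩).coeff ⟨a, c, p.comp u⟩ = f.coeff ⟨a, b, p⟩ := by
  induction f using induction_lin with
  | h0 => rw [zero_mul]; rfl
  | hadd f g hf hg => rw [add_mul, coeff_add, coeff_add, hf, hg]
  | hsmul k f hf => rw [smul_mul_assoc, coeff_smul, coeff_smul, hf]
  | hpath q =>
    obtain ⟨a', b', q⟩ := q
    by_cases hb : b = b'
    · subst hb
      rw [ofPath_mul_comp]
      by_cases h : (⟨a, b, p⟩ : QPath V) = ⟨a', b, q⟩
      · cases h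
        rw [coeff_ofPath_self, coeff_ofPath_self]
      · rw [coeff_ofPath_of_ne h, coeff_ofPath_of_ne]
        intro h'
        obtain ⟨rfl, -, h'⟩ := (QPath.mk.injEq _ _ _ _ _ _).mp h'
        exact h (by rw [Quiver.Path.comp_injective_left u (eq_of_heq h')])
    · rw [ofPath_mul_of_ne hb, coeff_ofPath_of_ne fun h => hb (congrArg QPath.tgt h)]
      rfl

theorem exists_of_coeff_ofPath_mul {u r : QPath V} {f : PathAlgebra K V}
    (h : (ofPath K u * f).coeff r ≠ 0) : ∃ s, f.coeff s ≠ 0 ∧ u.comp? s = some r :=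
  mul_mem_spanPaths (K := K) (C := fun p => p = u) (D := fun s => f.coeff s ≠ 0)
    (E := fun r => ∃ s, f.coeff s ≠ 0 ∧ u.comp? s = some r)
    (fun _ q _ hp hq hr => ⟨q, hq, hp ▸ hr⟩) (ofPath_mem _ rfl) (mem_spanPaths_support f) r h

theorem exists_of_coeff_mul_ofPath {u r : QPath V} {f : PathAlgebra K V}
    (h : (f * ofPath K u).coeff r ≠ 0) : ∃ s, f.coeff s ≠ 0 ∧ s.comp? u = some r :=
  mul_mem_spanPaths (K := K) (D := fun p => p = u) (C := fun s => f.coeff s ≠ 0)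
    (E := fun r => ∃ s, f.coeff s ≠ 0 ∧ s.comp? u = some r)
    (fun p _ _ hp hq hr => ⟨p, hp, hq ▸ hr⟩) (mem_spanPaths_support f) (ofPath_mem _ rfl) r h

/-- The two-sided ideal spanned by a set of paths that is closed under multiplication. -/
def pathIdeal (K : Type u) [Field K] (C : QPath V → Prop)
    (hl : ∀ p q r : QPath V, C q → p.comp? q = some r → C r)
    (hr : ∀ p q r : QPath V, C p → p.comp? q = some r → C r) :
    TwoSidedIdeal (PathAlgebra K V) :=
  TwoSidedIdeal.mk' (spanPaths K V C) (zero_mem _) (fun hx hy => add_mem hx hy)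
    (fun hx => neg_mem hx)
    (fun {x _} hy => mul_mem_spanPaths (fun p q r _ h h' => hl p q r h h')
      (mem_spanPaths_support x) hy)
    (fun {_ y} hx => mul_mem_spanPaths (fun p q r h _ h' => hr p q r h h') hx
      (mem_spanPaths_support y))

theorem mem_pathIdeal {C : QPath V → Prop} {hl hr} {f : PathAlgebra K V} :
    f ∈ pathIdeal K C hl hr ↔ f ∈ spanPaths K V C := by
  rw [pathIdeal, TwoSidedIdeal.mem_mk']
  rfl

/-- The paths that contain a path from `M` are closed under composition on both sides, so their
linear span is already a two-sided ideal. -/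
theorem exists_of_ofPath_mem_span {M : QPath V → Prop} {w : QPath V}
    (h : ofPath K w ∈ TwoSidedIdeal.span {f | ∃ m, M m ∧ f = ofPath K m}) :
    ∃ (a b c d : V) (s : Quiver.Path a b) (m : Quiver.Path b c) (t : Quiver.Path c d),
      M ⟨b, c, m⟩ ∧ w = ⟨a, d, (s.comp m).comp t⟩ := by
  let C : QPath V → Prop := fun w => ∃ (a b c d : V) (s : Quiver.Path a b) (m : Quiver.Path b c)
    (t : Quiver.Path c d), M ⟨b, c, m⟩ ∧ w = ⟨a, d, (s.comp m).comp t⟩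
  have hl : ∀ p q r : QPath V, C q → p.comp? q = some r → C r := by
    rintro p q r ⟨a, b, c, d, s, m, t, hm, rfl⟩ hr
    obtain ⟨a', b', c', p', q', rfl, h2, rfl⟩ := QPath.comp?_eq_some_iff.1 hr
    cases h2
    exact ⟨a', b, c, d, p'.comp s, m, t, hm, by simp [Quiver.Path.comp_assoc]⟩
  have hr : ∀ p q r : QPath V, C p → p.comp? q = some r → C r := by
    rintro p q r ⟨a, b, c, d, s, m, t, hm, rfl⟩ hr
    obtain ⟨a', b', c', p', q', h1, rfl, rfl⟩ := QPath.comp?_eq_some_iff.1 hr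
    cases h1
    exact ⟨a, b, c, c', s, m, t.comp q', hm, by simp [Quiver.Path.comp_assoc]⟩
  have hle : TwoSidedIdeal.span {f | ∃ m, M m ∧ f = ofPath K m} ≤ pathIdeal K C hl hr := by
    refine TwoSidedIdeal.span_le.2 ?_
    rintro _ ⟨⟨b, c, m⟩, hm, rfl⟩
    exact mem_pathIdeal.2 (ofPath_mem C ⟨b, b, c, c, .nil, m, .nil, hm, by simp⟩)
  exact mem_pathIdeal.1 (hle h) w (by rw [coeff_ofPath_self]; exact one_ne_zero)

end Mul

end PathAlgebra

theorem TwoSidedIdeal.proj_eq_zero {K S : Type*} [CommRing K] [Ring S] [Algebra K S]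
    {J : TwoSidedIdeal S} {x : S} : J.proj K x = 0 ↔ x ∈ J := by
  rw [TwoSidedIdeal.proj, Ideal.Quotient.mkₐ_eq_mk, Ideal.Quotient.eq_zero_iff_mem,
    TwoSidedIdeal.mem_asIdeal]

/-! ### Normal paths, normal forms and division -/

namespace PathAlgebra

variable {K : Type u} {V : Type v} [Field K] [Quiver.{w} V]

theorem proj_eq_proj [Fintype V] {I : TwoSidedIdeal (PathAlgebra K V)} {f g : PathAlgebra K V} :
    I.proj K f = I.proj K g ↔ f - g ∈ I := by
  rw [← sub_eq_zero, ← map_sub, TwoSidedIdeal.proj_eq_zero]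

section

variable [LinearOrder (QPath V)]

theorem IsGradedMonomialOrder.length_le (hord : IsGradedMonomialOrder V) {p q : QPath V}
    (h : p ≤ q) : p.length ≤ q.length :=
  not_lt.1 fun h' => absurd h (not_le.2 (hord.of_length_lt _ _ h'))

/-- A smaller path is not longer and there are finitely many paths of each length, so every path has
finitely many predecessors; their number is a decreasing measure. -/
theorem IsGradedMonomialOrder.wellFounded [Finite V] [∀ a b : V, Finite (a ⟶ b)]
    (hord : IsGradedMonomialOrder V) :
    WellFounded ((· < ·) : QPath V → QPath V → Prop) := by
  have hfin : ∀ p : QPath V, (Set.Iio p).Finite := by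
    intro p
    have h : (⋃ n ∈ Set.Iic p.length, {q : QPath V | q.length = n}).Finite :=
      (Set.finite_Iic _).biUnion fun n _ => QPath.finite_length_eq n
    refine h.subset fun q hq => ?_
    simp only [Set.mem_iUnion]
    exact ⟨q.length, hord.length_le (le_of_lt hq), rfl⟩
  refine Subrelation.wf (r := InvImage (· < ·) fun p : QPath V => (Set.Iio p).ncard) ?_
    (InvImage.wf _ wellFounded_lt)
  intro p q hpq
  refine Set.ncard_lt_ncard ⟨fun r hr => lt_trans hr hpq, fun h => ?_⟩ (hfin q)
  exact lt_irrefl p (h hpq)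

theorem IsLM.degree_eq (hord : IsGradedMonomialOrder V) {f : PathAlgebra K V} {p : QPath V}
    (h : IsLM f p) : f.degree = p.length := by
  refine le_antisymm (Finset.sup_le fun q hq => ?_) (le_degree f p h.1)
  exact hord.length_le (h.2 q (Finsupp.mem_support_iff.1 hq))

theorem IsLM.unique {f : PathAlgebra K V} {p q : QPath V} (hp : IsLM f p) (hq : IsLM f q) :
    p = q := le_antisymm (hq.2 p hp.1) (hp.2 q hq.1)

variable [Fintype V]

theorem IsLM.ofPath_mul (hord : IsGradedMonomialOrder V) {f : PathAlgebra K V} {a b c : V}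
    (u : Quiver.Path a b) {p : Quiver.Path b c} (h : IsLM f ⟨b, c, p⟩) :
    IsLM (ofPath K ⟨a, b, u⟩ * f) ⟨a, c, u.comp p⟩ := by
  refine ⟨by rw [coeff_ofPath_mul]; exact h.1, fun w hw => ?_⟩
  obtain ⟨s, hs, hsw⟩ := exists_of_coeff_ofPath_mul hw
  rcases (h.2 s hs).lt_or_eq with hlt | rfl
  · exact (hord.mul_left _ _ _ _ _ hlt hsw (QPath.comp?_mk _ _)).le
  · rw [QPath.comp?_mk] at hsw
    exact (Option.some.inj hsw).ge

theorem IsLM.mul_ofPath (hord : IsGradedMonomialOrder V) {f : PathAlgebra K V} {a b c : V}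
    {p : Quiver.Path a b} (u : Quiver.Path b c) (h : IsLM f ⟨a, b, p⟩) :
    IsLM (f * ofPath K ⟨b, c, u⟩) ⟨a, c, p.comp u⟩ := by
  refine ⟨by rw [coeff_mul_ofPath]; exact h.1, fun w hw => ?_⟩
  obtain ⟨s, hs, hsw⟩ := exists_of_coeff_mul_ofPath hw
  rcases (h.2 s hs).lt_or_eq with hlt | rfl
  · exact (hord.mul_right _ _ _ _ _ hlt hsw (QPath.comp?_mk _ _)).le
  · rw [QPath.comp?_mk] at hsw
    exact (Option.some.inj hsw).ge

/-- A path is normal if it is not a leading monomial of an element of the ideal. -/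
def IsNormal (I : TwoSidedIdeal (PathAlgebra K V)) (p : QPath V) : Prop := ∀ f ∈ I, ¬ IsLM f p

variable {I : TwoSidedIdeal (PathAlgebra K V)}

/-- If a subpath were the leading monomial of an element of `I`, multiplying that element by the two
outer paths would make the whole path one. -/
theorem IsNormal.of_comp (hord : IsGradedMonomialOrder V) {a b c d : V} {s : Quiver.Path a b}
    {p : Quiver.Path b c} {t : Quiver.Path c d} (h : IsNormal I ⟨a, d, (s.comp p).comp t⟩) :
    IsNormal I ⟨b, c, p⟩ := fun _ hf hp =>
  h _ (I.mul_mem_right _ _ (I.mul_mem_left _ _ hf)) ((hp.ofPath_mul hord s).mul_ofPath hord t)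

theorem eq_zero_of_normal {f : PathAlgebra K V} (hf : f ∈ I)
    (h : f ∈ spanPaths K V (IsNormal I)) : f = 0 := by
  by_contra hne
  obtain ⟨w, hw⟩ := exists_isLM hne
  exact h w hw.1 f hf hw

/-- The paths parallel to a given path that are smaller. -/
def ParallelLT (w q : QPath V) : Prop := q < w ∧ q.src = w.src ∧ q.tgt = w.tgt

theorem exists_reduction (hord : IsGradedMonomialOrder V) {w : QPath V} (hw : ¬ IsNormal I w) :
    ∃ f ∈ spanPaths K V (ParallelLT w), ofPath K w - f ∈ I := by
  obtain ⟨a, b, w⟩ := w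
  simp only [IsNormal, not_forall, not_not] at hw
  obtain ⟨f, hf, hlm⟩ := hw
  have hlm' := (hlm.ofPath_mul hord .nil).mul_ofPath hord .nil
  rw [Quiver.Path.nil_comp, Quiver.Path.comp_nil] at hlm'
  -- Multiplying by the two end vertices keeps the leading monomial and discards every path that is
  -- not parallel to it.
  set g := ofPath K ⟨a, a, .nil⟩ * f * ofPath K ⟨b, b, .nil⟩ with hg
  have hgI : g ∈ I := I.mul_mem_right _ _ (I.mul_mem_left _ _ hf)
  have hc := hlm'.1
  refine ⟨ofPath K ⟨a, b, w⟩ - (g.coeff ⟨a, b, w⟩)⁻¹ • g, fun q hq => ?_, ?_⟩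
  · have hqw : q ≠ ⟨a, b, w⟩ := by
      rintro rfl
      apply hq
      rw [coeff_sub, coeff_ofPath_self, coeff_smul, inv_mul_cancel₀ hc, sub_self]
    have hgq : g.coeff q ≠ 0 := by
      intro h0
      apply hq
      rw [coeff_sub, coeff_ofPath_of_ne hqw, coeff_smul, h0, mul_zero, sub_zero]
    refine ⟨lt_of_le_of_ne (hlm'.2 q hgq) hqw, ?_⟩
    obtain ⟨s, hs, hsq⟩ := exists_of_coeff_mul_ofPath hgq
    obtain ⟨t, -, hts⟩ := exists_of_coeff_ofPath_mul hs
    obtain ⟨a1, b1, c1, p1, q1, rfl, h2, rfl⟩ := QPath.comp?_eq_some_iff.1 hsq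
    obtain ⟨a2, b2, c2, p2, q2, h3, rfl, h4⟩ := QPath.comp?_eq_some_iff.1 hts
    cases h2
    cases h3
    cases h4
    exact ⟨rfl, rfl⟩
  · rw [sub_sub_cancel, Algebra.smul_def]
    exact I.mul_mem_left _ _ hgI

theorem IsGroebnerBasis.exists_factor {G : Set (PathAlgebra K V)} (hG : IsGroebnerBasis G I)
    {f : PathAlgebra K V} (hf : f ∈ I) {w : QPath V} (hw : IsLM f w) :
    ∃ (a b c d : V) (s : Quiver.Path a b) (m : Quiver.Path b c) (t : Quiver.Path c d),
      (∃ g ∈ G, IsLM g ⟨b, c, m⟩) ∧ w = ⟨a, d, (s.comp m).comp t⟩ := by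
  have h1 : ofPath K w ∈ idealLM G := by
    rw [← hG.2]
    exact TwoSidedIdeal.subset_span ⟨f, hf, w, hw, rfl⟩
  have h2 : {m | ∃ f ∈ G, ∃ w, IsLM f w ∧ m = ofPath K w} =
      {x | ∃ m : QPath V, (∃ f ∈ G, IsLM f m) ∧ x = ofPath K m} := by
    ext x
    constructor
    · rintro ⟨f, hf, w, hw, rfl⟩
      exact ⟨w, ⟨f, hf, hw⟩, rfl⟩
    · rintro ⟨w, ⟨f, hf, hw⟩, rfl⟩
      exact ⟨f, hf, w, hw, rfl⟩
  rw [idealLM, h2] at h1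
  exact exists_of_ofPath_mem_span h1

variable [∀ a b : V, Finite (a ⟶ b)]

theorem proj_mem_span_of_not_normal (hord : IsGradedMonomialOrder V) {w : QPath V}
    (hw : ¬ IsNormal I w) : I.proj K (ofPath K w) ∈
      Submodule.span K {x | ∃ q, IsNormal I q ∧ ParallelLT w q ∧ x = I.proj K (ofPath K q)} := by
  induction w using hord.wellFounded.induction with
  | _ w ih =>
  obtain ⟨f, hf, hfI⟩ := exists_reduction hord hw
  rw [proj_eq_proj.2 hfI]
  suffices h : spanPaths K V (ParallelLT w) ≤ (Submodule.span K {x | ∃ q, IsNormal I q ∧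
      ParallelLT w q ∧ x = I.proj K (ofPath K q)}).comap (I.proj K).toLinearMap from h hf
  refine spanPaths_le fun q hq => ?_
  by_cases hn : IsNormal I q
  · exact Submodule.subset_span ⟨q, hn, hq, rfl⟩
  · refine Submodule.span_mono ?_ (ih q hq.1 hn)
    rintro _ ⟨r, hr, hr', rfl⟩
    exact ⟨r, hr, ⟨hr'.1.trans hq.1, hr'.2.1.trans hq.2.1, hr'.2.2.trans hq.2.2⟩, rfl⟩

theorem proj_mem_span_normal (hord : IsGradedMonomialOrder V) (w : QPath V) :
    I.proj K (ofPath K w) ∈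
      Submodule.span K {x | ∃ q, IsNormal I q ∧ q ≤ w ∧ x = I.proj K (ofPath K q)} := by
  by_cases hw : IsNormal I w
  · exact Submodule.subset_span ⟨w, hw, le_rfl, rfl⟩
  · refine Submodule.span_mono ?_ (proj_mem_span_of_not_normal hord hw)
    rintro _ ⟨q, hq, hq', rfl⟩
    exact ⟨q, hq, hq'.1.le, rfl⟩

theorem inducedFiltration_le_span (hord : IsGradedMonomialOrder V) (p : ℕ) :
    (inducedFiltration I).F p ≤
      Submodule.span K {x | ∃ q, IsNormal I q ∧ q.length ≤ p ∧ x = I.proj K (ofPath K q)} := by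
  refine Submodule.map_le_iff_le_comap.2 (spanPaths_le fun w hw => ?_)
  refine Submodule.span_mono ?_ (proj_mem_span_normal hord w)
  rintro _ ⟨q, hq, hq', rfl⟩
  exact ⟨q, hq, (hord.length_le hq').trans hw, rfl⟩

/-- A nonzero combination of normal paths has a normal leading monomial and therefore cannot lie in
`I`. -/
theorem linearIndependent_normal :
    LinearIndependent K fun p : {p : QPath V // IsNormal I p} => I.proj K (ofPath K p.1) := by
  rw [linearIndependent_iff]
  intro l hl
  have h : Finsupp.linearCombination K
      (fun p : {p : QPath V // IsNormal I p} => ofPath K p.1) l = 0 := by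
    refine eq_zero_of_normal (I := I) ?_ ?_
    · rw [← TwoSidedIdeal.proj_eq_zero (K := K), ← hl, Finsupp.linearCombination_apply, Finsupp.linearCombination_apply,
        Finsupp.sum, Finsupp.sum, map_sum]
      simp only [map_smul]
    · rw [Finsupp.linearCombination_apply]
      exact sum_mem fun p _ => Submodule.smul_mem _ _ (ofPath_mem _ p.2)
  exact linearIndependent_iff.1 (linearIndependent_ofPath.comp _ Subtype.val_injective) l h

/-- The basis of a quotient algebra that consists of the classes of the normal paths. -/
def normalBasis (hord : IsGradedMonomialOrder V) (I : TwoSidedIdeal (PathAlgebra K V)) :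
    Module.Basis {p : QPath V // IsNormal I p} K I.QuotientAlg :=
  Module.Basis.mk linearIndependent_normal (by
    intro x _
    obtain ⟨n, hn⟩ := (inducedFiltration I).exhaustive x
    refine Submodule.span_mono ?_ (inducedFiltration_le_span hord n hn)
    rintro _ ⟨q, hq, -, rfl⟩
    exact ⟨⟨q, hq⟩, rfl⟩)

open Classical in
/-- The coefficient of a normal path in the normal form of an element of a quotient algebra. -/
def normalCoeff (hord : IsGradedMonomialOrder V) (I : TwoSidedIdeal (PathAlgebra K V))
    (p : QPath V) : I.QuotientAlg →ₗ[K] K :=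
  if h : IsNormal I p then (normalBasis hord I).coord ⟨p, h⟩ else 0

theorem normalCoeff_self (hord : IsGradedMonomialOrder V) {p : QPath V} (hp : IsNormal I p) :
    normalCoeff hord I p (I.proj K (ofPath K p)) = 1 := by
  have h : I.proj K (ofPath K p) = normalBasis hord I ⟨p, hp⟩ := by simp [normalBasis]
  rw [normalCoeff, dif_pos hp, h, Module.Basis.coord_apply, Module.Basis.repr_self,
    Finsupp.single_eq_same]

theorem normalCoeff_ne (hord : IsGradedMonomialOrder V) {p q : QPath V} (hq : IsNormal I q)
    (hpq : p ≠ q) : normalCoeff hord I p (I.proj K (ofPath K q)) = 0 := by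
  have h : I.proj K (ofPath K q) = normalBasis hord I ⟨q, hq⟩ := by simp [normalBasis]
  rw [normalCoeff]
  split_ifs with hp
  · rw [h, Module.Basis.coord_apply, Module.Basis.repr_self,
      Finsupp.single_eq_of_ne fun h => hpq (congrArg Subtype.val h)]
  · rfl

/-- Passing to normal form never increases length. Consequently these coefficients induce linear
forms on the graded pieces of `G(A)`. -/
theorem normalCoeff_of_length (hord : IsGradedMonomialOrder V) {p : QPath V} {n : ℕ}
    (hn : n < p.length) {x : I.QuotientAlg} (hx : x ∈ (inducedFiltration I).F n) :
    normalCoeff hord I p x = 0 := by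
  have h := Submodule.mem_of_mem_span (LinearMap.ker (normalCoeff hord I p))
    (inducedFiltration_le_span hord n hx) ?_
  · exact h
  · rintro _ ⟨q, hq, hqn, rfl⟩
    exact normalCoeff_ne hord hq (by rintro rfl; omega)

/-- This is the division algorithm: subtract a multiple of some `s g t` with the same leading
monomial and repeat. The degree bound persists because the degree of an element is the length of its
leading monomial. -/
theorem mem_span_of_mem_ideal (hord : IsGradedMonomialOrder V) {G : Set (PathAlgebra K V)}
    (hG : IsGroebnerBasis G I) {d : ℕ} {f : PathAlgebra K V} (hf : f ∈ I)
    (hfd : f ∈ filtered K V d) : f ∈ Submodule.span K {x | ∃ g ∈ G, ∃ s t : QPath V,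
      s.length + g.degree + t.length ≤ d ∧ x = ofPath K s * g * ofPath K t} := by
  by_cases hf0 : f = 0
  · rw [hf0]; exact zero_mem _
  obtain ⟨w, hw⟩ := exists_isLM hf0
  induction w using hord.wellFounded.induction generalizing f with
  | _ w ih =>
  obtain ⟨a, b, c, e, s, m, t, ⟨g, hgG, hg⟩, rfl⟩ :=
    hG.exists_factor hf hw
  have hlm := (hg.ofPath_mul hord s).mul_ofPath hord t
  set x := ofPath K ⟨a, b, s⟩ * g * ofPath K ⟨c, e, t⟩ with hx
  set w : QPath V := ⟨a, e, (s.comp m).comp t⟩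
  have hxS : x ∈ {x | ∃ g ∈ G, ∃ s t : QPath V,
      s.length + g.degree + t.length ≤ d ∧ x = ofPath K s * g * ofPath K t} := by
    refine ⟨g, hgG, _, _, ?_, rfl⟩
    -- The product `s g t` is counted with degree `|s| + deg g + |t|`, which is the length of the
    -- leading monomial of `f`.
    have h : ((s.comp m).comp t).length ≤ d := hfd w hw.1
    rw [Quiver.Path.length_comp, Quiver.Path.length_comp] at h
    rw [hg.degree_eq hord]
    exact h
  have hxI : x ∈ I := I.mul_mem_right _ _ (I.mul_mem_left _ _ (hG.1 hgG))
  set k := f.coeff w * (x.coeff w)⁻¹ with hk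
  have hdecomp : f = (f - k • x) + k • x := by rw [sub_add_cancel]
  have hkx : k • x ∈ I := by
    rw [Algebra.smul_def]
    exact I.mul_mem_left _ _ hxI
  rw [hdecomp]
  refine add_mem ?_ (Submodule.smul_mem _ k (Submodule.subset_span hxS))
  have hcoeff : ∀ q, (f - k • x).coeff q ≠ 0 → q < w := by
    intro q hq
    have hqw : q ≠ w := by
      rintro rfl
      apply hq
      rw [coeff_sub, coeff_smul, hk, mul_assoc, inv_mul_cancel₀ hlm.1, mul_one, sub_self]
    refine lt_of_le_of_ne ?_ hqw
    by_cases h : f.coeff q = 0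
    · refine hlm.2 q fun h' => hq ?_
      rw [coeff_sub, coeff_smul, h, h', mul_zero, sub_zero]
    · exact hw.2 q h
  by_cases hz : f - k • x = 0
  · rw [hz]; exact zero_mem _
  obtain ⟨q, hq⟩ := exists_isLM hz
  refine ih q (hcoeff q hq.1) (sub_mem hf hkx) (fun r hr => ?_) hz hq
  exact (hord.length_le (hcoeff r hr).le).trans (hfd w hw.1)

end

end PathAlgebra

theorem TwoSidedIdeal.mem_of_mem_span {K S : Type*} [CommRing K] [Ring S] [Algebra K S]
    (J : TwoSidedIdeal S) {s : Set S} {x : S} (hx : x ∈ Submodule.span K s)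
    (h : ∀ y ∈ s, y ∈ J) : x ∈ J := by
  have h1 := Submodule.mem_of_mem_span (LinearMap.ker (J.proj K).toLinearMap) hx fun y hy =>
    (TwoSidedIdeal.proj_eq_zero (K := K)).2 (h y hy)
  exact (TwoSidedIdeal.proj_eq_zero (K := K)).1 h1

theorem TwoSidedIdeal.exists_quotient_algEquiv {K S T : Type*} [CommRing K] [Ring S] [Algebra K S]
    [Semiring T] [Algebra K T] (J : TwoSidedIdeal S) (α : S →ₐ[K] T) (hα : Function.Surjective α)
    (h : ∀ x, α x = 0 ↔ x ∈ J) : ∃ e : J.QuotientAlg ≃ₐ[K] T, ∀ x, e (J.proj K x) = α x := by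
  let f : J.QuotientAlg →ₐ[K] T := Ideal.Quotient.liftₐ J.asIdeal α
    (fun a ha => (h a).2 (TwoSidedIdeal.mem_asIdeal.1 ha))
  have hf : ∀ x, f (J.proj K x) = α x := fun x => rfl
  refine ⟨AlgEquiv.ofBijective f ⟨?_, ?_⟩, hf⟩
  · refine (injective_iff_map_eq_zero f).2 fun y hy => ?_
    obtain ⟨x, rfl⟩ := Ideal.Quotient.mk_surjective y
    exact (TwoSidedIdeal.proj_eq_zero (K := K)).2 ((h x).1 hy)
  · intro t
    obtain ⟨x, rfl⟩ := hα t
    exact ⟨J.proj K x, rfl⟩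

/-! ### Homogeneous components -/

namespace PathAlgebra

variable {K : Type u} {V : Type v} [Field K] [Quiver.{w} V]

theorem coeff_component (p : ℕ) (f : PathAlgebra K V) (w : QPath V) :
    (component p f).coeff w = if w.length = p then f.coeff w else 0 := by
  classical
  exact (Finsupp.filter_apply _ _ _).trans (by congr)

variable (K V) in
/-- The projection onto the homogeneous part of degree `p`, as a linear map. -/
def componentLin (p : ℕ) : PathAlgebra K V →ₗ[K] PathAlgebra K V where
  toFun := component p
  map_add' f g := ext_coeff fun w => by
    rw [coeff_add, coeff_component, coeff_component, coeff_component]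
    split_ifs
    · rfl
    · rw [add_zero]
  map_smul' c f := ext_coeff fun w => by
    rw [RingHom.id_apply, coeff_smul, coeff_component, coeff_component]
    split_ifs
    · rfl
    · rw [mul_zero]

theorem component_mem (p : ℕ) (f : PathAlgebra K V) : component p f ∈ homogeneous K V p := by
  intro w hw
  rw [coeff_component] at hw
  by_contra h
  exact hw (if_neg h)

theorem component_of_mem {m : ℕ} {f : PathAlgebra K V} (hf : f ∈ homogeneous K V m) (p : ℕ) :
    component p f = if m = p then f else 0 := by
  refine ext_coeff fun w => ?_
  rw [coeff_component]
  by_cases h : f.coeff w = 0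
  · rw [h, ite_self]
    split_ifs
    · exact h.symm
    · rfl
  · rw [hf w h]
    split_ifs <;> rfl

theorem component_eq_zero {m p : ℕ} {f : PathAlgebra K V} (hf : f ∈ filtered K V m) (h : m < p) :
    component p f = 0 := by
  refine ext_coeff fun w => ?_
  rw [coeff_component]
  split_ifs with hw
  · by_contra h0
    have := hf w h0
    omega
  · rfl

theorem ofPath_mem_homogeneous (p : QPath V) : ofPath K p ∈ homogeneous K V p.length :=
  ofPath_mem _ rfl

theorem homogeneous_le_filtered (p : ℕ) : homogeneous K V p ≤ filtered K V p :=
  spanPaths_mono fun _ h => h.le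

theorem filtered_mono {p q : ℕ} (h : p ≤ q) : filtered K V p ≤ filtered K V q :=
  spanPaths_mono fun _ h' => h'.trans h

/-- Induction on the elements of the span of a set of paths. -/
theorem spanPaths_induction {C : QPath V → Prop}
    {P : ∀ f : PathAlgebra K V, f ∈ spanPaths K V C → Prop} (zero : P 0 (zero_mem _))
    (add : ∀ f g hf hg, P f hf → P g hg → P (f + g) (add_mem hf hg))
    (smul : ∀ (c : K) f hf, P f hf → P (c • f) (Submodule.smul_mem _ c hf))
    (path : ∀ p (hp : C p), P (ofPath K p) (ofPath_mem C hp))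
    {f : PathAlgebra K V} (hf : f ∈ spanPaths K V C) : P f hf := by
  have hs : spanPaths K V C = Submodule.span K {f | ∃ p, C p ∧ f = ofPath K p} := by
    refine le_antisymm (spanPaths_le fun p hp => Submodule.subset_span ⟨p, hp, rfl⟩) ?_
    refine Submodule.span_le.2 ?_
    rintro _ ⟨p, hp, rfl⟩
    exact ofPath_mem C hp
  have h2 : f ∈ Submodule.span K {f | ∃ p, C p ∧ f = ofPath K p} := hs ▸ hf
  suffices h : ∃ hf' : f ∈ spanPaths K V C, P f hf' from h.2
  induction h2 using Submodule.span_induction with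
  | mem x hx =>
    obtain ⟨p, hp, rfl⟩ := hx
    exact ⟨_, path p hp⟩
  | zero => exact ⟨_, zero⟩
  | add x y hx hy hx' hy' =>
    obtain ⟨h1, h1'⟩ := hx' (hs ▸ hx)
    obtain ⟨h2, h2'⟩ := hy' (hs ▸ hy)
    exact ⟨_, add _ _ _ _ h1' h2'⟩
  | smul c x hx hx' =>
    obtain ⟨h1, h1'⟩ := hx' (hs ▸ hx)
    exact ⟨_, smul c _ _ h1'⟩

theorem linearMap_eqOn_spanPaths {E : Type*} [AddCommGroup E] [Module K E] {C : QPath V → Prop}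
    (φ ψ : PathAlgebra K V →ₗ[K] E) (h : ∀ p, C p → φ (ofPath K p) = ψ (ofPath K p))
    {f : PathAlgebra K V} (hf : f ∈ spanPaths K V C) : φ f = ψ f :=
  (spanPaths_le (M := LinearMap.eqLocus φ ψ) h) hf

theorem linearMap_ext {E : Type*} [AddCommGroup E] [Module K E]
    {φ ψ : PathAlgebra K V →ₗ[K] E} (h : ∀ p, φ (ofPath K p) = ψ (ofPath K p)) : φ = ψ :=
  LinearMap.ext fun f => linearMap_eqOn_spanPaths φ ψ (fun p _ => h p) (mem_spanPaths_support f)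

variable [Fintype V]

theorem mul_mul_mem_homogeneous (s t : QPath V) {n : ℕ} {f : PathAlgebra K V}
    (hf : f ∈ homogeneous K V n) :
    ofPath K s * f * ofPath K t ∈ homogeneous K V (s.length + n + t.length) :=
  SetLike.GradedMul.mul_mem (SetLike.GradedMul.mul_mem (ofPath_mem_homogeneous s) hf)
    (ofPath_mem_homogeneous t)

theorem mul_mul_mem_filtered (s t : QPath V) {n : ℕ} {f : PathAlgebra K V}
    (hf : f ∈ filtered K V n) :
    ofPath K s * f * ofPath K t ∈ filtered K V (s.length + n + t.length) := by
  have h : ∀ {m n : ℕ} {f g : PathAlgebra K V}, f ∈ filtered K V m → g ∈ filtered K V n →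
      f * g ∈ filtered K V (m + n) := fun hf hg =>
    mul_mem_spanPaths (fun p q r hp hq hr => by
      rw [QPath.comp?_eq_some hr]
      exact add_le_add hp hq) hf hg
  exact h (h (homogeneous_le_filtered _ (ofPath_mem_homogeneous s)) hf)
    (homogeneous_le_filtered _ (ofPath_mem_homogeneous t))

theorem component_mul_mul (s t : QPath V) (n : ℕ) (f : PathAlgebra K V) :
    component (s.length + n + t.length) (ofPath K s * f * ofPath K t) =
      ofPath K s * component n f * ofPath K t := by
  have h : (componentLin K V (s.length + n + t.length)) ∘ₗ
      (LinearMap.mulRight K (ofPath K t) ∘ₗ LinearMap.mulLeft K (ofPath K s)) =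
      (LinearMap.mulRight K (ofPath K t) ∘ₗ LinearMap.mulLeft K (ofPath K s)) ∘ₗ
        componentLin K V n := by
    refine linearMap_ext fun q => ?_
    change component _ (ofPath K s * ofPath K q * ofPath K t) =
      ofPath K s * component n (ofPath K q) * ofPath K t
    rw [component_of_mem (ofPath_mem_homogeneous q),
      component_of_mem (mul_mul_mem_homogeneous s t (ofPath_mem_homogeneous q))]
    by_cases hq : q.length = n
    · rw [if_pos hq, if_pos (by rw [hq])]
    · rw [if_neg hq, if_neg (by omega), mul_zero, zero_mul]
  exact LinearMap.congr_fun h f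

/-! ### Homogenization in a given degree -/

variable (K V) in
/-- The homogenization `t^d f_0 + ... + f_d` of an element `f` of `F_d R`. -/
def homogenizeIn (d : ℕ) : PathAlgebra K V →ₗ[K] (PathAlgebra K V)[X] :=
  Finsupp.linearCombination K fun q : QPath V => Polynomial.monomial (d - q.length) (ofPath K q)

theorem homogenizeIn_ofPath (d : ℕ) (q : QPath V) :
    homogenizeIn K V d (ofPath K q) = Polynomial.monomial (d - q.length) (ofPath K q) := by
  refine (Finsupp.linearCombination_single K (1 : K) q).trans ?_
  exact one_smul _ _

theorem homogenizeIn_of_mem {d m : ℕ} {f : PathAlgebra K V} (hf : f ∈ homogeneous K V m) :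
    homogenizeIn K V d f = Polynomial.monomial (d - m) f := by
  refine linearMap_eqOn_spanPaths (homogenizeIn K V d)
    ((Polynomial.monomial (d - m)).restrictScalars K) (fun q hq => ?_) hf
  rw [homogenizeIn_ofPath, hq]
  rfl

theorem homogenizeIn_eq_sum {d : ℕ} {f : PathAlgebra K V} (hf : f ∈ filtered K V d) :
    homogenizeIn K V d f =
      ∑ i ∈ Finset.range (d + 1), Polynomial.monomial (d - i) (component i f) := by
  have h := linearMap_eqOn_spanPaths (homogenizeIn K V d)
    (∑ i ∈ Finset.range (d + 1), (Polynomial.monomial (d - i)).restrictScalars K ∘ₗ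
      componentLin K V i) (fun q hq => ?_) hf
  · rw [h, LinearMap.sum_apply]
    rfl
  · rw [homogenizeIn_ofPath, LinearMap.sum_apply, Finset.sum_eq_single q.length]
    · change _ = Polynomial.monomial (d - q.length) (component q.length (ofPath K q))
      rw [component_of_mem (ofPath_mem_homogeneous q), if_pos rfl]
    · intro i _ hi
      change Polynomial.monomial (d - i) (component i (ofPath K q)) = 0
      rw [component_of_mem (ofPath_mem_homogeneous q), if_neg (Ne.symm hi), map_zero]
    · intro h
      exact absurd (Finset.mem_range.2 (Nat.lt_succ_of_le hq)) h

theorem homogenize_eq (f : PathAlgebra K V) : homogenize f = homogenizeIn K V f.degree f :=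
  (homogenizeIn_eq_sum (le_degree f)).symm

/-- The excess `k` of the chosen degree over the natural degree of the product becomes the factor
`t^k`. -/
theorem homogenizeIn_mul_mul (s t : QPath V) (k : ℕ) {n : ℕ} {f : PathAlgebra K V}
    (hf : f ∈ filtered K V n) :
    homogenizeIn K V (k + (s.length + n + t.length)) (ofPath K s * f * ofPath K t) =
      Polynomial.monomial k (ofPath K s) * homogenizeIn K V n f * Polynomial.C (ofPath K t) := by
  refine linearMap_eqOn_spanPaths
    (homogenizeIn K V (k + (s.length + n + t.length)) ∘ₗ
      (LinearMap.mulRight K (ofPath K t) ∘ₗ LinearMap.mulLeft K (ofPath K s)))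
    ((LinearMap.mulRight K (Polynomial.C (ofPath K t)) ∘ₗ
      LinearMap.mulLeft K (Polynomial.monomial k (ofPath K s))) ∘ₗ homogenizeIn K V n)
    (fun q hq => ?_) hf
  change homogenizeIn K V _ (ofPath K s * ofPath K q * ofPath K t) = Polynomial.monomial k
    (ofPath K s) * homogenizeIn K V n (ofPath K q) * Polynomial.C (ofPath K t)
  rw [homogenizeIn_of_mem (mul_mul_mem_homogeneous s t (ofPath_mem_homogeneous q)),
    homogenizeIn_ofPath, Polynomial.monomial_mul_monomial, ← Polynomial.monomial_zero_left,
    Polynomial.monomial_mul_monomial]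
  have hq' : q.length ≤ n := hq
  have e : k + (s.length + n + t.length) - (s.length + q.length + t.length) =
      k + (n - q.length) + 0 := by omega
  rw [e]

theorem coeff_coeff_homogenizeIn {d : ℕ} {f : PathAlgebra K V} (hf : f ∈ filtered K V d) (r : ℕ)
    (w : QPath V) :
    ((homogenizeIn K V d f).coeff r).coeff w = if w.length + r = d then f.coeff w else 0 := by
  refine spanPaths_induction (P := fun f _ => ((homogenizeIn K V d f).coeff r).coeff w =
    if w.length + r = d then f.coeff w else 0) ?_ ?_ ?_ ?_ hf
  · rw [map_zero, Polynomial.coeff_zero, coeff_zero, ite_self]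
  · intro f g _ _ hf hg
    rw [map_add, Polynomial.coeff_add, coeff_add, hf, hg, coeff_add]
    split_ifs
    · rfl
    · rw [add_zero]
  · intro c f _ hf
    rw [map_smul, Polynomial.coeff_smul, coeff_smul, hf, coeff_smul]
    split_ifs
    · rfl
    · rw [mul_zero]
  · intro q hq
    rw [homogenizeIn_ofPath, Polynomial.coeff_monomial]
    by_cases hw : w = q
    · subst hw
      have : (d - w.length = r) ↔ w.length + r = d := by
        have hq' : w.length ≤ d := hq
        omega
      simp only [this]
      split_ifs <;> rfl
    · rw [coeff_ofPath_of_ne hw, ite_self]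
      split_ifs
      · exact coeff_ofPath_of_ne hw
      · rfl

section Groebner

variable [LinearOrder (QPath V)] [∀ a b : V, Finite (a ⟶ b)]
  {I : TwoSidedIdeal (PathAlgebra K V)} {G : Set (PathAlgebra K V)}

theorem span_eq_of_isGroebnerBasis (hord : IsGradedMonomialOrder V) (hG : IsGroebnerBasis G I) :
    TwoSidedIdeal.span G = I := by
  refine le_antisymm (TwoSidedIdeal.span_le.2 hG.1) fun f hf => ?_
  refine TwoSidedIdeal.mem_of_mem_span _ (mem_span_of_mem_ideal hord hG hf (le_degree f)) ?_
  rintro _ ⟨g, hg, s, t, -, rfl⟩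
  exact TwoSidedIdeal.mul_mem_right _ _ _ (TwoSidedIdeal.mul_mem_left _ _ _
    (TwoSidedIdeal.subset_span hg))

/-- In a division of `f` within degree `d`, a product `s g t` of smaller degree contributes nothing
in degree `d`, and one of degree exactly `d` contributes `s LH(g) t`. -/
theorem component_mem_idealLH (hord : IsGradedMonomialOrder V) (hG : IsGroebnerBasis G I) {d : ℕ}
    {f : PathAlgebra K V} (hf : f ∈ I) (hfd : f ∈ filtered K V d) :
    component d f ∈ idealLH G := by
  have h := Submodule.mem_map_of_mem (f := componentLin K V d)
    (mem_span_of_mem_ideal hord hG hf hfd)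
  rw [Submodule.map_span] at h
  refine TwoSidedIdeal.mem_of_mem_span _ h ?_
  rintro _ ⟨_, ⟨g, hg, s, t, hd, rfl⟩, rfl⟩
  change component d _ ∈ _
  rcases hd.lt_or_eq with hlt | rfl
  · rw [component_eq_zero (mul_mul_mem_filtered s t (le_degree g)) hlt]
    exact zero_mem _
  · rw [component_mul_mul]
    exact TwoSidedIdeal.mul_mem_right _ _ _ (TwoSidedIdeal.mul_mem_left _ _ _
      (TwoSidedIdeal.subset_span ⟨g, hg, rfl⟩))

theorem homogenizeIn_mem_idealHomogenize (hord : IsGradedMonomialOrder V)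
    (hG : IsGroebnerBasis G I) {d : ℕ} {f : PathAlgebra K V} (hf : f ∈ I)
    (hfd : f ∈ filtered K V d) : homogenizeIn K V d f ∈ idealHomogenize G := by
  have h := Submodule.mem_map_of_mem (f := homogenizeIn K V d)
    (mem_span_of_mem_ideal hord hG hf hfd)
  rw [Submodule.map_span] at h
  refine TwoSidedIdeal.mem_of_mem_span _ h ?_
  rintro _ ⟨_, ⟨g, hg, s, t, hd, rfl⟩, rfl⟩
  obtain ⟨k, rfl⟩ := Nat.exists_eq_add_of_le' hd
  rw [homogenizeIn_mul_mul s t k (le_degree g), ← homogenize_eq]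
  exact TwoSidedIdeal.mul_mem_right _ _ _ (TwoSidedIdeal.mul_mem_left _ _ _
      (TwoSidedIdeal.subset_span ⟨g, hg, rfl⟩))

theorem idealLH_eq (hord : IsGradedMonomialOrder V) (hG : IsGroebnerBasis G I) :
    idealLH G = idealLH (I : Set (PathAlgebra K V)) := by
  refine le_antisymm (TwoSidedIdeal.span_mono (Set.image_mono hG.1)) (TwoSidedIdeal.span_le.2 ?_)
  rintro _ ⟨f, hf, rfl⟩
  exact component_mem_idealLH hord hG hf (le_degree f)

end Groebner

end PathAlgebra

/-! ### Homogeneous elements of the Rees and associated graded algebras -/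

namespace AlgFiltration

variable {K A : Type*} [CommRing K] [Ring A] [Algebra K A] (Φ : AlgFiltration K A)

/-- `toRees` as a linear map. -/
def reesLin (p : ℕ) : Φ.F p →ₗ[K] Φ.Rees := DirectSum.lof K ℕ (fun p => Φ.F p) p

/-- `toGr` as a linear map. -/
def grLin (p : ℕ) : Φ.F p →ₗ[K] Φ.Gr :=
  DirectSum.lof K ℕ Φ.GrPart p ∘ₗ ((Φ.pred p).submoduleOf (Φ.F p)).mkQ

theorem toRees_congr {p q : ℕ} {a b : A} (h : p = q) (hab : a = b) (ha : a ∈ Φ.F p)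
    (hb : b ∈ Φ.F q) : Φ.toRees p a ha = Φ.toRees q b hb := by
  subst h hab
  rfl

theorem toRees_mul {p q : ℕ} {a b : A} (ha : a ∈ Φ.F p) (hb : b ∈ Φ.F q) :
    Φ.toRees p a ha * Φ.toRees q b hb = Φ.toRees (p + q) (a * b) (Φ.mul_mem ha hb) :=
  DirectSum.of_mul_of (A := fun p => Φ.F p) _ _

theorem toRees_one : Φ.toRees 0 1 Φ.one_mem = 1 := rfl

theorem toRees_zero (p : ℕ) : Φ.toRees p 0 (zero_mem _) = 0 := map_zero (Φ.reesLin p)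

theorem toGr_congr {p q : ℕ} {a b : A} (h : p = q) (hab : a = b) (ha : a ∈ Φ.F p)
    (hb : b ∈ Φ.F q) : Φ.toGr p a ha = Φ.toGr q b hb := by
  subst h hab
  rfl

theorem toGr_mul {p q : ℕ} {a b : A} (ha : a ∈ Φ.F p) (hb : b ∈ Φ.F q) :
    Φ.toGr p a ha * Φ.toGr q b hb = Φ.toGr (p + q) (a * b) (Φ.mul_mem ha hb) :=
  DirectSum.of_mul_of (A := Φ.GrPart) _ _

theorem cls_eq_zero {p : ℕ} {a : A} (ha : a ∈ Φ.F p) : Φ.cls p a ha = 0 ↔ a ∈ Φ.pred p := by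
  rw [cls_zero, cls_eq_cls, sub_zero]

theorem toGr_eq_toGr {p : ℕ} {a b : A} (ha : a ∈ Φ.F p) (hb : b ∈ Φ.F p)
    (h : a - b ∈ Φ.pred p) : Φ.toGr p a ha = Φ.toGr p b hb :=
  congrArg (DirectSum.of Φ.GrPart p) ((Φ.cls_eq_cls ha hb).2 h)

theorem toGr_eq_zero {p : ℕ} {a : A} (ha : a ∈ Φ.F p) (h : a ∈ Φ.pred p) :
    Φ.toGr p a ha = 0 :=
  (congrArg (DirectSum.of Φ.GrPart p) ((Φ.cls_eq_zero ha).2 h)).trans (map_zero _)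

theorem toRees_apply_self {p : ℕ} {a : A} (ha : a ∈ Φ.F p) : (Φ.toRees p a ha p : A) = a :=
  congrArg Subtype.val (DirectSum.of_eq_same (β := fun p => Φ.F p) p ⟨a, ha⟩)

theorem toRees_apply_of_ne {p q : ℕ} {a : A} (ha : a ∈ Φ.F p) (h : q ≠ p) :
    Φ.toRees p a ha q = 0 :=
  DirectSum.of_eq_of_ne (β := fun p => Φ.F p) p q ⟨a, ha⟩ h

theorem toGr_apply_self {p : ℕ} {a : A} (ha : a ∈ Φ.F p) : Φ.toGr p a ha p = Φ.cls p a ha :=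
  DirectSum.of_eq_same _ _

theorem toGr_apply_of_ne {p q : ℕ} {a : A} (ha : a ∈ Φ.F p) (h : q ≠ p) :
    Φ.toGr p a ha q = 0 :=
  DirectSum.of_eq_of_ne _ _ _ h

end AlgFiltration

/-! ### The natural map to the associated graded algebra -/

namespace PathAlgebra

variable {K : Type u} {V : Type v} [Field K] [Quiver.{w} V]

theorem sum_component {d : ℕ} {f : PathAlgebra K V} (hf : f ∈ filtered K V d) :
    f = ∑ i ∈ Finset.range (d + 1), component i f := by
  have h := linearMap_eqOn_spanPaths LinearMap.id
    (∑ i ∈ Finset.range (d + 1), componentLin K V i) (fun q hq => ?_) hf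
  · rw [LinearMap.sum_apply] at h
    exact h
  · rw [LinearMap.sum_apply, Finset.sum_eq_single q.length]
    · exact ((component_of_mem (ofPath_mem_homogeneous q) _).trans (if_pos rfl)).symm
    · intro i _ hi
      exact (component_of_mem (ofPath_mem_homogeneous q) _).trans (if_neg (Ne.symm hi))
    · intro h
      exact absurd (Finset.mem_range.2 (Nat.lt_succ_of_le hq)) h

section Lift

variable {T : Type*} [Semiring T] [Algebra K T]

/-- The linear map on the path algebra that is given on its homogeneous parts. -/
def liftLin (τ : ∀ p, homogeneous K V p →ₗ[K] T) : PathAlgebra K V →ₗ[K] T :=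
  Finsupp.linearCombination K fun q : QPath V => τ q.length ⟨ofPath K q, ofPath_mem_homogeneous q⟩

theorem liftLin_of_mem (τ : ∀ p, homogeneous K V p →ₗ[K] T) {p : ℕ} {f : PathAlgebra K V}
    (hf : f ∈ homogeneous K V p) : liftLin τ f = τ p ⟨f, hf⟩ := by
  refine spanPaths_induction (P := fun f hf => liftLin τ f = τ p ⟨f, hf⟩) ?_ ?_ ?_ ?_ hf
  · exact (map_zero _).trans (map_zero (τ p)).symm
  · intro f g hf hg h h'
    rw [map_add, h, h', ← map_add]
    rfl
  · intro c f hf h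
    rw [map_smul, h, ← map_smul]
    rfl
  · rintro q rfl
    refine (Finsupp.linearCombination_single K (1 : K) q).trans ?_
    exact one_smul _ _

variable [Fintype V]

/-- The algebra morphism on the path algebra that is given on its homogeneous parts. -/
def liftAlg (τ : ∀ p, homogeneous K V p →ₗ[K] T)
    (h1 : τ 0 ⟨1, SetLike.GradedOne.one_mem⟩ = 1)
    (h2 : ∀ p q (x : homogeneous K V p) (y : homogeneous K V q),
      τ (p + q) ⟨x * y, SetLike.GradedMul.mul_mem x.2 y.2⟩ = τ p x * τ q y) :
    PathAlgebra K V →ₐ[K] T :=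
  AlgHom.ofLinearMap (liftLin τ)
    ((liftLin_of_mem τ SetLike.GradedOne.one_mem).trans h1) (by
      intro f g
      induction f using induction_lin with
      | h0 => rw [zero_mul, map_zero, zero_mul]
      | hadd f f' hf hf' => rw [add_mul, map_add, map_add, add_mul, hf, hf']
      | hsmul c f hf => rw [smul_mul_assoc, map_smul, map_smul, smul_mul_assoc, hf]
      | hpath p =>
        induction g using induction_lin with
        | h0 => rw [mul_zero, map_zero, mul_zero]
        | hadd f f' hf hf' => rw [mul_add, map_add, map_add, mul_add, hf, hf']
        | hsmul c f hf => rw [mul_smul_comm, map_smul, map_smul, mul_smul_comm, hf]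
        | hpath q =>
          have hp := ofPath_mem_homogeneous (K := K) p
          have hq := ofPath_mem_homogeneous (K := K) q
          rw [liftLin_of_mem τ hp, liftLin_of_mem τ hq,
            liftLin_of_mem τ (SetLike.GradedMul.mul_mem hp hq)]
          exact h2 _ _ ⟨_, hp⟩ ⟨_, hq⟩)

theorem liftAlg_of_mem {τ : ∀ p, homogeneous K V p →ₗ[K] T} (h1) (h2) {p : ℕ}
    {f : PathAlgebra K V} (hf : f ∈ homogeneous K V p) : liftAlg τ h1 h2 f = τ p ⟨f, hf⟩ :=
  liftLin_of_mem τ hf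

end Lift

theorem isLM_LH_iff [LinearOrder (QPath V)] (hord : IsGradedMonomialOrder V) {f : PathAlgebra K V} {w : QPath V} :
    IsLM (LH f) w ↔ IsLM f w := by
  have key : ∀ {f : PathAlgebra K V} {w : QPath V}, IsLM f w → IsLM (LH f) w := by
    intro f w hw
    refine ⟨?_, fun q hq => ?_⟩
    · rw [LH, hw.degree_eq hord, coeff_component, if_pos rfl]
      exact hw.1
    · rw [LH, coeff_component] at hq
      exact hw.2 q fun h => hq (by rw [h, ite_self])
  refine ⟨fun hw => ?_, key⟩
  have hf : f ≠ 0 := by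
    rintro rfl
    refine hw.1 ?_
    rw [LH, coeff_component]
    split_ifs <;> rfl
  obtain ⟨q, hq⟩ := exists_isLM hf
  rwa [hw.unique (key hq)]

variable [Fintype V] (I : TwoSidedIdeal (PathAlgebra K V))

theorem proj_filtered_mem {p : ℕ} {f : PathAlgebra K V} (hf : f ∈ filtered K V p) :
    I.proj K f ∈ (inducedFiltration I).F p := ⟨f, hf, rfl⟩

/-- The projection from `F_p R` to `F_p A`. -/
def projFiltered (p : ℕ) : filtered K V p →ₗ[K] (inducedFiltration I).F p :=
  ((I.proj K).toLinearMap ∘ₗ (filtered K V p).subtype).codRestrict _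
    fun f => proj_filtered_mem I f.2

/-- The projection from `R_p` to `F_p A`. -/
def projHomogeneous (p : ℕ) : homogeneous K V p →ₗ[K] (inducedFiltration I).F p :=
  projFiltered I p ∘ₗ Submodule.inclusion (homogeneous_le_filtered p)

/-- The map from `R_p` to `G(A)`. -/
def grPiece (p : ℕ) : homogeneous K V p →ₗ[K] (inducedFiltration I).Gr :=
  (inducedFiltration I).grLin p ∘ₗ projHomogeneous I p

theorem grPiece_one : grPiece I 0 ⟨1, SetLike.GradedOne.one_mem⟩ = 1 :=
  (inducedFiltration I).toGr_congr rfl (map_one (I.proj K)) _ _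

theorem grPiece_mul (p q : ℕ) (x : homogeneous K V p) (y : homogeneous K V q) :
    grPiece I (p + q) ⟨x * y, SetLike.GradedMul.mul_mem x.2 y.2⟩ =
      grPiece I p x * grPiece I q y :=
  ((inducedFiltration I).toGr_congr rfl (map_mul (I.proj K) _ _) _ _).trans
    ((inducedFiltration I).toGr_mul _ _).symm

/-- The natural morphism from `R` to `G(A)`. -/
def grHom : PathAlgebra K V →ₐ[K] (inducedFiltration I).Gr :=
  liftAlg (grPiece I) (grPiece_one I) (grPiece_mul I)

/-- The map from `R_p` to the Rees algebra of `A`. -/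
def reesPiece (p : ℕ) : homogeneous K V p →ₗ[K] (inducedFiltration I).Rees :=
  (inducedFiltration I).reesLin p ∘ₗ projHomogeneous I p

theorem reesPiece_one : reesPiece I 0 ⟨1, SetLike.GradedOne.one_mem⟩ = 1 :=
  (inducedFiltration I).toRees_congr rfl (map_one (I.proj K)) _ _

theorem reesPiece_mul (p q : ℕ) (x : homogeneous K V p) (y : homogeneous K V q) :
    reesPiece I (p + q) ⟨x * y, SetLike.GradedMul.mul_mem x.2 y.2⟩ =
      reesPiece I p x * reesPiece I q y :=
  ((inducedFiltration I).toRees_congr rfl (map_mul (I.proj K) _ _) _ _).trans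
    ((inducedFiltration I).toRees_mul _ _).symm

/-- The natural morphism from `R` to the Rees algebra of `A`. -/
def reesHom : PathAlgebra K V →ₐ[K] (inducedFiltration I).Rees :=
  liftAlg (reesPiece I) (reesPiece_one I) (reesPiece_mul I)

theorem grHom_of_mem {p : ℕ} {f : PathAlgebra K V} (hf : f ∈ homogeneous K V p) :
    grHom I f = (inducedFiltration I).toGr p (I.proj K f) (proj_mem I hf) := by
  rw [grHom, liftAlg_of_mem (grPiece_one I) (grPiece_mul I) hf]
  rfl

theorem reesHom_of_mem {p : ℕ} {f : PathAlgebra K V} (hf : f ∈ homogeneous K V p) :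
    reesHom I f = (inducedFiltration I).toRees p (I.proj K f) (proj_mem I hf) := by
  rw [reesHom, liftAlg_of_mem (reesPiece_one I) (reesPiece_mul I) hf]
  rfl

theorem grHom_apply (f : PathAlgebra K V) (p : ℕ) :
    grHom I f p =
      (inducedFiltration I).cls p (I.proj K (component p f)) (proj_mem I (component_mem p f)) := by
  have hf := sum_component (filtered_mono (le_max_left f.degree p) (le_degree f))
  have h : grHom I f = ∑ i ∈ Finset.range (max f.degree p + 1), (inducedFiltration I).toGr i
      (I.proj K (component i f)) (proj_mem I (component_mem i f)) := by
    conv_lhs => rw [hf, map_sum]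
    exact Finset.sum_congr rfl fun i _ => grHom_of_mem I (component_mem i f)
  rw [h, DirectSum.sum_apply, Finset.sum_eq_single p]
  · exact DirectSum.of_eq_same _ _
  · intro i _ hi
    exact DirectSum.of_eq_of_ne _ _ _ hi.symm
  · intro hp
    exact absurd (Finset.mem_range.2 (Nat.lt_succ_of_le (le_max_right _ _))) hp

variable {I}

/-- Bounding lengths strictly by `p` treats `F_{p-1}` uniformly, including its value `0` for `p =
0`. -/
theorem proj_mem_pred_iff {p : ℕ} {f : PathAlgebra K V} :
    I.proj K f ∈ (inducedFiltration I).pred p ↔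
      ∃ g ∈ spanPaths K V fun w => w.length < p, f - g ∈ I := by
  cases p with
  | zero =>
    change I.proj K f = 0 ↔ _
    rw [TwoSidedIdeal.proj_eq_zero]
    constructor
    · intro h
      exact ⟨0, zero_mem _, by rwa [sub_zero]⟩
    · rintro ⟨g, hg, h⟩
      have : g = 0 := ext_coeff fun w => by
        by_contra h0
        exact absurd (hg w h0) (Nat.not_lt_zero _)
      rwa [this, sub_zero] at h
  | succ p =>
    constructor
    · rintro ⟨g, hg, h⟩
      exact ⟨g, fun w hw => Nat.lt_succ_of_le (hg w hw), proj_eq_proj.1 h.symm⟩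
    · rintro ⟨g, hg, h⟩
      exact ⟨g, fun w hw => Nat.le_of_lt_succ (hg w hw), (proj_eq_proj.2 h).symm⟩

theorem sub_component_mem_spanPaths {p : ℕ} {f : PathAlgebra K V} (hf : f ∈ filtered K V p) :
    f - component p f ∈ spanPaths K V fun w => w.length < p := by
  intro w hw
  refine lt_of_le_of_ne ?_ fun h => hw ?_
  · refine (sub_mem hf (homogeneous_le_filtered p (component_mem p f))) w hw
  · rw [coeff_sub, coeff_component, if_pos h, sub_self]

theorem grHom_surjective : Function.Surjective (grHom I) := by
  intro y
  induction y using DirectSum.induction_on with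
  | zero => exact ⟨0, map_zero _⟩
  | of p x =>
    obtain ⟨_, ⟨f, hf, rfl⟩, rfl⟩ := (inducedFiltration I).cls_surj x
    refine ⟨component p f, (grHom_of_mem I (component_mem p f)).trans ?_⟩
    refine (inducedFiltration I).toGr_eq_toGr _ _ ?_
    change I.proj K (component p f) - I.proj K f ∈ _
    rw [← map_sub, ← neg_sub f, map_neg]
    refine neg_mem (proj_mem_pred_iff.2 ⟨_, sub_component_mem_spanPaths hf, ?_⟩)
    rw [sub_self]
    exact zero_mem _
  | add x y hx hy =>
    obtain ⟨f, rfl⟩ := hx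
    obtain ⟨g, rfl⟩ := hy
    exact ⟨f + g, map_add _ _ _⟩

theorem grHom_eq_zero_of_mem {S : Set (PathAlgebra K V)} (hS : S ⊆ I) {f : PathAlgebra K V}
    (hf : f ∈ idealLH S) : grHom I f = 0 := by
  have h : idealLH S ≤ TwoSidedIdeal.ker (grHom I) := by
    refine TwoSidedIdeal.span_le.2 ?_
    rintro _ ⟨g, hg, rfl⟩
    refine (TwoSidedIdeal.mem_ker (grHom I)).2 ?_
    rw [LH, grHom_of_mem I (component_mem _ _)]
    refine (inducedFiltration I).toGr_eq_zero _ (proj_mem_pred_iff.2 ⟨-(g - LH g),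
      neg_mem (sub_component_mem_spanPaths (le_degree g)), ?_⟩)
    rw [sub_neg_eq_add, LH, add_sub_cancel]
    exact hS hg
  exact (TwoSidedIdeal.mem_ker (grHom I)).1 (h hf)

theorem exists_of_grHom_eq_zero {f : PathAlgebra K V} (hf : grHom I f = 0) (p : ℕ) :
    ∃ g ∈ spanPaths K V fun w => w.length < p, component p f - g ∈ I := by
  have h := grHom_apply I f p
  rw [hf] at h
  exact proj_mem_pred_iff.1 (((inducedFiltration I).cls_eq_zero _).1 h.symm)

section Groebner

variable [LinearOrder (QPath V)] [∀ a b : V, Finite (a ⟶ b)] {G : Set (PathAlgebra K V)}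

/-- If `f` maps to zero, each of its components becomes an element of `I` after subtracting terms of
lower degree. The component is the top part of that element, so it lies in `⟨LH(G)⟩` by division. -/
theorem grHom_eq_zero_iff (hord : IsGradedMonomialOrder V) (hG : IsGroebnerBasis G I)
    (f : PathAlgebra K V) : grHom I f = 0 ↔ f ∈ idealLH G := by
  refine ⟨fun hf => ?_, grHom_eq_zero_of_mem hG.1⟩
  rw [sum_component (le_degree f)]
  refine sum_mem fun p _ => ?_
  obtain ⟨g, hg, h⟩ := exists_of_grHom_eq_zero hf p
  have hgp : component p g = 0 := ext_coeff fun w => by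
    rw [coeff_component]
    split_ifs with hw
    · by_contra h0
      exact absurd (hg w h0) (by omega)
    · rfl
  have hc : component p (component p f - g) = component p f := by
    refine (map_sub (componentLin K V p) _ _).trans ?_
    change component p (component p f) - component p g = _
    rw [hgp, sub_zero, component_of_mem (component_mem p f), if_pos rfl]
  rw [← hc]
  refine component_mem_idealLH hord hG h (sub_mem ?_ (spanPaths_mono (fun _ h => le_of_lt h) hg))
  exact homogeneous_le_filtered p (component_mem p f)

theorem naturalMapIsIso_of_idealLH_eq (hord : IsGradedMonomialOrder V)
    (hG : IsGroebnerBasis G I) {S : Set (PathAlgebra K V)} (hS : idealLH S = idealLH G) :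
    NaturalMapIsIso I S := by
  obtain ⟨e, he⟩ := TwoSidedIdeal.exists_quotient_algEquiv (idealLH S) (grHom I) grHom_surjective
    fun f => by rw [grHom_eq_zero_iff hord hG, hS]
  exact ⟨e, fun p f hf => (he f).trans (grHom_of_mem I hf)⟩

/-- Let `w` be the leading monomial of an element of `⟨LH(I)⟩`. Its component of degree `|w|` is
corrected by shorter paths to an element of `I`, and in a graded ordering this correction leaves the
leading monomial unchanged. -/
theorem isGroebnerBasis_LH (hord : IsGradedMonomialOrder V) (hG : IsGroebnerBasis G I) :
    IsGroebnerBasis (LH '' G) (idealLH (I : Set (PathAlgebra K V))) := by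
  have h1 : LH '' G ⊆ idealLH (I : Set (PathAlgebra K V)) := by
    rintro _ ⟨g, hg, rfl⟩
    exact TwoSidedIdeal.subset_span ⟨g, hG.1 hg, rfl⟩
  refine ⟨h1, le_antisymm (TwoSidedIdeal.span_le.2 ?_) (TwoSidedIdeal.span_mono ?_)⟩
  · rintro _ ⟨f, hf, w, hw, rfl⟩
    obtain ⟨g, hg, h⟩ := exists_of_grHom_eq_zero (grHom_eq_zero_of_mem subset_rfl hf) w.length
    have hlm : IsLM (component w.length f - g) w := by
      have hgw : g.coeff w = 0 := by
        by_contra h0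
        exact absurd (hg w h0) (lt_irrefl _)
      refine ⟨?_, fun q hq => ?_⟩
      · rw [coeff_sub, coeff_component, if_pos rfl, hgw, sub_zero]
        exact hw.1
      · rw [coeff_sub, coeff_component] at hq
        by_cases h0 : g.coeff q = 0
        · rw [h0, sub_zero] at hq
          exact hw.2 q fun h' => hq (by rw [h', ite_self])
        · exact (hord.of_length_lt _ _ (hg q h0)).le
    have hw' : ofPath K w ∈ idealLM G := by
      rw [← hG.2]
      exact TwoSidedIdeal.subset_span ⟨_, h, w, hlm, rfl⟩
    refine (TwoSidedIdeal.span_mono ?_ : idealLM G ≤ _) hw'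
    rintro _ ⟨g, hg, w, hw, rfl⟩
    exact ⟨_, ⟨g, hg, rfl⟩, w, (isLM_LH_iff hord).2 hw, rfl⟩
  · rintro _ ⟨g, hg, w, hw, rfl⟩
    exact ⟨g, h1 hg, w, hw, rfl⟩

end Groebner

end PathAlgebra

/-! ### The Rees algebra as a quotient of `R[t]` -/

namespace PathAlgebra

variable {K : Type u} {V : Type v} [Field K] [Quiver.{w} V] [Fintype V]

theorem poly_induction {P : (PathAlgebra K V)[X] → Prop} (F : (PathAlgebra K V)[X]) (h0 : P 0)
    (hadd : ∀ F F', P F → P F' → P (F + F')) (hsmul : ∀ (c : K) F, P F → P (c • F))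
    (hpath : ∀ r q, P (Polynomial.monomial r (ofPath K q))) : P F := by
  induction F using Polynomial.induction_on' with
  | add F F' h h' => exact hadd F F' h h'
  | monomial r f =>
    induction f using induction_lin with
    | h0 => rwa [map_zero]
    | hadd f g hf hg => rw [map_add]; exact hadd _ _ hf hg
    | hsmul c f hf => rw [← Polynomial.smul_monomial]; exact hsmul _ _ hf
    | hpath q => exact hpath r q

theorem polyLinearMap_ext {E : Type*} [AddCommGroup E] [Module K E]
    {φ ψ : (PathAlgebra K V)[X] →ₗ[K] E} (h : ∀ r q, φ (Polynomial.monomial r (ofPath K q)) =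
      ψ (Polynomial.monomial r (ofPath K q))) : φ = ψ :=
  LinearMap.ext fun F => poly_induction (P := fun F => φ F = ψ F) F (by rw [map_zero, map_zero])
    (fun F F' h h' => by rw [map_add, map_add, h, h'])
    (fun c F h => by rw [map_smul, map_smul, h]) h

variable (K V) in
/-- The dehomogenization of the homogeneous component of degree `m` of a polynomial. -/
def dehomogenize (m : ℕ) : (PathAlgebra K V)[X] →ₗ[K] PathAlgebra K V :=
  ∑ r ∈ Finset.range (m + 1), componentLin K V (m - r) ∘ₗ
    (Polynomial.lcoeff (PathAlgebra K V) r).restrictScalars K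

theorem coeff_dehomogenize (m : ℕ) (F : (PathAlgebra K V)[X]) (w : QPath V) :
    (dehomogenize K V m F).coeff w =
      if w.length ≤ m then (F.coeff (m - w.length)).coeff w else 0 := by
  have h : dehomogenize K V m F =
      ∑ r ∈ Finset.range (m + 1), component (m - r) (F.coeff r) := by
    rw [dehomogenize, LinearMap.sum_apply]
    rfl
  rw [h, coeff_sum]
  split_ifs with hw
  · rw [Finset.sum_eq_single (m - w.length)]
    · rw [coeff_component, if_pos (by omega)]
    · intro r hr hr'
      have := Finset.mem_range.1 hr
      rw [coeff_component, if_neg (by omega)]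
    · intro h'
      exact absurd (Finset.mem_range.2 (by omega)) h'
  · refine Finset.sum_eq_zero fun r hr => ?_
    rw [coeff_component, if_neg (by omega)]

theorem dehomogenize_mem (m : ℕ) (F : (PathAlgebra K V)[X]) :
    dehomogenize K V m F ∈ filtered K V m := by
  intro w hw
  rw [coeff_dehomogenize] at hw
  by_contra h
  exact hw (if_neg h)

theorem dehomogenize_monomial (m r : ℕ) (q : QPath V) :
    dehomogenize K V m (Polynomial.monomial r (ofPath K q)) =
      if q.length + r = m then ofPath K q else 0 := by
  refine ext_coeff fun w => ?_
  rw [coeff_dehomogenize, Polynomial.coeff_monomial]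
  by_cases hw : w = q
  · subst hw
    by_cases h : w.length + r = m
    · rw [if_pos (by omega), if_pos (by omega), if_pos h]
    · rw [if_neg h]
      split_ifs
      · omega
      · rfl
      · rfl
  · have h := coeff_ofPath_of_ne (K := K) hw
    split_ifs <;> first | rfl | exact h | exact h.symm

theorem homogenizeIn_dehomogenize {m : ℕ} {F : (PathAlgebra K V)[X]}
    (hF : F ∈ polyHomogeneous K V m) : homogenizeIn K V m (dehomogenize K V m F) = F := by
  refine Polynomial.ext fun r => ext_coeff fun w => ?_
  rw [coeff_coeff_homogenizeIn (dehomogenize_mem m F), coeff_dehomogenize]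
  by_cases h : (F.coeff r).coeff w = 0
  · split_ifs with h1 h2
    · obtain rfl : m - w.length = r := by omega
      rfl
    · exact h.symm
    · exact h.symm
  · have := hF r w h
    rw [if_pos this, if_pos (by omega)]
    obtain rfl : m - w.length = r := by omega
    rfl

theorem eval_homogenizeIn (d : ℕ) (f : PathAlgebra K V) :
    (homogenizeIn K V d f).eval 1 = f := by
  have h : ((Polynomial.leval (1 : PathAlgebra K V)).restrictScalars K) ∘ₗ homogenizeIn K V d =
      LinearMap.id := linearMap_ext fun q => by
    rw [LinearMap.comp_apply, homogenizeIn_ofPath]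
    exact (Polynomial.eval_monomial).trans (by rw [one_pow, mul_one]; rfl)
  exact LinearMap.congr_fun h f

-- A polynomial is the sum of its homogeneous components. Stating this for all large bounds provides
-- a common bound for sums.
open Filter in
theorem eventually_sum_homogenizeIn_dehomogenize (F : (PathAlgebra K V)[X]) :
    ∀ᶠ M in atTop, ∑ m ∈ Finset.range M, homogenizeIn K V m (dehomogenize K V m F) = F := by
  induction F using poly_induction with
  | h0 => exact Eventually.of_forall fun M => by simp
  | hadd F F' h h' =>
    filter_upwards [h, h'] with M h h'
    simp only [map_add, Finset.sum_add_distrib, h, h']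
  | hsmul c F h =>
    filter_upwards [h] with M h
    simp only [map_smul, ← Finset.smul_sum, h]
  | hpath r q =>
    filter_upwards [eventually_gt_atTop (q.length + r)] with M hM
    rw [Finset.sum_eq_single (q.length + r)]
    · rw [dehomogenize_monomial, if_pos rfl, homogenizeIn_ofPath, Nat.add_sub_cancel_left]
    · intro m _ hm
      rw [dehomogenize_monomial, if_neg hm.symm, map_zero]
    · intro h
      exact absurd (Finset.mem_range.2 hM) h

variable (I : TwoSidedIdeal (PathAlgebra K V))

theorem one_mem_inducedFiltration (p : ℕ) : (1 : I.QuotientAlg) ∈ (inducedFiltration I).F p :=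
  (inducedFiltration I).mono (Nat.zero_le p) (inducedFiltration I).one_mem

/-- The element of degree `1` of the Rees algebra that corresponds to the variable `t`. -/
def reesVar : (inducedFiltration I).Rees :=
  (inducedFiltration I).toRees 1 1 (one_mem_inducedFiltration I 1)

theorem reesVar_pow (r : ℕ) :
    reesVar I ^ r = (inducedFiltration I).toRees r 1 (one_mem_inducedFiltration I r) := by
  induction r with
  | zero => exact (pow_zero _).trans (inducedFiltration I).toRees_one.symm
  | succ r ih =>
    rw [pow_succ, ih, reesVar, AlgFiltration.toRees_mul]
    exact (inducedFiltration I).toRees_congr rfl (mul_one 1) _ _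

theorem commute_reesVar (f : PathAlgebra K V) : Commute (reesHom I f) (reesVar I) := by
  induction f using induction_lin with
  | h0 => rw [map_zero]; exact Commute.zero_left _
  | hadd f g hf hg => rw [map_add]; exact hf.add_left hg
  | hsmul c f hf => rw [map_smul]; exact hf.smul_left c
  | hpath q =>
    rw [reesHom_of_mem I (ofPath_mem_homogeneous q)]
    change _ * _ = _ * _
    rw [reesVar, AlgFiltration.toRees_mul, AlgFiltration.toRees_mul]
    exact (inducedFiltration I).toRees_congr (add_comm _ _) ((mul_one _).trans (one_mul _).symm) _ _

/-- The natural morphism from `R[t]` to the Rees algebra of `A`. -/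
def polyReesHom : (PathAlgebra K V)[X] →ₐ[K] (inducedFiltration I).Rees :=
  Polynomial.eval₂AlgHom (reesHom I) (reesVar I) (commute_reesVar I)

theorem polyReesHom_monomial (r : ℕ) (q : QPath V) :
    polyReesHom I (Polynomial.monomial r (ofPath K q)) =
      (inducedFiltration I).toRees (q.length + r) (I.proj K (ofPath K q))
        (proj_filtered_mem I (ofPath_mem _ (Nat.le_add_right _ _))) := by
  have h : polyReesHom I (Polynomial.monomial r (ofPath K q)) =
      reesHom I (ofPath K q) * reesVar I ^ r := Polynomial.eval₂_monomial _ _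
  rw [h, reesVar_pow, reesHom_of_mem I (ofPath_mem_homogeneous q), AlgFiltration.toRees_mul]
  exact (inducedFiltration I).toRees_congr rfl (mul_one _) _ _

theorem polyReesHom_homogenizeIn {d : ℕ} {f : PathAlgebra K V} (hf : f ∈ filtered K V d) :
    polyReesHom I (homogenizeIn K V d f) =
      (inducedFiltration I).toRees d (I.proj K f) (proj_filtered_mem I hf) := by
  refine spanPaths_induction (P := fun f hf => polyReesHom I (homogenizeIn K V d f) =
    (inducedFiltration I).toRees d (I.proj K f) (proj_filtered_mem I hf)) ?_ ?_ ?_ ?_ hf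
  · rw [map_zero, map_zero, ← (inducedFiltration I).toRees_zero d]
    exact (inducedFiltration I).toRees_congr rfl (map_zero _).symm _ _
  · intro f g hf hg h h'
    rw [map_add, map_add, h, h']
    refine (map_add ((inducedFiltration I).reesLin d) _ _).symm.trans ?_
    exact (inducedFiltration I).toRees_congr rfl (map_add (I.proj K) f g).symm _ _
  · intro c f hf h
    rw [map_smul, map_smul, h]
    refine (map_smul ((inducedFiltration I).reesLin d) c _).symm.trans ?_
    exact (inducedFiltration I).toRees_congr rfl (map_smul (I.proj K) c f).symm _ _
  · intro q hq
    rw [homogenizeIn_ofPath, polyReesHom_monomial]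
    exact (inducedFiltration I).toRees_congr (Nat.add_sub_cancel' hq) rfl _ _

/-- The coordinate of degree `m` only sees the homogeneous component of that degree, in which the
variable is replaced by `1`. Thus a polynomial in the kernel dehomogenizes into `I` degree by
degree. -/
theorem polyReesHom_apply (F : (PathAlgebra K V)[X]) (m : ℕ) :
    (polyReesHom I F m : I.QuotientAlg) = I.proj K (dehomogenize K V m F) := by
  have h : ((inducedFiltration I).F m).subtype ∘ₗ
      DirectSum.component K ℕ (fun p => (inducedFiltration I).F p) m ∘ₗ
        (polyReesHom I).toLinearMap = (I.proj K).toLinearMap ∘ₗ dehomogenize K V m := by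
    refine polyLinearMap_ext fun r q => ?_
    change (polyReesHom I (Polynomial.monomial r (ofPath K q)) m : I.QuotientAlg) =
      I.proj K (dehomogenize K V m (Polynomial.monomial r (ofPath K q)))
    rw [polyReesHom_monomial, dehomogenize_monomial]
    split_ifs with h
    · subst h
      exact (inducedFiltration I).toRees_apply_self _
    · rw [map_zero]
      exact congrArg Subtype.val ((inducedFiltration I).toRees_apply_of_ne _ (Ne.symm h))
  exact LinearMap.congr_fun h F

variable {I}

theorem polyReesHom_of_mem {p : ℕ} {F : (PathAlgebra K V)[X]} (hF : F ∈ polyHomogeneous K V p) :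
    polyReesHom I F = (inducedFiltration I).toRees p (I.proj K (F.eval 1))
      ⟨_, eval_mem_filtered hF, rfl⟩ := by
  have h := homogenizeIn_dehomogenize hF
  have h' := eval_homogenizeIn p (dehomogenize K V p F)
  rw [h] at h'
  conv_lhs => rw [← h]
  rw [polyReesHom_homogenizeIn I (dehomogenize_mem p F)]
  exact (inducedFiltration I).toRees_congr rfl (by rw [h']) _ _

theorem polyReesHom_surjective : Function.Surjective (polyReesHom I) := by
  intro y
  induction y using DirectSum.induction_on with
  | zero => exact ⟨0, map_zero _⟩
  | of p x =>
    obtain ⟨_, f, hf, rfl⟩ := x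
    exact ⟨homogenizeIn K V p f, polyReesHom_homogenizeIn I hf⟩
  | add x y hx hy =>
    obtain ⟨f, rfl⟩ := hx
    obtain ⟨g, rfl⟩ := hy
    exact ⟨f + g, map_add _ _ _⟩

theorem polyReesHom_eq_zero_of_mem {S : Set (PathAlgebra K V)} (hS : S ⊆ I) {F : (PathAlgebra K V)[X]}
    (hF : F ∈ idealHomogenize S) : polyReesHom I F = 0 := by
  have h : idealHomogenize S ≤ TwoSidedIdeal.ker (polyReesHom I) := by
    refine TwoSidedIdeal.span_le.2 ?_
    rintro _ ⟨g, hg, rfl⟩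
    refine (TwoSidedIdeal.mem_ker (polyReesHom I)).2 ?_
    rw [homogenize_eq, polyReesHom_homogenizeIn I (le_degree g),
      ← (inducedFiltration I).toRees_zero g.degree]
    exact (inducedFiltration I).toRees_congr rfl (TwoSidedIdeal.proj_eq_zero.2 (hS hg)) _ _
  exact (TwoSidedIdeal.mem_ker (polyReesHom I)).1 (h hF)

theorem dehomogenize_mem_of_polyReesHom_eq_zero {F : (PathAlgebra K V)[X]}
    (hF : polyReesHom I F = 0) (m : ℕ) : dehomogenize K V m F ∈ I := by
  rw [← TwoSidedIdeal.proj_eq_zero (K := K), ← polyReesHom_apply, hF]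
  rfl

section Groebner

variable [LinearOrder (QPath V)]

/-- The leading monomial has maximal length, so it acquires no power of `t`; other paths are smaller
whatever their power of `t`. -/
theorem IsLM.homogenize (hord : IsGradedMonomialOrder V) {g : PathAlgebra K V} {m : QPath V}
    (hg : IsLM g m) : IsPolyLM g.homogenize m 0 := by
  have hd := hg.degree_eq hord
  constructor
  · rw [homogenize_eq, coeff_coeff_homogenizeIn (le_degree g), if_pos (by omega)]
    exact hg.1
  · intro w r h
    rw [homogenize_eq, coeff_coeff_homogenizeIn (le_degree g)] at h
    split_ifs at h with hr
    · rcases (hg.2 w h).lt_or_eq with hlt | rfl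
      · exact Or.inl hlt
      · exact Or.inr ⟨rfl, by omega⟩
    · exact absurd rfl h

theorem IsPolyLM.dehomogenize {F : (PathAlgebra K V)[X]} {w : QPath V} {r : ℕ}
    (hF : IsPolyLM F w r) : IsLM (dehomogenize K V (w.length + r) F) w := by
  refine ⟨?_, fun q hq => ?_⟩
  · rw [coeff_dehomogenize, if_pos (Nat.le_add_right _ _), Nat.add_sub_cancel_left]
    exact hF.1
  · rw [coeff_dehomogenize] at hq
    split_ifs at hq
    · rcases hF.2 _ _ hq with h | h
      · exact h.le
      · exact h.1.le
    · exact absurd rfl hq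

variable [∀ a b : V, Finite (a ⟶ b)] {G : Set (PathAlgebra K V)}

theorem polyReesHom_eq_zero_iff (hord : IsGradedMonomialOrder V) (hG : IsGroebnerBasis G I)
    (F : (PathAlgebra K V)[X]) : polyReesHom I F = 0 ↔ F ∈ idealHomogenize G := by
  refine ⟨fun hF => ?_, polyReesHom_eq_zero_of_mem hG.1⟩
  obtain ⟨M, hM⟩ := (eventually_sum_homogenizeIn_dehomogenize F).exists
  rw [← hM]
  exact sum_mem fun m _ => homogenizeIn_mem_idealHomogenize hord hG
    (dehomogenize_mem_of_polyReesHom_eq_zero hF m) (dehomogenize_mem m F)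

theorem reesIsomorphism (hord : IsGradedMonomialOrder V) (hG : IsGroebnerBasis G I) :
    ReesIsomorphism I G := by
  obtain ⟨e, he⟩ := TwoSidedIdeal.exists_quotient_algEquiv (K := K) (idealHomogenize G) (polyReesHom I)
    (polyReesHom_surjective (I := I)) (polyReesHom_eq_zero_iff hord hG)
  exact ⟨e, fun p F hF => (he F).trans (polyReesHom_of_mem hF)⟩

/-- If `w t^r` is leading in `F`, dehomogenizing the component of degree `|w| + r` gives an element
of `I` with leading monomial `w`. A factor of `w` that is leading in some `g ∈ G` is also the
leading monomial of `g^*`. -/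
theorem isPolyGroebnerBasis_homogenize (hord : IsGradedMonomialOrder V)
    (hG : IsGroebnerBasis G I) :
    IsPolyGroebnerBasis (homogenize '' G) (idealHomogenize (I : Set (PathAlgebra K V))) := by
  have h1 : homogenize '' G ⊆ idealHomogenize (I : Set (PathAlgebra K V)) := by
    rintro _ ⟨g, hg, rfl⟩
    exact TwoSidedIdeal.subset_span ⟨g, hG.1 hg, rfl⟩
  refine ⟨h1, le_antisymm (TwoSidedIdeal.span_le.2 ?_) (TwoSidedIdeal.span_mono ?_)⟩
  · rintro _ ⟨F, hF, w, r, hw, rfl⟩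
    have hI := dehomogenize_mem_of_polyReesHom_eq_zero (polyReesHom_eq_zero_of_mem subset_rfl hF)
      (w.length + r)
    obtain ⟨a, b, c, d, s, m, t, ⟨g, hgG, hg⟩, rfl⟩ := hG.exists_factor hI hw.dehomogenize
    have e : Polynomial.monomial r (ofPath K (⟨a, d, (s.comp m).comp t⟩ : QPath V)) =
        Polynomial.monomial r (ofPath K ⟨a, b, s⟩) * Polynomial.monomial 0 (ofPath K ⟨b, c, m⟩) *
          Polynomial.monomial 0 (ofPath K ⟨c, d, t⟩) := by
      rw [Polynomial.monomial_mul_monomial, Polynomial.monomial_mul_monomial, ofPath_mul_comp,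
        ofPath_mul_comp, add_zero, add_zero]
    rw [e]
    exact TwoSidedIdeal.mul_mem_right _ _ _ (TwoSidedIdeal.mul_mem_left _ _ _
      (TwoSidedIdeal.subset_span ⟨_, ⟨g, hgG, rfl⟩, _, 0, hg.homogenize hord, rfl⟩))
  · rintro _ ⟨F, hF, w, r, hw, rfl⟩
    exact ⟨F, h1 hF, w, r, hw, rfl⟩

end Groebner

end PathAlgebra

/-! ### Gradings and linear forms on the two graded algebras -/

theorem DirectSum.isInternal_range_lof {K : Type*} [CommRing K] (β : ℕ → Type*)
    [∀ i, AddCommGroup (β i)] [∀ i, Module K (β i)] :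
    DirectSum.IsInternal fun i => LinearMap.range (DirectSum.lof K ℕ β i) := by
  refine DirectSum.isInternal_of_separating (E := ⨁ i, β i) _ (fun R hR x => ?_) fun q x hx hne => ?_
  · induction x using DirectSum.induction_on with
    | zero => exact zero_mem _
    | of i x => exact hR i _ ⟨x, rfl⟩
    | add x y hx hy => exact add_mem hx hy
  · obtain ⟨x, rfl⟩ := hx
    refine ⟨(DirectSum.lof K ℕ β q ∘ₗ DirectSum.component K ℕ β q).toAddMonoidHom, ?_, ?_⟩
    · change DirectSum.lof K ℕ β q (DirectSum.component K ℕ β q (DirectSum.lof K ℕ β q x)) ≠ 0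
      rwa [DirectSum.component.lof_self]
    · rintro i hi _ ⟨y, rfl⟩
      change DirectSum.lof K ℕ β q (DirectSum.component K ℕ β q (DirectSum.lof K ℕ β i y)) = 0
      rw [DirectSum.component.of, dif_neg hi, map_zero]

namespace AlgFiltration

variable {K A : Type*} [CommRing K] [Ring A] [Algebra K A] (Φ : AlgFiltration K A)

theorem isInternal_grGrading : DirectSum.IsInternal Φ.grGrading :=
  DirectSum.isInternal_range_lof Φ.GrPart

theorem isInternal_reesGrading : DirectSum.IsInternal Φ.reesGrading :=
  DirectSum.isInternal_range_lof fun p => Φ.F p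

theorem pred_le_of_lt {m n : ℕ} (h : m < n) : Φ.F m ≤ Φ.pred n := by
  cases n with
  | zero => exact absurd h (Nat.not_lt_zero _)
  | succ n => exact Φ.mono (Nat.le_of_lt_succ h)

/-- The linear form on `F_n A / F_{n-1} A` induced by a linear form on `A` that vanishes on
`F_{n-1} A`. -/
def grPartForm (φ : A →ₗ[K] K) (n : ℕ) (h : ∀ a ∈ Φ.pred n, φ a = 0) : Φ.GrPart n →ₗ[K] K :=
  ((Φ.pred n).submoduleOf (Φ.F n)).liftQ (φ ∘ₗ (Φ.F n).subtype) fun a ha => h a ha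

/-- The linear form on `G(A)` induced by a linear form on `A` that vanishes on `F_{n-1} A`. -/
def grForm (φ : A →ₗ[K] K) (n : ℕ) (h : ∀ a ∈ Φ.pred n, φ a = 0) : Φ.Gr →ₗ[K] K :=
  Φ.grPartForm φ n h ∘ₗ DirectSum.component K ℕ Φ.GrPart n

theorem grForm_toGr (φ : A →ₗ[K] K) (n : ℕ) (h) {m : ℕ} {a : A} (ha : a ∈ Φ.F m) :
    Φ.grForm φ n h (Φ.toGr m a ha) = if m = n then φ a else 0 := by
  change Φ.grPartForm φ n h (Φ.toGr m a ha n) = _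
  split_ifs with hmn
  · subst hmn
    rw [toGr_apply_self]
    rfl
  · rw [toGr_apply_of_ne Φ ha (Ne.symm hmn)]
    exact map_zero _

/-- The linear form on the Rees algebra induced by a linear form on `A`. -/
def reesForm (φ : A →ₗ[K] K) (n : ℕ) : Φ.Rees →ₗ[K] K :=
  (φ ∘ₗ (Φ.F n).subtype) ∘ₗ DirectSum.component K ℕ (fun p => Φ.F p) n

theorem reesForm_toRees (φ : A →ₗ[K] K) (n : ℕ) {m : ℕ} {a : A} (ha : a ∈ Φ.F m) :
    Φ.reesForm φ n (Φ.toRees m a ha) = if m = n then φ a else 0 := by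
  change φ (Φ.toRees m a ha n : A) = _
  split_ifs with hmn
  · subst hmn
    rw [toRees_apply_self]
  · rw [toRees_apply_of_ne Φ ha (Ne.symm hmn)]
    exact map_zero _

/-- The linear image of an element of `F_n A` lies in a submodule if this holds for a set of
elements of `F_n A` that spans the element. -/
theorem lin_mem_of_mem_span {M : Type*} [AddCommMonoid M] [Module K M] {n : ℕ}
    (L : Φ.F n →ₗ[K] M) (N : Submodule K M) {s : Set A} {a : A} (ha : a ∈ Φ.F n)
    (hs : a ∈ Submodule.span K s) (h : ∀ b ∈ s, ∃ hb : b ∈ Φ.F n, L ⟨b, hb⟩ ∈ N) :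
    L ⟨a, ha⟩ ∈ N := by
  obtain ⟨b, hb, hba⟩ := Submodule.mem_of_mem_span ((N.comap L).map (Φ.F n).subtype) hs
    fun b hb => by
      obtain ⟨hb', hbN⟩ := h b hb
      exact ⟨⟨b, hb'⟩, hbN, rfl⟩
  obtain rfl : b = ⟨a, ha⟩ := Subtype.ext hba
  exact hb

end AlgFiltration

theorem QPath.eq_of_cons_eq {V : Type*} [Quiver V] {a b c a' b' c' : V} {p : Quiver.Path a b}
    {x : b ⟶ c} {q : Quiver.Path a' b'} {y : b' ⟶ c'}
    (h : (⟨a, c, p.cons x⟩ : QPath V) = ⟨a', c', q.cons y⟩) :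
    (⟨a, b, p⟩ : QPath V) = ⟨a', b', q⟩ := by
  cases h
  rfl

/-! ### Koszulity of the associated graded algebra -/

namespace PathAlgebra

variable {K : Type u} {V : Type v} [Field K] [Quiver.{w} V] [Fintype V]
  {I : TwoSidedIdeal (PathAlgebra K V)} {G : Set (PathAlgebra K V)}

section Normal

variable [LinearOrder (QPath V)]

theorem IsNormal.of_comp_left (hord : IsGradedMonomialOrder V) {a b c : V} {s : Quiver.Path a b}
    {p : Quiver.Path b c} (h : IsNormal I ⟨a, c, s.comp p⟩) : IsNormal I ⟨b, c, p⟩ :=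
  IsNormal.of_comp hord (s := s) (t := .nil) (by rwa [Quiver.Path.comp_nil])

/-- A forbidden factor can be taken to be a leading monomial from `G`, of length at most two. It
either stops before the last letter or is contained in the last two letters. -/
theorem IsNormal.cons_cons (hord : IsGradedMonomialOrder V) (hG : IsGroebnerBasis G I)
    (h2 : G ⊆ filtered K V 2) {a b c d : V} {p : Quiver.Path a b} {x : b ⟶ c} {y : c ⟶ d}
    (h : IsNormal I ⟨a, c, p.cons x⟩) (h' : IsNormal I ⟨b, d, x.toPath.cons y⟩) :
    IsNormal I ⟨a, d, (p.cons x).cons y⟩ := by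
  intro f hf hlm
  obtain ⟨a', b', c', d', s, m, t, ⟨g, hgG, hg⟩, hw⟩ := hG.exists_factor hf hlm
  have hm : m.length ≤ 2 := h2 hgG _ hg.1
  have hn : ¬ IsNormal I ⟨b', c', m⟩ := fun h => h g (hG.1 hgG) hg
  apply hn
  cases t with
  | cons t z =>
    rw [Quiver.Path.comp_cons] at hw
    rw [QPath.eq_of_cons_eq hw] at h
    exact IsNormal.of_comp hord h
  | nil =>
    rw [Quiver.Path.comp_nil] at hw
    cases m with
    | nil =>
      cases hw
      exact IsNormal.of_comp_left hord (s := x.toPath.cons y) h'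
    | cons m z =>
      rw [Quiver.Path.comp_cons] at hw
      cases m with
      | nil =>
        cases hw
        exact IsNormal.of_comp_left hord (s := x.toPath) h'
      | cons m z' =>
        cases m with
        | nil =>
          cases hw
          exact h'
        | cons m z'' =>
          simp only [Quiver.Path.length_cons] at hm
          omega

end Normal

theorem exists_homogeneous_grHom_eq {n : ℕ} {x : (inducedFiltration I).Gr}
    (hx : x ∈ (inducedFiltration I).grGrading n) :
    ∃ f ∈ homogeneous K V n, grHom I f = x := by
  obtain ⟨y, rfl⟩ := hx
  obtain ⟨_, ⟨f, hf, rfl⟩, rfl⟩ := (inducedFiltration I).cls_surj y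
  refine ⟨component n f, component_mem n f, (grHom_of_mem I (component_mem n f)).trans ?_⟩
  refine (inducedFiltration I).toGr_eq_toGr _ _ ?_
  change I.proj K (component n f) - I.proj K f ∈ _
  rw [← map_sub, ← neg_sub f, map_neg]
  refine neg_mem (proj_mem_pred_iff.2 ⟨_, sub_component_mem_spanPaths hf, ?_⟩)
  rw [sub_self]
  exact zero_mem _

/-- The generators have degree `N`, and multiplying by paths never shortens a path. -/
theorem le_length_of_mem_idealLH {N : ℕ} (hN : IsNKoszul N (idealLH G)) {f : PathAlgebra K V}
    (hf : f ∈ idealLH G) : f ∈ spanPaths K V fun w => N ≤ w.length := by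
  obtain ⟨S, hS, hJ⟩ := hN.1
  rw [hJ] at hf
  have hl : ∀ p q r : QPath V, N ≤ q.length → p.comp? q = some r → N ≤ r.length := by
    intro p q r h h'
    rw [QPath.comp?_eq_some h']
    omega
  have hr : ∀ p q r : QPath V, N ≤ p.length → p.comp? q = some r → N ≤ r.length := by
    intro p q r h h'
    rw [QPath.comp?_eq_some h']
    omega
  have h : TwoSidedIdeal.span S ≤ pathIdeal K (fun w => N ≤ w.length) hl hr :=
    TwoSidedIdeal.span_le.2 fun g hg => mem_pathIdeal.2 fun w hw => (hS hg w hw).ge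
  exact mem_pathIdeal.1 (h hf)

section Groebner

variable [LinearOrder (QPath V)] [∀ a b : V, Finite (a ⟶ b)]

theorem normalCoeff_pred (hord : IsGradedMonomialOrder V) {p : QPath V} {x : I.QuotientAlg}
    (hx : x ∈ (inducedFiltration I).pred p.length) : normalCoeff hord I p x = 0 := by
  rcases h : p.length with _ | n
  · rw [h] at hx
    obtain rfl : x = 0 := hx
    exact map_zero _
  · rw [h] at hx
    exact normalCoeff_of_length hord (n := n) (by omega) hx

/-- The quadratic normal form of the associated graded algebra. -/
def grNormalForm (hord : IsGradedMonomialOrder V) (hG : IsGroebnerBasis G I)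
    (h2 : G ⊆ filtered K V 2) : QuadraticNormalForm V (inducedFiltration I).grGrading where
  lt p q := p < q ∧ p.length = q.length
  lt_trans h h' := ⟨h.1.trans h'.1, h.2.trans h'.2⟩
  lt_wf := Subrelation.wf (fun h => h.1) hord.wellFounded
  lt_length h := h.2
  lt_comp_left s p q h := ⟨hord.mul_left _ _ _ _ _ h.1 (QPath.comp?_mk _ _) (QPath.comp?_mk _ _), by
    have := h.2
    simp only [QPath.length, Quiver.Path.length_comp] at this ⊢
    rw [this]⟩
  lt_comp_right s p q h := ⟨hord.mul_right _ _ _ _ _ h.1 (QPath.comp?_mk _ _) (QPath.comp?_mk _ _), by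
    have := h.2
    simp only [QPath.length, Quiver.Path.length_comp] at this ⊢
    rw [this]⟩
  Nrm {a b} p := IsNormal I ⟨a, b, p⟩
  nrm_letter {a b c p x} h := IsNormal.of_comp_left hord (s := p) (p := x.toPath) h
  nrm_cons_cons h h' := h.cons_cons hord hG h2 h'
  val {a b} p := grHom I (ofPath K ⟨a, b, p⟩)
  val_comp p q := by rw [← map_mul, ofPath_mul_comp]
  val_mul_of_ne {a b c d} p q h := by
    rw [← map_mul, ofPath_mul_of_ne (p := ⟨a, b, p⟩) (q := ⟨c, d, q⟩) (Ne.symm h), map_zero]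
  sum_val := by
    rw [← map_sum]
    exact map_one (grHom I)
  val_mem {a b} p := by
    rw [grHom_of_mem I (ofPath_mem_homogeneous _)]
    exact ⟨_, rfl⟩
  span_val n x hx := by
    obtain ⟨f, hf, rfl⟩ := exists_homogeneous_grHom_eq hx
    refine (spanPaths_le (M := Submodule.comap (grHom I).toLinearMap (Submodule.span K _)) ?_) hf
    rintro ⟨a, b, p⟩ hp
    exact Submodule.subset_span ⟨a, b, p, hp, rfl⟩
  coord p := (inducedFiltration I).grForm (normalCoeff hord I p) p.length
    fun _ h => normalCoeff_pred hord h
  coord_self {a b p} h := by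
    rw [grHom_of_mem I (ofPath_mem_homogeneous _), AlgFiltration.grForm_toGr, if_pos rfl,
      normalCoeff_self hord h]
  coord_ne {a b c d p q} hp hq h := by
    rw [grHom_of_mem I (ofPath_mem_homogeneous _), AlgFiltration.grForm_toGr,
      normalCoeff_ne hord hq h, ite_self]
  reduce {a b} p hp := by
    rw [grHom_of_mem I (ofPath_mem_homogeneous _)]
    refine (inducedFiltration I).lin_mem_of_mem_span ((inducedFiltration I).grLin _) _ _
      (proj_mem_span_of_not_normal hord hp) ?_
    rintro _ ⟨⟨a', b', q⟩, hq, ⟨hlt, rfl, rfl⟩, rfl⟩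
    have hle := hord.length_le hlt.le
    have hmem := proj_mem I (ofPath_mem_homogeneous (⟨_, _, q⟩ : QPath V))
    refine ⟨(inducedFiltration I).mono hle hmem, ?_⟩
    -- Normal paths that are shorter than `p` vanish in `F_n A / F_{n-1} A` with `n = |p|`; those of
    -- equal length are comparable for the order used here.
    rcases hle.lt_or_eq with h | h
    · have h0 := (inducedFiltration I).toGr_eq_zero ((inducedFiltration I).mono hle hmem)
        ((inducedFiltration I).pred_le_of_lt h hmem)
      exact Set.mem_of_eq_of_mem h0 (zero_mem _)
    · refine Submodule.subset_span ⟨q, hq, ⟨hlt, h⟩, ?_⟩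
      rw [grHom_of_mem I (ofPath_mem_homogeneous _)]
      exact (inducedFiltration I).toGr_congr h.symm rfl _ _
  internal := (inducedFiltration I).isInternal_grGrading

theorem isKoszul_grGrading (hord : IsGradedMonomialOrder V) (hG : IsGroebnerBasis G I)
    (h2 : G ⊆ filtered K V 2) : IsKoszul (inducedFiltration I).grGrading :=
  (grNormalForm hord hG h2).isKoszul

/-! ### Berger–Ginzburg Koszulity -/

theorem idealLH_topPart_eq (hord : IsGradedMonomialOrder V) (hG : IsGroebnerBasis G I) {N : ℕ}
    (hN : IsNKoszul N (idealLH G)) {P : Set (PathAlgebra K V)} (hGP : G ⊆ P) (hPI : P ⊆ I) :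
    idealLH (topPart N P) = idealLH G := by
  refine le_antisymm ?_ (TwoSidedIdeal.span_le.2 ?_)
  · rw [idealLH_eq hord hG]
    exact TwoSidedIdeal.span_mono (Set.image_mono fun f hf => hPI hf.1)
  · rintro _ ⟨g, hg, rfl⟩
    by_cases h0 : g = 0
    · have : LH g = 0 := by
        rw [h0]
        exact map_zero (componentLin K V _)
      rw [this]
      exact zero_mem _
    · obtain ⟨w, hw⟩ := exists_isLM h0
      have h := (isLM_LH_iff hord).2 hw
      have hlen := le_length_of_mem_idealLH hN (TwoSidedIdeal.subset_span ⟨g, hg, rfl⟩) w h.1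
      exact TwoSidedIdeal.subset_span ⟨g, ⟨hGP hg, w, hw.1, hlen⟩, rfl⟩

theorem isBergerGinzburgKoszul (hord : IsGradedMonomialOrder V) (hG : IsGroebnerBasis G I) {N : ℕ}
    (h2 : 2 ≤ N) (hN : IsNKoszul N (idealLH G)) {P : Set (PathAlgebra K V)} (hGP : G ⊆ P)
    (hPI : P ⊆ I) (hP : P ⊆ filtered K V N) : IsBergerGinzburgKoszul N P I := by
  have h := idealLH_topPart_eq hord hG hN hGP hPI
  refine ⟨h2, hP, le_antisymm (TwoSidedIdeal.span_le.2 hPI) ?_, h ▸ hN,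
    naturalMapIsIso_of_idealLH_eq hord hG h⟩
  rw [← span_eq_of_isGroebnerBasis hord hG]
  exact TwoSidedIdeal.span_mono hGP

end Groebner

end PathAlgebra

/-! ## Adding a loop at every vertex -/

/-- The vertices of a quiver, when a loop is added at every vertex. -/
@[ext] structure Looped (V : Type v) : Type v where
  base : V

namespace Looped

variable {V : Type v}

/-- The vertices are unchanged. -/
def equiv (V : Type v) : V ≃ Looped V := ⟨Looped.mk, Looped.base, fun _ => rfl, fun _ => rfl⟩

instance [Fintype V] : Fintype (Looped V) := Fintype.ofEquiv V (equiv V)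

variable [Quiver.{w} V]

instance : Quiver.{w} (Looped V) :=
  ⟨fun a b => (a.base ⟶ b.base) ⊕ ULift.{w} (PLift (a = b))⟩

/-- An arrow of the given quiver. -/
def arr {a b : Looped V} (x : a.base ⟶ b.base) : a ⟶ b := Sum.inl x

/-- The loop that is added at a vertex. -/
def loop (a : Looped V) : a ⟶ a := Sum.inr ⟨⟨rfl⟩⟩

/-- The path obtained by deleting the added loops. -/
def under {a : Looped V} : ∀ {b : Looped V}, Quiver.Path a b → Quiver.Path a.base b.base
  | _, .nil => .nil
  | _, .cons p (.inl x) => (under p).cons x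
  | _, .cons p (.inr h) => (under p).cast rfl (congrArg base h.down.down)

/-- The number of pairs that consist of an arrow and of an added loop further on. -/
def inv {a : Looped V} : ∀ {b : Looped V}, Quiver.Path a b → ℕ
  | _, .nil => 0
  | _, .cons p (.inl _) => inv p
  | _, .cons p (.inr _) => inv p + (under p).length

theorem under_cons_arr {a b c : Looped V} (p : Quiver.Path a b) (x : b.base ⟶ c.base) :
    under (p.cons (arr x)) = (under p).cons x := rfl

theorem under_cons_loop {a b : Looped V} (p : Quiver.Path a b) :
    under (p.cons (loop b)) = under p := rfl

theorem inv_cons_arr {a b c : Looped V} (p : Quiver.Path a b) (x : b.base ⟶ c.base) :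
    inv (p.cons (arr x)) = inv p := rfl

theorem inv_cons_loop {a b : Looped V} (p : Quiver.Path a b) :
    inv (p.cons (loop b)) = inv p + (under p).length := rfl

theorem path_induction {a : Looped V} {P : ∀ b : Looped V, Quiver.Path a b → Prop}
    (nil : P a .nil)
    (cons_arr : ∀ (b c : Looped V) (p : Quiver.Path a b) (x : b.base ⟶ c.base),
      P b p → P c (p.cons (arr x)))
    (cons_loop : ∀ (b : Looped V) (p : Quiver.Path a b), P b p → P b (p.cons (loop b)))
    {b : Looped V} (p : Quiver.Path a b) : P b p := by
  induction p with
  | nil => exact nil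
  | cons p x ih =>
    rcases x with x | ⟨⟨h⟩⟩
    · exact cons_arr _ _ p x ih
    · obtain ⟨h⟩ := h
      cases h
      exact cons_loop _ p ih

theorem under_comp {a b c : Looped V} (p : Quiver.Path a b) (q : Quiver.Path b c) :
    under (p.comp q) = (under p).comp (under q) := by
  induction q using path_induction with
  | nil => rfl
  | cons_arr b c q x ih =>
    rw [Quiver.Path.comp_cons, under_cons_arr, under_cons_arr, ih]
    rfl
  | cons_loop b q ih => rw [Quiver.Path.comp_cons, under_cons_loop, under_cons_loop, ih]

theorem length_under_le {a b : Looped V} (p : Quiver.Path a b) : (under p).length ≤ p.length := by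
  induction p using path_induction with
  | nil => exact le_rfl
  | cons_arr b c q x ih =>
    rw [under_cons_arr, Quiver.Path.length_cons, Quiver.Path.length_cons]
    exact Nat.succ_le_succ ih
  | cons_loop b q ih =>
    rw [under_cons_loop, Quiver.Path.length_cons]
    exact Nat.le_succ_of_le ih

/-- The new inversions pair each original arrow of `p` with each added loop of `q`. -/
theorem inv_comp {a b c : Looped V} (p : Quiver.Path a b) (q : Quiver.Path b c) :
    inv (p.comp q) = inv p + inv q + (under p).length * (q.length - (under q).length) := by
  induction q using path_induction with
  | nil => rfl
  | cons_arr b c q x ih =>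
    rw [Quiver.Path.comp_cons, inv_cons_arr, inv_cons_arr, under_cons_arr, ih,
      Quiver.Path.length_cons, Quiver.Path.length_cons, Nat.add_sub_add_right]
  | cons_loop b q ih =>
    rw [Quiver.Path.comp_cons, inv_cons_loop, inv_cons_loop, under_cons_loop, ih, under_comp,
      Quiver.Path.length_comp, Quiver.Path.length_cons, Nat.succ_sub (length_under_le q), Nat.mul_succ]
    ring

/-- The path that consists of added loops only. -/
def loopPow (a : Looped V) : ℕ → Quiver.Path a a
  | 0 => .nil
  | k + 1 => (loopPow a k).cons (loop a)

/-- A path of the given quiver, after some added loops. -/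
def sorted (k : ℕ) {a : V} : ∀ {b : V}, Quiver.Path a b → Quiver.Path (⟨a⟩ : Looped V) ⟨b⟩
  | _, .nil => loopPow ⟨a⟩ k
  | _, .cons p x => (sorted k p).cons (arr x)

theorem under_loopPow (a : Looped V) (k : ℕ) : under (loopPow a k) = .nil := by
  induction k with
  | zero => rfl
  | succ k ih => rw [loopPow, under_cons_loop, ih]

theorem inv_loopPow (a : Looped V) (k : ℕ) : inv (loopPow a k) = 0 := by
  induction k with
  | zero => rfl
  | succ k ih => rw [loopPow, inv_cons_loop, ih, under_loopPow]; rfl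

theorem length_loopPow (a : Looped V) (k : ℕ) : (loopPow a k).length = k := by
  induction k with
  | zero => rfl
  | succ k ih => rw [loopPow, Quiver.Path.length_cons, ih]

theorem under_sorted (k : ℕ) {a b : V} (p : Quiver.Path a b) : under (sorted k p) = p := by
  induction p with
  | nil => exact under_loopPow ⟨a⟩ k
  | cons p x ih => rw [sorted, under_cons_arr, ih]

theorem inv_sorted (k : ℕ) {a b : V} (p : Quiver.Path a b) : inv (sorted k p) = 0 := by
  induction p with
  | nil => exact inv_loopPow ⟨a⟩ k
  | cons p x ih => rw [sorted, inv_cons_arr, ih]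

theorem length_sorted (k : ℕ) {a b : V} (p : Quiver.Path a b) :
    (sorted k p).length = k + p.length := by
  induction p with
  | nil => exact length_loopPow ⟨a⟩ k
  | cons p x ih => rw [sorted, Quiver.Path.length_cons, ih, Quiver.Path.length_cons, add_assoc]

theorem exists_eq_loopPow {a b : Looped V} (p : Quiver.Path a b) (h : (under p).length = 0) :
    ∃ k, (⟨a, b, p⟩ : QPath (Looped V)) = ⟨a, a, loopPow a k⟩ := by
  induction p using path_induction with
  | nil => exact ⟨0, rfl⟩
  | cons_arr b c p x ih => cases h
  | cons_loop b p ih =>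
    obtain ⟨k, hk⟩ := ih h
    cases hk
    exact ⟨k + 1, rfl⟩

/-- Without inversions no arrow precedes a loop, so all loops stand at the beginning. -/
theorem eq_sorted {a b : Looped V} (p : Quiver.Path a b) (h : inv p = 0) :
    ∃ k, p = sorted k (under p) := by
  induction p using path_induction with
  | nil => exact ⟨0, rfl⟩
  | cons_arr b c p x ih =>
    obtain ⟨k, hk⟩ := ih h
    exact ⟨k, congrArg (fun q : Quiver.Path a b => q.cons (arr x)) hk⟩
  | cons_loop b p ih =>
    rw [inv_cons_loop, Nat.add_eq_zero_iff] at h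
    obtain ⟨k, hk⟩ := exists_eq_loopPow p h.2
    cases hk
    exact ⟨k + 1, by rw [under_cons_loop, under_loopPow]; rfl⟩

/-- The path obtained by deleting the added loops. -/
def underQ (p : QPath (Looped V)) : QPath V := ⟨p.src.base, p.tgt.base, under p.path⟩

theorem length_underQ_le (p : QPath (Looped V)) : (underQ p).length ≤ p.length :=
  length_under_le p.path

theorem ext_of_inv {p q : QPath (Looped V)} (hp : inv p.path = 0) (hq : inv q.path = 0)
    (h : underQ p = underQ q) (hl : p.length = q.length) : p = q := by
  obtain ⟨⟨a⟩, ⟨b⟩, p⟩ := p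
  obtain ⟨⟨c⟩, ⟨d⟩, q⟩ := q
  obtain ⟨k, hk⟩ := eq_sorted p hp
  obtain ⟨l, hl'⟩ := eq_sorted q hq
  change (⟨a, b, under p⟩ : QPath V) = ⟨c, d, under q⟩ at h
  have h1 : p.length = q.length := hl
  generalize under p = p' at *
  generalize under q = q' at *
  cases h
  subst hk hl'
  rw [length_sorted, length_sorted, Nat.add_right_cancel_iff] at h1
  rw [h1]

end Looped

/-! ### Koszulity of the Rees algebra through paths with loops -/

namespace PathAlgebra

open Looped

variable {K : Type u} {V : Type v} [Field K] [Quiver.{w} V] [Fintype V]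
  {I : TwoSidedIdeal (PathAlgebra K V)} {G : Set (PathAlgebra K V)}

variable (I) in
/-- The element of the Rees algebra given by a path with loops; a loop stands for the variable. -/
def loopedVal (p : QPath (Looped V)) : (inducedFiltration I).Rees :=
  polyReesHom I (Polynomial.monomial (p.length - (underQ p).length) (ofPath K (underQ p)))

theorem loopedVal_eq (p : QPath (Looped V)) :
    loopedVal I p = (inducedFiltration I).toRees p.length (I.proj K (ofPath K (underQ p)))
      (proj_filtered_mem I (ofPath_mem _ (length_underQ_le p))) := by
  rw [loopedVal, polyReesHom_monomial]
  exact (inducedFiltration I).toRees_congr (Nat.add_sub_cancel' (length_underQ_le p)) rfl _ _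

theorem loopedVal_comp {a b c : Looped V} (p : Quiver.Path a b) (q : Quiver.Path b c) :
    loopedVal I ⟨a, c, p.comp q⟩ = loopedVal I ⟨a, b, p⟩ * loopedVal I ⟨b, c, q⟩ := by
  have e : underQ ⟨a, c, p.comp q⟩ = ⟨a.base, c.base, (under p).comp (under q)⟩ := by
    rw [underQ, under_comp]
  have hp := length_under_le p
  have hq := length_under_le q
  rw [loopedVal, loopedVal, loopedVal, ← map_mul, Polynomial.monomial_mul_monomial, e, underQ,
    underQ, ofPath_mul_comp]
  have hl : (⟨a, c, p.comp q⟩ : QPath (Looped V)).length -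
      (⟨a.base, c.base, (under p).comp (under q)⟩ : QPath V).length =
      ((⟨a, b, p⟩ : QPath (Looped V)).length - (⟨a.base, b.base, under p⟩ : QPath V).length) +
      ((⟨b, c, q⟩ : QPath (Looped V)).length - (⟨b.base, c.base, under q⟩ : QPath V).length) := by
    simp only [QPath.length, Quiver.Path.length_comp]
    omega
  rw [hl]

theorem loopedVal_mul_of_ne {p q : QPath (Looped V)} (h : q.src ≠ p.tgt) :
    loopedVal I p * loopedVal I q = 0 := by
  rw [loopedVal, loopedVal, ← map_mul, Polynomial.monomial_mul_monomial,
    ofPath_mul_of_ne (fun h' => h (Looped.ext h')), map_zero, map_zero]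

theorem sum_loopedVal_nil : ∑ a : Looped V, loopedVal I ⟨a, a, .nil⟩ = 1 := by
  rw [← (Looped.equiv V).sum_comp, ← map_one (polyReesHom I), ← Polynomial.C_1,
    ← Polynomial.monomial_zero_left]
  change _ = polyReesHom I (Polynomial.monomial 0 (∑ a : V, ofPath K (QPath.vertex a)))
  rw [map_sum, map_sum]
  rfl

theorem mem_span_loopedVal {n : ℕ} {x : (inducedFiltration I).Rees}
    (hx : x ∈ (inducedFiltration I).reesGrading n) :
    x ∈ Submodule.span K {s | ∃ p : QPath (Looped V), p.length = n ∧ s = loopedVal I p} := by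
  obtain ⟨⟨_, f, hf, rfl⟩, rfl⟩ := hx
  have h : polyReesHom I (homogenizeIn K V n f) ∈ Submodule.span K
      {s | ∃ p : QPath (Looped V), p.length = n ∧ s = loopedVal I p} := by
    refine (spanPaths_le (M := Submodule.comap ((polyReesHom I).toLinearMap ∘ₗ homogenizeIn K V n)
      (Submodule.span K _)) ?_) hf
    rintro ⟨a, b, p⟩ hp
    -- A path of length at most `n` is padded with loops to length exactly `n`, in agreement with
    -- its homogenization in degree `n`.
    have hl : (⟨⟨a⟩, ⟨b⟩, sorted (n - p.length) p⟩ : QPath (Looped V)).length = n := by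
      have hp' : p.length ≤ n := hp
      change (sorted (n - p.length) p).length = n
      rw [length_sorted]
      omega
    refine Submodule.subset_span ⟨⟨⟨a⟩, ⟨b⟩, sorted (n - p.length) p⟩, hl, ?_⟩
    rw [loopedVal, hl, underQ, under_sorted]
    change polyReesHom I (homogenizeIn K V n (ofPath K ⟨a, b, p⟩)) = _
    rw [homogenizeIn_ofPath]
  rw [polyReesHom_homogenizeIn I hf] at h
  exact h

section Order

variable [LinearOrder (QPath V)]

/-- The order on the paths with loops. -/
def LoopedLT (p q : QPath (Looped V)) : Prop :=
  p.length = q.length ∧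
    (underQ p < underQ q ∨ underQ p = underQ q ∧ inv p.path < inv q.path)

theorem LoopedLT.comp_left (hord : IsGradedMonomialOrder V) {a b c c' : Looped V}
    (s : Quiver.Path a b) {p : Quiver.Path b c} {q : Quiver.Path b c'}
    (h : LoopedLT ⟨b, c, p⟩ ⟨b, c', q⟩) : LoopedLT ⟨a, c, s.comp p⟩ ⟨a, c', s.comp q⟩ := by
  obtain ⟨hl, h⟩ := h
  have hl' : p.length = q.length := hl
  refine ⟨?_, ?_⟩
  · change (s.comp p).length = (s.comp q).length
    rw [Quiver.Path.length_comp, Quiver.Path.length_comp, hl']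
  simp only [underQ, under_comp, inv_comp] at h ⊢
  rcases h with h | ⟨h, h'⟩
  · exact Or.inl (hord.mul_left _ _ _ _ _ h (QPath.comp?_mk _ _) (QPath.comp?_mk _ _))
  · right
    obtain ⟨c⟩ := c
    obtain ⟨c'⟩ := c'
    generalize under p = p' at *
    generalize under q = q' at *
    cases h
    refine ⟨rfl, ?_⟩
    rw [hl']
    omega

theorem LoopedLT.comp_right (hord : IsGradedMonomialOrder V) {a b c : Looped V}
    (s : Quiver.Path b c) {p q : Quiver.Path a b} (h : LoopedLT ⟨a, b, p⟩ ⟨a, b, q⟩) :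
    LoopedLT ⟨a, c, p.comp s⟩ ⟨a, c, q.comp s⟩ := by
  obtain ⟨hl, h⟩ := h
  have hl' : p.length = q.length := hl
  refine ⟨?_, ?_⟩
  · change (p.comp s).length = (q.comp s).length
    rw [Quiver.Path.length_comp, Quiver.Path.length_comp, hl']
  simp only [underQ, under_comp, inv_comp] at h ⊢
  rcases h with h | ⟨h, h'⟩
  · exact Or.inl (hord.mul_right _ _ _ _ _ h (QPath.comp?_mk _ _) (QPath.comp?_mk _ _))
  · right
    generalize under p = p' at *
    generalize under q = q' at *
    cases h
    refine ⟨rfl, ?_⟩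
    omega

variable (I) in
/-- A path with loops is normal if its loops are at its beginning and its other arrows form a
normal path. -/
def IsLoopedNormal {a b : Looped V} (p : Quiver.Path a b) : Prop :=
  IsNormal I (underQ ⟨a, b, p⟩) ∧ inv p = 0

theorem IsLoopedNormal.of_comp (hord : IsGradedMonomialOrder V) {a b c : Looped V}
    {p : Quiver.Path a b} {q : Quiver.Path b c} (h : IsLoopedNormal I (p.comp q)) :
    IsLoopedNormal I q := by
  obtain ⟨h, h'⟩ := h
  rw [inv_comp] at h'
  rw [underQ, under_comp] at h
  exact ⟨IsNormal.of_comp_left hord h, by omega⟩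

/-- An arrow followed by a loop is never normal, and two arrows are the case of the original quiver.
If `x` is a loop, normality of `px` leaves only loops in `p`, and adding either an arrow or a loop
preserves sortedness. -/
theorem IsLoopedNormal.cons_cons (hord : IsGradedMonomialOrder V) (hG : IsGroebnerBasis G I)
    (h2 : G ⊆ filtered K V 2) {a b c d : Looped V} {p : Quiver.Path a b} {x : b ⟶ c} {y : c ⟶ d}
    (h : IsLoopedNormal I (p.cons x)) (h' : IsLoopedNormal I (x.toPath.cons y)) :
    IsLoopedNormal I ((p.cons x).cons y) := by
  rcases x with x | ⟨⟨⟨e⟩⟩⟩ <;> rcases y with y | ⟨⟨⟨e'⟩⟩⟩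
  · exact ⟨IsNormal.cons_cons hord hG h2 h.1 h'.1, h.2⟩
  · exact absurd h'.2 (Nat.succ_ne_zero _)
  · cases e
    have h0 : inv p + (under p).length = 0 := h.2
    refine ⟨?_, h0⟩
    have hn : IsNormal I ⟨b.base, d.base, Quiver.Path.nil.cons y⟩ := h'.1
    obtain ⟨k, hk⟩ := exists_eq_loopPow p (by omega)
    cases hk
    change IsNormal I ⟨a.base, d.base, (under (loopPow a k)).cons y⟩
    rwa [under_loopPow]
  · cases e
    cases e'
    have h0 : inv p + (under p).length = 0 := h.2
    refine ⟨h.1, ?_⟩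
    change inv p + (under p).length + (under p).length = 0
    omega

variable [∀ a b : V, Finite (a ⟶ b)]

theorem wellFounded_loopedLT (hord : IsGradedMonomialOrder V) :
    WellFounded (LoopedLT : QPath (Looped V) → QPath (Looped V) → Prop) :=
  Subrelation.wf (fun h => Prod.lex_def.2 h.2)
    (InvImage.wf (fun p : QPath (Looped V) => (underQ p, inv p.path))
      (hord.wellFounded.prod_lex Nat.lt_wfRel.wf))

/-- There are two ways to fail normality. If only the loops are out of place, moving them to the
front gives the same element with fewer inversions. Otherwise the underlying path is reduced in `A`,
and the shorter or equal paths that result are padded with loops to the original length. -/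
theorem loopedVal_mem_span (hord : IsGradedMonomialOrder V) {a b : Looped V} (p : Quiver.Path a b)
    (hp : ¬ IsLoopedNormal I p) : loopedVal I ⟨a, b, p⟩ ∈
      Submodule.span K {s | ∃ q : Quiver.Path a b, IsLoopedNormal I q ∧
        LoopedLT ⟨a, b, q⟩ ⟨a, b, p⟩ ∧ s = loopedVal I ⟨a, b, q⟩} := by
  obtain ⟨a⟩ := a
  obtain ⟨b⟩ := b
  -- The candidate is `q` preceded by as many loops as the length of `p` requires.
  have key : ∀ q : Quiver.Path a b, IsNormal I ⟨a, b, q⟩ → q.length ≤ p.length →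
      ((⟨a, b, q⟩ : QPath V) < ⟨a, b, under p⟩ ∨ q = under p ∧ 0 < inv p) →
      ∃ q' : Quiver.Path (⟨a⟩ : Looped V) ⟨b⟩, IsLoopedNormal I q' ∧
        LoopedLT ⟨_, _, q'⟩ ⟨_, _, p⟩ ∧ under q' = q := by
    intro q hq hl hlt
    have hu := under_sorted (p.length - q.length) q
    refine ⟨sorted (p.length - q.length) q, ⟨?_, inv_sorted _ q⟩, ⟨?_, ?_⟩, hu⟩
    · rwa [underQ, hu]
    · change (sorted (p.length - q.length) q).length = p.length
      rw [length_sorted]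
      omega
    · rw [inv_sorted, underQ, hu]
      rcases hlt with h | ⟨rfl, h⟩
      · exact Or.inl h
      · exact Or.inr ⟨rfl, h⟩
  by_cases hn : IsNormal I (underQ ⟨_, _, p⟩)
  · obtain ⟨q, hq, hlt, hu⟩ := key (under p) hn (length_under_le p)
      (Or.inr ⟨rfl, Nat.pos_of_ne_zero fun h => hp ⟨hn, h⟩⟩)
    refine Submodule.subset_span ⟨q, hq, hlt, ?_⟩
    rw [loopedVal_eq, loopedVal_eq]
    exact (inducedFiltration I).toRees_congr hlt.1.symm (by rw [underQ, underQ, hu]) _ _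
  · rw [loopedVal_eq]
    refine (inducedFiltration I).lin_mem_of_mem_span ((inducedFiltration I).reesLin _) _ _
      (proj_mem_span_of_not_normal hord hn) ?_
    rintro _ ⟨⟨a', b', q⟩, hq, ⟨hlt, rfl, rfl⟩, rfl⟩
    have hle : q.length ≤ p.length := (hord.length_le hlt.le).trans (length_under_le p)
    refine ⟨proj_filtered_mem I (ofPath_mem _ hle), ?_⟩
    obtain ⟨q', hq', hlt', hu⟩ := key q hq hle (Or.inl hlt)
    refine Submodule.subset_span ⟨q', hq', hlt', ?_⟩
    rw [loopedVal_eq]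
    exact (inducedFiltration I).toRees_congr hlt'.1.symm (by rw [underQ, hu]) _ _

/-- The quadratic normal form of the Rees algebra. -/
def reesNormalForm (hord : IsGradedMonomialOrder V) (hG : IsGroebnerBasis G I)
    (h2 : G ⊆ filtered K V 2) :
    QuadraticNormalForm (Looped V) (S := (inducedFiltration I).Rees)
      (inducedFiltration I).reesGrading where
  lt := LoopedLT
  lt_trans h h' := by
    refine ⟨h.1.trans h'.1, ?_⟩
    rcases h.2 with h1 | h1 <;> rcases h'.2 with h2 | h2
    · exact Or.inl (h1.trans h2)
    · exact Or.inl (h2.1 ▸ h1)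
    · exact Or.inl (h1.1 ▸ h2)
    · exact Or.inr ⟨h1.1.trans h2.1, h1.2.trans h2.2⟩
  lt_wf := wellFounded_loopedLT hord
  lt_length h := h.1
  lt_comp_left s _ _ h := h.comp_left hord s
  lt_comp_right s _ _ h := h.comp_right hord s
  Nrm p := IsLoopedNormal I p
  nrm_letter {_ _ _ p x} h := IsLoopedNormal.of_comp hord (p := p) (q := x.toPath) h
  nrm_cons_cons h h' := h.cons_cons hord hG h2 h'
  val {a b} p := loopedVal I ⟨a, b, p⟩
  val_comp p q := loopedVal_comp p q
  val_mul_of_ne p q h := loopedVal_mul_of_ne (Ne.symm h)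
  sum_val := sum_loopedVal_nil
  val_mem p := by
    rw [loopedVal_eq]
    exact ⟨_, rfl⟩
  span_val n x hx := by
    refine Submodule.span_mono ?_ (mem_span_loopedVal hx)
    rintro _ ⟨⟨a, b, p⟩, hp, rfl⟩
    exact ⟨a, b, p, hp, rfl⟩
  coord p := (inducedFiltration I).reesForm (normalCoeff hord I (underQ p)) p.length
  coord_self h := by
    rw [loopedVal_eq, AlgFiltration.reesForm_toRees, if_pos rfl, normalCoeff_self hord h.1]
  coord_ne hp hq h := by
    rw [loopedVal_eq, AlgFiltration.reesForm_toRees]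
    split_ifs with hl
    · exact normalCoeff_ne hord hq.1 fun h' => h (ext_of_inv hp.2 hq.2 h' hl.symm)
    · rfl
  reduce p hp := loopedVal_mem_span hord p hp
  internal := (inducedFiltration I).isInternal_reesGrading

theorem isKoszul_reesGrading (hord : IsGradedMonomialOrder V) (hG : IsGroebnerBasis G I)
    (h2 : G ⊆ filtered K V 2) :
    IsKoszul (S := (inducedFiltration I).Rees) (inducedFiltration I).reesGrading :=
  (reesNormalForm hord hG h2).isKoszul

end Order

end PathAlgebra

end

theorem mainTheorem7 {K V : Type*} [Field K] [Quiver V] [Fintype V]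
    [∀ a b : V, Finite (a ⟶ b)] [LinearOrder (QPath V)] (hord : PathAlgebra.IsGradedMonomialOrder V)
    (I : TwoSidedIdeal (PathAlgebra K V)) (G : Set (PathAlgebra K V))
    (hG : PathAlgebra.IsGroebnerBasis G I) :
    (PathAlgebra.HasGeneralPBW I G ∧
      PathAlgebra.IsGroebnerBasis (PathAlgebra.LH '' G)
        (PathAlgebra.idealLH (I : Set (PathAlgebra K V)))) ∧
    (G ⊆ PathAlgebra.filtered K V 2 → IsKoszul (PathAlgebra.inducedFiltration I).grGrading) ∧
    (∀ N : ℕ, 2 ≤ N → G ⊆ PathAlgebra.filtered K V N →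
      PathAlgebra.IsNKoszul N (PathAlgebra.idealLH G) →
        ∀ P : Set (PathAlgebra K V), G ⊆ P → P ⊆ I → P ⊆ PathAlgebra.filtered K V N →
          PathAlgebra.IsBergerGinzburgKoszul N P I) ∧
    (PathAlgebra.ReesIsomorphism I G ∧
      PathAlgebra.IsPolyGroebnerBasis (PathAlgebra.homogenize '' G)
        (PathAlgebra.idealHomogenize (I : Set (PathAlgebra K V)))) ∧
    (G ⊆ PathAlgebra.filtered K V 2 →
      IsKoszul (S := (PathAlgebra.inducedFiltration I).Rees)
        (PathAlgebra.inducedFiltration I).reesGrading) :=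
  ⟨⟨⟨PathAlgebra.span_eq_of_isGroebnerBasis hord hG,
        PathAlgebra.naturalMapIsIso_of_idealLH_eq hord hG rfl⟩,
      PathAlgebra.isGroebnerBasis_LH hord hG⟩,
    PathAlgebra.isKoszul_grGrading hord hG,
    fun _ hN _ hK _ hGP hPI hP => PathAlgebra.isBergerGinzburgKoszul hord hG hN hK hGP hPI hP,
    ⟨PathAlgebra.reesIsomorphism hord hG, PathAlgebra.isPolyGroebnerBasis_homogenize hord hG⟩,
    PathAlgebra.isKoszul_reesGrading hord hG⟩
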